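/- Let $M$ be a connected smooth four-dimensional manifold with a smooth Lorentzian metric $g_{ab}$ and a smooth symmetric (torsion-free) linear connection $\nabla$ with coefficients $\Gamma^c_{\ ab}$ and Ricci tensor $R_{ab}=\partial_c\Gamma^c_{\ ab}-\partial_b\Gamma^c_{\ ac}+\Gamma^c_{\ cd}\Gamma^d_{\ ab}-\Gamma^c_{\ bd}\Gamma^d_{\ ac}$; put $R:=g^{ab}R_{ab}$. Let $f:\mathbb R\to\mathbb R$ be smooth and assume that $f'(R)\neq0$ everywhere on $M$. Put $\Phi:=\ln|f'(R)|$ (which is $\ln f'$ if $f'(R)>0$). Call $(g,\Gamma)$ *Palatini-critical* if the action $\int\sqrt{-g}\,f\bigl(g^{ab}R_{ab}(\Gamma)\bigr)\,\mathrm d^4y$ over every compact region of a coordinate domain is stationary under all independent smooth variations of $g^{ab}$ and $\Gamma^c_{\ ab}=\Gamma^c_{\ ba}$ supported in that region. Call $(M,g,\nabla)$ a *Weyl space* with one-form $Q$ if $\nabla_cg_{ab}=-Q_cg_{ab}$, and call it *genuine* if $Q$ is not the gradient of a smooth function on $M$. Given a smooth one-form $Q$ and a smooth tensor field $\Lambda_c^{\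 ab}=\Lambda_c^{\ ba}$ (Lagrange multiplier), call $(g,\Gamma,\Lambda)$ *$Q$-constrained critical* if it is in the same sense stationary, under independent variations of $g^{ab},\Gamma^c_{\ ab},\Lambda_c^{\ ab}$ with $Q$ fixed, for $$\int\sqrt{-g}\,\Bigl\{f\bigl(g^{ab}R_{ab}(\Gamma)\bigr)+\Lambda_c^{\ ab}\Bigl[\Gamma^c_{\ ab}-\bigl\{{}^{\,c}_{ab}\bigr\}-\tfrac12g^{cd}\bigl(Q_bg_{ad}+Q_ag_{db}-Q_dg_{ab}\bigr)\Bigr]\Bigr\}\,\mathrm d^4y ,$$ where $\bigl\{{}^{\,c}_{ab}\bigr\}$ are the Christoffel symbols of $g$. Then: 1. $(g,\Gamma)$ is Palatini-critical if and only if $$f'(R)R_{(ab)}-\tfrac12f(R)g_{ab}=0\quad\text{and}\quad\nabla_c\bigl(f'(R)\sqrt{-g}\,g^{ab}\bigr)=0 .$$ 2. $(g,\Gamma)$ is Palatini-critical if and only if the following three conditions hold: $\Gamma$ is the Levi-Civita connection of $f'(R)g_{ab}$; $f'(R)R=2f(R)$ on $M$; and $R_{ab}=k\,f'(R)\,g_{ab}$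 for some constant $k$ (so that $f'(R)g_{ab}$ is an Einstein metric). 3. $\Phi$ is smooth. If $(g,\Gamma)$ is Palatini-critical, then $(M,g,\nabla)$ has the form of a Weyl space with $Q_a=\nabla_a\Phi$, and the conformal transformation $\widetilde g_{ab}=e^{\Phi}g_{ab}=|f'(R)|\,g_{ab}$, $\widetilde Q_a=Q_a-\nabla_a\Phi$ gives $\widetilde Q_a=0$: $\nabla$ is the Levi-Civita connection of the Lorentzian metric $\widetilde g$, and $(M,\widetilde g)$ is an Einstein space, $\widetilde R_{ab}=\widetilde k\,\widetilde g_{ab}$ with $\widetilde k$ constant. If moreover the set of roots $\rho$ of $f'(\rho)\rho=2f(\rho)$ is totally disconnected, then $R$ is constant and equal to one of these roots $\rho$, $\nabla$ is the Levi-Civita connection of $g$, and $g$ itself is Einstein with Ricci tensor $\tfrac{\rho}{4}g_{ab}$. 4. The Palatini method is the special choice $Q_a=\nabla_a\Phi$ of the constrained formalism: $\nabla_a\Phi$ is a smooth one-form, and for $Q_a=\nabla_a\Phi$, $(g,\Gamma)$ is Palatini-critical if and only if $(g,\Gamma,\Lambda)$ is $Q$-constrained critical for some $\Lambda$. For any $Q$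 and any $Q$-constrained critical $(g,\Gamma,\Lambda)$, the conditions "$(g,\Gamma)$ is Palatini-critical", "$Q_a=\nabla_a\Phi$" and "$\Lambda=0$" are equivalent. 5. The Palatini method cannot describe genuine Weyl spaces: if $(M,g,\nabla)$ is a Weyl space with one-form $Q$ and $(g,\Gamma)$ is Palatini-critical, then $Q_a=\nabla_a\Phi$; hence a genuine Weyl space is never Palatini-critical. -/

import Mathlib

open MeasureTheory
open scoped Manifold ContDiff

noncomputable section

/-! ## Coordinates, and fields in coordinates

Space-time is a smooth four-dimensional manifold `M`. Tensor fields and connections are described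
classically, by their components in every chart of the smooth structure, the components in
overlapping charts being related by the transformation law of the object. -/

/-- The coordinate space. -/
abbrev Coord : Type := EuclideanSpace ℝ (Fin 4)

/-- The partial derivative `∂_a F` of a real function of the coordinates. -/
def pd (a : Fin 4) (F : Coord → ℝ) (y : Coord) : ℝ :=
  fderiv ℝ F y (EuclideanSpace.single a 1)

section Charts

variable (M : Type*) [TopologicalSpace M] [ChartedSpace Coord M]

/-- `e` is an admissible chart of the smooth manifold `M`. -/
abbrev IsChart (e : OpenPartialHomeomorph M Coord) : Prop :=
  e ∈ IsManifold.maximalAtlas (𝓡 4) ∞ M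

variable {M}

/-- The `k`-th new coordinate (chart `e'`) as a function of the old coordinates (chart `e`). -/
def transition (e e' : OpenPartialHomeomorph M Coord) (k : Fin 4) (y : Coord) : ℝ :=
  e' (e.symm y) k

/-- The Jacobian matrix `∂ y'^k / ∂ y^a` at the point `x`, where `y` are the coordinates of the
chart `e` and `y'` those of the chart `e'`. -/
def jac (e e' : OpenPartialHomeomorph M Coord) (x : M) (k a : Fin 4) : ℝ :=
  pd a (transition e e' k) (e x)

end Charts

/-! ### Local expressions -/

/-- The symbols `½ h^{cd} (∂_b h_{ad} + ∂_a h_{db} - ∂_d h_{ab})`, as a function of `c a b`. -/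
def christoffel (h : Coord → Matrix (Fin 4) (Fin 4) ℝ) (y : Coord) (c a b : Fin 4) : ℝ :=
  (1 / 2) * ∑ d, (h y)⁻¹ c d *
    (pd b (fun z => h z a d) y + pd a (fun z => h z d b) y - pd d (fun z => h z a b) y)

/-- The Ricci tensor
`R_{ab} = ∂_c Γ^c_{ab} - ∂_b Γ^c_{ac} + Γ^c_{cd} Γ^d_{ab} - Γ^c_{bd} Γ^d_{ac}`
of a connection with coefficients `Γ^c_{ab} = Γ y c a b`. -/
def ricci (Γ : Coord → Fin 4 → Fin 4 → Fin 4 → ℝ) (y : Coord) (a b : Fin 4) : ℝ :=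
  ∑ c, (pd c (fun z => Γ z c a b) y - pd b (fun z => Γ z c a c) y) +
    ∑ c, ∑ d, (Γ y c c d * Γ y d a b - Γ y c b d * Γ y d a c)

/-- The scalar `g^{ab} R_{ab}(Γ)`. -/
def localScalar (g : Coord → Matrix (Fin 4) (Fin 4) ℝ)
    (Γ : Coord → Fin 4 → Fin 4 → Fin 4 → ℝ) (y : Coord) : ℝ :=
  ∑ a, ∑ b, (g y)⁻¹ a b * ricci Γ y a b

/-- `√(-g)`. -/
def volDensity (g : Coord → Matrix (Fin 4) (Fin 4) ℝ) (y : Coord) : ℝ :=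
  √(-(g y).det)

/-- The metric-affine Lagrangian density `√(-g) f(g^{ab} R_{ab}(Γ))`. -/
def palatiniDensity (f : ℝ → ℝ) (g : Coord → Matrix (Fin 4) (Fin 4) ℝ)
    (Γ : Coord → Fin 4 → Fin 4 → Fin 4 → ℝ) (y : Coord) : ℝ :=
  volDensity g y * f (localScalar g Γ y)

/-- The Weyl constraint density
`√(-g) Λ_c^{ab} [Γ^c_{ab} - {c; ab} - ½ g^{cd} (Q_b g_{ad} + Q_a g_{db} - Q_d g_{ab})]`,
with `Λ_c^{ab} = L y c a b`. -/
def weylConstraintDensity (Q : Coord → Fin 4 → ℝ) (g : Coord → Matrix (Fin 4) (Fin 4) ℝ)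
    (Γ L : Coord → Fin 4 → Fin 4 → Fin 4 → ℝ) (y : Coord) : ℝ :=
  volDensity g y * ∑ c, ∑ a, ∑ b, L y c a b *
    (Γ y c a b - christoffel g y c a b -
      (1 / 2) * ∑ d, (g y)⁻¹ c d * (Q y b * g y a d + Q y a * g y d b - Q y d * g y a b))

/-- The metric whose contravariant components are `g^{ab} + t δg^{ab}`. -/
def varyMetric (g δg : Coord → Matrix (Fin 4) (Fin 4) ℝ) (t : ℝ) :
    Coord → Matrix (Fin 4) (Fin 4) ℝ :=
  fun y => ((g y)⁻¹ + t • δg y)⁻¹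

/-- The variation `A + t δA` of a field with three indices. -/
def vary (A δA : Coord → Fin 4 → Fin 4 → Fin 4 → ℝ) (t : ℝ) :
    Coord → Fin 4 → Fin 4 → Fin 4 → ℝ :=
  fun y c a b => A y c a b + t * δA y c a b

/-- A smooth symmetric variation of the contravariant metric, supported in `K`. -/
def IsMetricVariation (K : Set Coord) (δg : Coord → Matrix (Fin 4) (Fin 4) ℝ) : Prop :=
  ∀ a b, ContDiff ℝ ∞ (fun y => δg y a b) ∧ tsupport (fun y => δg y a b) ⊆ K ∧
    ∀ y, δg y a b = δg y b a

/-- A smooth variation, supported in `K`, of a field with three indices which is symmetric in the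
last two of them. -/
def IsSymVariation (K : Set Coord) (δA : Coord → Fin 4 → Fin 4 → Fin 4 → ℝ) : Prop :=
  ∀ c a b, ContDiff ℝ ∞ (fun y => δA y c a b) ∧ tsupport (fun y => δA y c a b) ⊆ K ∧
    ∀ y, δA y c a b = δA y c b a

/-! ## Fields on the manifold -/

section Fields

variable (M : Type*) [TopologicalSpace M] [ChartedSpace Coord M]

/-- A smooth Lorentzian metric `g_{ab}` of signature `(- + + +)`. -/
structure LorentzMetric where
  /-- The matrix `g_{ab}` in the chart `e`, as a function of the coordinates of `e`. -/
  comp : OpenPartialHomeomorph M Coord → Coord → Matrix (Fin 4) (Fin 4) ℝ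
  smooth : ∀ e, IsChart M e → ∀ a b, ContDiffOn ℝ ∞ (fun y => comp e y a b) e.target
  symm : ∀ e, IsChart M e → ∀ y ∈ e.target, ∀ a b, comp e y a b = comp e y b a
  lorentzian : ∀ e, IsChart M e → ∀ y ∈ e.target, ∃ P : Matrix (Fin 4) (Fin 4) ℝ,
    IsUnit P.det ∧ P.transpose * comp e y * P = Matrix.diagonal ![-1, 1, 1, 1]
  transform : ∀ e, IsChart M e → ∀ e', IsChart M e' → ∀ x ∈ e.source ∩ e'.source, ∀ a b,
    comp e (e x) a b = ∑ i, ∑ j, jac e e' x i a * jac e e' x j b * comp e' (e' x) i j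

/-- A smooth symmetric (torsion-free) linear connection `Γ^c_{ab} = comp e y c a b`. -/
structure SymConnection where
  comp : OpenPartialHomeomorph M Coord → Coord → Fin 4 → Fin 4 → Fin 4 → ℝ
  smooth : ∀ e, IsChart M e → ∀ c a b, ContDiffOn ℝ ∞ (fun y => comp e y c a b) e.target
  symm : ∀ e, IsChart M e → ∀ y ∈ e.target, ∀ c a b, comp e y c a b = comp e y c b a
  transform : ∀ e, IsChart M e → ∀ e', IsChart M e' → ∀ x ∈ e.source ∩ e'.source, ∀ k a b,
    ∑ c, jac e e' x k c * comp e (e x) c a b =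
      ∑ i, ∑ j, jac e e' x i a * jac e e' x j b * comp e' (e' x) k i j +
        pd a (pd b (transition e e' k)) (e x)

/-- A smooth one-form `Q_a`. -/
structure OneForm where
  comp : OpenPartialHomeomorph M Coord → Coord → Fin 4 → ℝ
  smooth : ∀ e, IsChart M e → ∀ a, ContDiffOn ℝ ∞ (fun y => comp e y a) e.target
  transform : ∀ e, IsChart M e → ∀ e', IsChart M e' → ∀ x ∈ e.source ∩ e'.source, ∀ a,
    comp e (e x) a = ∑ i, jac e e' x i a * comp e' (e' x) i

/-- A smooth field of Lagrange multipliers: a tensor field `Λ_c^{ab} = comp e y c a b`, symmetric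
in `a` and `b`. -/
structure Multiplier where
  comp : OpenPartialHomeomorph M Coord → Coord → Fin 4 → Fin 4 → Fin 4 → ℝ
  smooth : ∀ e, IsChart M e → ∀ c a b, ContDiffOn ℝ ∞ (fun y => comp e y c a b) e.target
  symm : ∀ e, IsChart M e → ∀ y ∈ e.target, ∀ c a b, comp e y c a b = comp e y c b a
  transform : ∀ e, IsChart M e → ∀ e', IsChart M e' → ∀ x ∈ e.source ∩ e'.source, ∀ c a b,
    comp e (e x) c a b = ∑ k, ∑ i, ∑ j,
      jac e e' x k c * jac e' e x a i * jac e' e x b j * comp e' (e' x) k i j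

variable {M}

/-- The scalar curvature `R = g^{ab} R_{ab}(Γ)` as a function on `M`, computed at each point in the
preferred chart there (it is a scalar, so that any other chart gives the same value). -/
def scalarCurvature (g : LorentzMetric M) (Γ : SymConnection M) (p : M) : ℝ :=
  localScalar (g.comp (chartAt Coord p)) (Γ.comp (chartAt Coord p)) (chartAt Coord p p)

/-- `Q_a = ∂_a Φ`. -/
def OneForm.IsGradientOf (Q : OneForm M) (Φ : M → ℝ) : Prop :=
  ∀ e, IsChart M e → ∀ y ∈ e.target, ∀ a, Q.comp e y a = pd a (fun z => Φ (e.symm z)) y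

/-- The multiplier vanishes identically. -/
def Multiplier.IsZero (L : Multiplier M) : Prop :=
  ∀ e, IsChart M e → ∀ y ∈ e.target, ∀ c a b, L.comp e y c a b = 0

/-- `Γ` is the Levi-Civita connection of the metric `u g_{ab}`, for a nowhere zero function `u`. -/
def IsLeviCivitaOfScaled (u : M → ℝ) (g : LorentzMetric M) (Γ : SymConnection M) : Prop :=
  ∀ e, IsChart M e → ∀ y ∈ e.target, ∀ c a b,
    Γ.comp e y c a b = christoffel (fun z => u (e.symm z) • g.comp e z) y c a b

/-- `Γ` is the Levi-Civita connection of the metric `g_{ab}`. -/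
def IsLeviCivita (g : LorentzMetric M) (Γ : SymConnection M) : Prop :=
  ∀ e, IsChart M e → ∀ y ∈ e.target, ∀ c a b,
    Γ.comp e y c a b = christoffel (g.comp e) y c a b

/-- `(M, g, Γ)` is a Weyl space with Weyl one-form `Q`, that is, `∇_c g_{ab} = - Q_c g_{ab}`. -/
def IsWeylSpace (g : LorentzMetric M) (Q : OneForm M) (Γ : SymConnection M) : Prop :=
  ∀ e, IsChart M e → ∀ y ∈ e.target, ∀ c a b,
    pd c (fun z => g.comp e z a b) y -
        ∑ d, (Γ.comp e y d c a * g.comp e y d b + Γ.comp e y d c b * g.comp e y a d) =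
      - Q.comp e y c * g.comp e y a b

/-- The conformal (gauge) transformation `g̃_{ab} = exp(Φ) g_{ab}`, `Q̃_a = Q_a - ∂_a Φ` of a Weyl
space; `exp(Φ)` is the squared conformal factor `Ω²`. -/
def IsWeylGaugeTransform (Φ : M → ℝ) (g : LorentzMetric M) (Q : OneForm M)
    (g' : LorentzMetric M) (Q' : OneForm M) : Prop :=
  ∀ e, IsChart M e → ∀ y ∈ e.target,
    (∀ a b, g'.comp e y a b = Real.exp (Φ (e.symm y)) * g.comp e y a b) ∧
    (∀ a, Q'.comp e y a = Q.comp e y a - pd a (fun z => Φ (e.symm z)) y)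

/-- The one-form vanishes identically. -/
def OneForm.IsZero (Q : OneForm M) : Prop :=
  ∀ e, IsChart M e → ∀ y ∈ e.target, ∀ a, Q.comp e y a = 0

/-- `(M, g)` is an Einstein space with constant `k`: the Ricci tensor of the Levi-Civita connection
of `g` is `k g_{ab}`. -/
def IsEinsteinSpace (k : ℝ) (g : LorentzMetric M) : Prop :=
  ∀ e, IsChart M e → ∀ y ∈ e.target, ∀ a b,
    ricci (christoffel (g.comp e)) y a b = k * g.comp e y a b

/-! ## The two variational principles

The action over a compact region `K` of a coordinate domain is the coordinate integral of the
Lagrangian density. The fields are critical if the first variation of the action vanishes for all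
smooth variations supported in the region. -/

/-- The pair `(g, Γ)` is critical for the unconstrained Einstein--Palatini action
`∫ √(-g) f(g^{ab} R_{ab}(Γ)) d⁴y`: `g^{ab}` and `Γ^c_{ab}` are varied independently. -/
def IsPalatiniCritical (f : ℝ → ℝ) (g : LorentzMetric M) (Γ : SymConnection M) : Prop :=
  ∀ e, IsChart M e → ∀ K : Set Coord, IsCompact K → K ⊆ e.target →
    ∀ δg δΓ, IsMetricVariation K δg → IsSymVariation K δΓ →
      HasDerivAt (fun t : ℝ => ∫ y in K,
        palatiniDensity f (varyMetric (g.comp e) δg t) (vary (Γ.comp e) δΓ t) y) 0 0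

/-- The triple `(g, Γ, Λ)` is critical for the action of the constrained first-order formalism of
Weyl geometry with given one-form `Q`: the Weyl constraint density is added to the Lagrangian
density, and `g^{ab}`, `Γ^c_{ab}`, `Λ_c^{ab}` are varied independently. -/
def IsConstrainedCritical (f : ℝ → ℝ) (Q : OneForm M) (g : LorentzMetric M)
    (Γ : SymConnection M) (L : Multiplier M) : Prop :=
  ∀ e, IsChart M e → ∀ K : Set Coord, IsCompact K → K ⊆ e.target →
    ∀ δg δΓ δL, IsMetricVariation K δg → IsSymVariation K δΓ → IsSymVariation K δL →
      HasDerivAt (fun t : ℝ => ∫ y in K,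
        (palatiniDensity f (varyMetric (g.comp e) δg t) (vary (Γ.comp e) δΓ t) y +
          weylConstraintDensity (Q.comp e) (varyMetric (g.comp e) δg t) (vary (Γ.comp e) δΓ t)
            (vary (L.comp e) δL t) y)) 0 0

/-- The equation `f'(R) R_{(ab)} - ½ f(R) g_{ab} = 0`. -/
def MetricEquation (f : ℝ → ℝ) (g : LorentzMetric M) (Γ : SymConnection M) : Prop :=
  ∀ e, IsChart M e → ∀ y ∈ e.target, ∀ a b,
    deriv f (localScalar (g.comp e) (Γ.comp e) y) *
        ((ricci (Γ.comp e) y a b + ricci (Γ.comp e) y b a) / 2) -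
      (1 / 2) * f (localScalar (g.comp e) (Γ.comp e) y) * g.comp e y a b = 0

/-- The tensor density `f'(R) √(-g) g^{ab}` of weight one. -/
def gothicMetric (f : ℝ → ℝ) (g : Coord → Matrix (Fin 4) (Fin 4) ℝ)
    (Γ : Coord → Fin 4 → Fin 4 → Fin 4 → ℝ) (a b : Fin 4) (y : Coord) : ℝ :=
  deriv f (localScalar g Γ y) * volDensity g y * (g y)⁻¹ a b

/-- The equation `∇_c (f'(R) √(-g) g^{ab}) = 0`, where
`∇_c H^{ab} = ∂_c H^{ab} + Γ^a_{cd} H^{db} + Γ^b_{cd} H^{ad} - Γ^d_{cd} H^{ab}` for a tensor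
density of weight one. -/
def ConnectionEquation (f : ℝ → ℝ) (g : LorentzMetric M) (Γ : SymConnection M) : Prop :=
  ∀ e, IsChart M e → ∀ y ∈ e.target, ∀ c a b,
    pd c (gothicMetric f (g.comp e) (Γ.comp e) a b) y +
      ∑ d, (Γ.comp e y a c d * gothicMetric f (g.comp e) (Γ.comp e) d b y +
        Γ.comp e y b c d * gothicMetric f (g.comp e) (Γ.comp e) a d y -
        Γ.comp e y d c d * gothicMetric f (g.comp e) (Γ.comp e) a b y) = 0

/-- The function `ln |f'(R)|` on `M` (`Real.log x` is `ln |x|` for `x ≠ 0`). -/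
def logConformalFactor (f : ℝ → ℝ) (g : LorentzMetric M) (Γ : SymConnection M) (p : M) : ℝ :=
  Real.log (deriv f (scalarCurvature g Γ p))

end Fields

end

/-!
Everything is reduced to pointwise statements about the components in an arbitrary chart.

*First variation.* On a compact `K` inside the chart domain the Lagrangian density depends smoothly
on the variation parameter and the coordinates jointly, so the action may be differentiated under
the integral (`hasDerivAt_setIntegral`). With `H^{ab} = f'(R) √(-g) g^{ab}`, the derivative of the
density is `√(-g) (f' R_{ab} - ½ f g_{ab}) δg^{ab} + H^{ab} δR_{ab}`, and `H^{ab} δR_{ab}` is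
`(-∇_c H^{ab} + δ_c^b ∇_d H^{ad}) δΓ^c_{ab}` up to the divergence of a current supported in `K`
(`sum_mul_ricciVariation`, `hasDerivAt_action`). The fundamental lemma of the calculus of variations
gives the symmetrized Euler--Lagrange equations, and taking a trace shows that the one for `δΓ` is
equivalent to `∇_c H^{ab} = 0` (`densityDeriv_eq_zero_iff`).

*The connection equation.* In dimension four, `H^{ab}` is `√(-h) h^{ab}` for `h = f'(R) g`. Hence
`∇_c H^{ab} = 0`, "`Γ` is the Levi-Civita connection of `f'(R) g`", the same for `|f'(R)| g`, and
the Weyl equation with `Q = dΦ`, `Φ = ln |f'(R)|`, all say `∇_c g_{ab} = -∂_c Φ g_{ab}`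
(`gothic_equation_iff`, `christoffel_smul_iff`, `weylDefect_eq_zero_iff`). As `g` is nondegenerate,
a one-form `Q` with `∇_c g_{ab} = -Q_c g_{ab}` is unique, which settles the statements on Weyl
spaces.

*The Einstein constant.* The trace of the metric equation is `G(R) = 0` with
`G(ρ) = f'(ρ) ρ - 2 f(ρ)`; with the symmetry of the Ricci tensor of a Levi-Civita connection it
gives `R_{ab} = ¼ R g_{ab}`. No Bianchi identity is needed for the constancy of the factor between
the Ricci tensor and `f'(R) g`: from `G'(R) dR = d(G(R)) = 0` and
`d(R / f'(R)) = -G'(R) dR / f'(R)²` the quotient `R / f'(R)` is constant on the connected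
manifold `M` (`comp_scalarCurvature_const`). That `R` is a well defined smooth function on `M` rests on the
tensor property of the Ricci tensor, obtained by treating the coordinate change as a gauge
transformation of the connection matrices (`ricci_transform`).

*The constrained principle.* Varying `Λ` returns the Weyl constraint, and varying `Γ` says that
`√(-g) Λ_c^{ab}` is minus the symmetrized expression that belongs to `δΓ`. So `Λ = 0` is equivalent
to the connection equation, and by the above to `Q = dΦ`; for `Λ = 0` the variation of the metric
is the one of the Palatini action. Conversely, at `Λ = 0` and with the Weyl constraint satisfied
the constraint term is of second order in the variation parameter.
-/

section Calculus

open Filter Topology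

/-! ### Partial derivatives -/

lemma pd_congr {F G : Coord → ℝ} {y : Coord} (a : Fin 4) (h : F =ᶠ[𝓝 y] G) :
    pd a F y = pd a G y := by
  unfold pd; rw [h.fderiv_eq]

lemma pd_add {F G : Coord → ℝ} {y : Coord} (a : Fin 4) (hF : DifferentiableAt ℝ F y)
    (hG : DifferentiableAt ℝ G y) :
    pd a (fun z => F z + G z) y = pd a F y + pd a G y := by
  unfold pd; rw [fderiv_fun_add hF hG]; rfl

lemma pd_sum {ι : Type*} {s : Finset ι} {F : ι → Coord → ℝ} {y : Coord} (a : Fin 4)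
    (hF : ∀ i ∈ s, DifferentiableAt ℝ (F i) y) :
    pd a (fun z => ∑ i ∈ s, F i z) y = ∑ i ∈ s, pd a (F i) y := by
  unfold pd; rw [fderiv_fun_sum hF]; simp

lemma pd_mul {F G : Coord → ℝ} {y : Coord} (a : Fin 4) (hF : DifferentiableAt ℝ F y)
    (hG : DifferentiableAt ℝ G y) :
    pd a (fun z => F z * G z) y = pd a F y * G y + F y * pd a G y := by
  unfold pd; rw [fderiv_fun_mul hF hG]; simp; ring

lemma pd_const_mul {F : Coord → ℝ} {y : Coord} (a : Fin 4) (r : ℝ)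
    (hF : DifferentiableAt ℝ F y) :
    pd a (fun z => r * F z) y = r * pd a F y := by
  unfold pd; rw [fderiv_const_mul hF]; simp

lemma pd_const (a : Fin 4) (r : ℝ) (y : Coord) : pd a (fun _ => r) y = 0 := by
  simp [pd]

lemma pd_real_comp {F : Coord → ℝ} {y : Coord} {φ : ℝ → ℝ} (a : Fin 4)
    (hφ : DifferentiableAt ℝ φ (F y)) (hF : DifferentiableAt ℝ F y) :
    pd a (fun z => φ (F z)) y = deriv φ (F y) * pd a F y := by
  unfold pd
  have := (hφ.hasDerivAt.comp_hasFDerivAt y hF.hasFDerivAt).fderiv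
  change (fderiv ℝ (φ ∘ F) y) _ = _
  rw [this]; simp

lemma ContDiffAt.pd {F : Coord → ℝ} {y : Coord} (hF : ContDiffAt ℝ ∞ F y) (a : Fin 4) :
    ContDiffAt ℝ ∞ (_root_.pd a F) y := by
  unfold _root_.pd
  exact (hF.fderiv_right (m := ∞) (by simp)).clm_apply contDiffAt_const

lemma pd_comm {F : Coord → ℝ} {y : Coord} (hF : ContDiffAt ℝ ∞ F y) (a b : Fin 4) :
    pd a (pd b F) y = pd b (pd a F) y := by
  have hs : IsSymmSndFDerivAt ℝ F y := hF.isSymmSndFDerivAt (by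
    simp only [minSmoothness_of_isRCLikeNormedField]
    exact WithTop.coe_le_coe.2 le_top)
  have hd : DifferentiableAt ℝ (fderiv ℝ F) y :=
    (hF.fderiv_right (m := ∞) (by simp)).differentiableAt (by simp)
  have key : ∀ v w : Coord, fderiv ℝ (fun z => fderiv ℝ F z v) y w =
      fderiv ℝ (fderiv ℝ F) y w v := fun v w => by
    rw [fderiv_clm_apply hd (differentiableAt_const v)]; simp
  change fderiv ℝ (fun z => fderiv ℝ F z _) y _ = fderiv ℝ (fun z => fderiv ℝ F z _) y _
  rw [key, key]; exact hs _ _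

/-- A partial derivative in the coordinates depends smoothly on a further parameter. -/
lemma contDiffAt_pd_param {G : ℝ × Coord → ℝ} {p : ℝ × Coord} (hG : ContDiffAt ℝ ∞ G p)
    (a : Fin 4) : ContDiffAt ℝ ∞ (fun q : ℝ × Coord => pd a (fun z => G (q.1, z)) q.2) p := by
  have h1 : ContDiffAt ℝ ∞ (fun q => fderiv ℝ G q (0, EuclideanSpace.single a 1)) p :=
    (hG.fderiv_right (m := ∞) (by simp)).clm_apply contDiffAt_const
  refine h1.congr_of_eventuallyEq ?_
  have h2 : ∀ᶠ q in 𝓝 p, ContDiffAt ℝ 1 G q :=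
    (hG.of_le (by exact_mod_cast le_top)).eventually (by simp)
  filter_upwards [h2] with q hq
  have hq' : HasFDerivAt G (fderiv ℝ G q) (q.1, q.2) := (hq.differentiableAt (by simp)).hasFDerivAt
  have h3 : HasFDerivAt (fun z : Coord => (q.1, z)) (ContinuousLinearMap.inr ℝ ℝ Coord) q.2 :=
    hasFDerivAt_prodMk_right _ _
  have := (hq'.comp q.2 h3).fderiv
  unfold pd
  change (fderiv ℝ (G ∘ fun z : Coord => (q.1, z)) q.2) _ = _
  rw [this]; simp

/-! ### Smoothness and derivatives of determinants and inverse matrices -/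

section MatrixCalculus

variable {E : Type*} [NormedAddCommGroup E] [NormedSpace ℝ E] {n : Type*} [Fintype n]
  [DecidableEq n] {A : E → Matrix n n ℝ} {x : E}

lemma contDiffAt_det (h : ∀ i j, ContDiffAt ℝ ∞ (fun z => A z i j) x) :
    ContDiffAt ℝ ∞ (fun z => (A z).det) x := by
  simp only [Matrix.det_apply]
  refine ContDiffAt.sum fun σ _ => ContDiffAt.const_smul _ ?_
  exact contDiffAt_prod fun i _ => h _ _

lemma contDiffAt_adjugate (h : ∀ i j, ContDiffAt ℝ ∞ (fun z => A z i j) x) (i j : n) :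
    ContDiffAt ℝ ∞ (fun z => (A z).adjugate i j) x := by
  simp only [Matrix.adjugate_apply]
  refine contDiffAt_det fun k l => ?_
  by_cases hk : k = j
  · subst hk; simpa using contDiffAt_const
  · simpa [Matrix.updateRow_ne hk] using h k l

lemma contDiffAt_matrix_inv (h : ∀ i j, ContDiffAt ℝ ∞ (fun z => A z i j) x) (hd : (A x).det ≠ 0)
    (i j : n) : ContDiffAt ℝ ∞ (fun z => (A z)⁻¹ i j) x := by
  simp only [Matrix.inv_def, Ring.inverse_eq_inv', Matrix.smul_apply, smul_eq_mul]
  exact ((contDiffAt_det h).inv hd).mul (contDiffAt_adjugate h i j)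

/-- Jacobi's formula: `d det A = tr (adj A · dA)`. -/
lemma hasFDerivAt_det {A' : n → n → E →L[ℝ] ℝ}
    (h : ∀ i j, HasFDerivAt (fun z => A z i j) (A' i j) x) :
    HasFDerivAt (fun z => (A z).det) (∑ i, ∑ j, (A x).adjugate i j • A' j i) x := by
  simp only [Matrix.det_apply']
  have h1 : HasFDerivAt (fun z => ∑ σ : Equiv.Perm n, ((Equiv.Perm.sign σ : ℤ) : ℝ) *
      ∏ i, A z (σ i) i) (∑ σ : Equiv.Perm n, ((Equiv.Perm.sign σ : ℤ) : ℝ) •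
        ∑ i, (∏ j ∈ Finset.univ.erase i, A x (σ j) j) • A' (σ i) i) x :=
    HasFDerivAt.fun_sum fun σ _ => (HasFDerivAt.finsetProd fun i _ => h (σ i) i).const_mul _
  convert! h1 using 1
  ext v
  simp only [sum_apply, smul_apply, smul_eq_mul,
    Finset.mul_sum]
  rw [Finset.sum_comm (s := (Finset.univ : Finset (Equiv.Perm n)))]
  refine Finset.sum_congr rfl fun i _ => ?_
  have h2 := congrFun (Matrix.cramer_eq_adjugate_mulVec (A x) (fun j => A' j i v)) i
  rw [Matrix.cramer_apply, Matrix.mulVec, dotProduct] at h2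
  rw [← h2, Matrix.det_apply']
  refine Finset.sum_congr rfl fun σ _ => ?_
  rw [← Finset.mul_prod_erase _ _ (Finset.mem_univ i)]
  rw [Matrix.updateCol_self]
  have : ∏ k ∈ Finset.univ.erase i, (A x).updateCol i (fun j => A' j i v) (σ k) k =
      ∏ k ∈ Finset.univ.erase i, A x (σ k) k :=
    Finset.prod_congr rfl fun k hk => by
      rw [Matrix.updateCol_ne (Finset.ne_of_mem_erase hk)]
  rw [this]; ring

end MatrixCalculus

/-! ### Integrals depending on a parameter, and integration by parts -/

/-- Differentiation under an integral over a compact set. -/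
lemma hasDerivAt_setIntegral {F : ℝ × Coord → ℝ} {K : Set Coord} (hK : IsCompact K)
    (hF : ∀ y ∈ K, ContDiffAt ℝ ∞ F (0, y)) {D : Coord → ℝ}
    (hD : ∀ y ∈ K, HasDerivAt (fun t => F (t, y)) (D y) 0) :
    HasDerivAt (fun t => ∫ y in K, F (t, y)) (∫ y in K, D y) 0 := by
  have h1 : ∀ y ∈ K, ∀ᶠ q in 𝓝 ((0 : ℝ), y), ContDiffAt ℝ 1 F q := fun y hy =>
    ((hF y hy).of_le (by exact_mod_cast le_top)).eventually (by simp)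
  obtain ⟨U, V, hU, hV, h0U, hKV, hUV⟩ := generalized_tube_lemma (s := {(0 : ℝ)})
    isCompact_singleton hK (n := {q | ∀ᶠ p in 𝓝 q, ContDiffAt ℝ 1 F p})
    isOpen_setOfPred_eventually_nhds (by rintro ⟨t, y⟩ ⟨ht, hy⟩; cases ht; exact h1 y hy)
  have hC : ∀ t ∈ U, ∀ y ∈ V, ContDiffAt ℝ 1 F (t, y) := fun t ht y hy =>
    (hUV (Set.mk_mem_prod ht hy)).self_of_nhds
  obtain ⟨ε, hε, hεU⟩ := Metric.nhds_basis_closedBall.mem_iff.1 (hU.mem_nhds (h0U rfl))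
  have hder : ∀ t ∈ U, ∀ y ∈ V, HasDerivAt (fun s => F (s, y)) (fderiv ℝ F (t, y) (1, 0)) t := by
    intro t ht y hy
    have h2 : HasFDerivAt F (fderiv ℝ F (t, y)) (t, y) :=
      ((hC t ht y hy).differentiableAt (by simp)).hasFDerivAt
    have h3 : HasDerivAt (fun s : ℝ => (s, y)) ((1 : ℝ), (0 : Coord)) t :=
      (hasDerivAt_id t).prodMk (hasDerivAt_const t y)
    exact h2.comp_hasDerivAt t h3
  have hcont : ContinuousOn (fun q => fderiv ℝ F q ((1 : ℝ), (0 : Coord)))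
      (Metric.closedBall 0 ε ×ˢ K) := by
    rintro ⟨t, y⟩ ⟨ht, hy⟩
    have := ((hC t (hεU ht) y (hKV hy)).fderiv_right (m := 0) (by simp)).continuousAt
    exact (this.clm_apply continuousAt_const).continuousWithinAt
  obtain ⟨C, hCb⟩ := ((isCompact_closedBall (0 : ℝ) ε).prod hK).exists_bound_of_continuousOn hcont
  have hFc : ∀ t ∈ U, ContinuousOn (fun y => F (t, y)) K := fun t ht y hy =>
    ((hC t ht y (hKV hy)).continuousAt.comp
      (f := fun z : Coord => (t, z)) (by fun_prop)).continuousWithinAt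
  have hDc : ContinuousOn (fun y => fderiv ℝ F ((0 : ℝ), y) ((1 : ℝ), (0 : Coord))) K := by
    refine hcont.comp (f := fun y => ((0 : ℝ), y)) (by fun_prop) fun y hy => ⟨?_, hy⟩
    simp [hε.le]
  have hmeas := hK.measurableSet
  have main := (hasDerivAt_integral_of_dominated_loc_of_deriv_le
    (μ := volume.restrict K) (F := fun t y => F (t, y))
    (F' := fun t y => fderiv ℝ F (t, y) ((1 : ℝ), (0 : Coord))) (x₀ := (0 : ℝ))
    (s := Metric.closedBall 0 ε) (bound := fun _ => C)
    (Metric.closedBall_mem_nhds _ hε)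
    (by filter_upwards [hU.mem_nhds (h0U rfl)] with t ht
        exact (hFc t ht).aestronglyMeasurable hmeas)
    ((hFc 0 (h0U rfl)).integrableOn_compact hK)
    (hDc.aestronglyMeasurable hmeas)
    (by filter_upwards [ae_restrict_mem hmeas] with y hy t ht
        exact hCb (t, y) ⟨ht, hy⟩)
    (by have : IsFiniteMeasure (volume.restrict K) := ⟨by simpa using hK.measure_lt_top⟩
        exact integrable_const C)
    (by filter_upwards [ae_restrict_mem hmeas] with y hy t ht
        exact hder t (hεU ht) y (hKV hy))).2
  have hDe : ∫ y in K, D y = ∫ y in K, fderiv ℝ F ((0 : ℝ), y) ((1 : ℝ), (0 : Coord)) :=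
    setIntegral_congr_fun hmeas fun y hy => (hD y hy).unique (hder 0 (h0U rfl) y (hKV hy))
  rw [hDe]; exact main

/-- A product of a function smooth on an open set and a test function supported in a compact
subset of it is smooth everywhere. -/
lemma contDiff_mul_of_tsupport {H φ : Coord → ℝ} {U : Set Coord}
    (hH : ∀ y ∈ U, ContDiffAt ℝ ∞ H y) (hφ : ContDiff ℝ ∞ φ) (hs : tsupport φ ⊆ U) :
    ContDiff ℝ ∞ (fun y => H y * φ y) := by
  refine contDiff_iff_contDiffAt.2 fun y => ?_
  by_cases hy : y ∈ tsupport φ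
  · exact (hH y (hs hy)).mul hφ.contDiffAt
  · have : (fun y => H y * φ y) =ᶠ[𝓝 y] fun _ => 0 := by
      filter_upwards [notMem_tsupport_iff_eventuallyEq.1 hy] with z hz
      simp [hz]
    exact contDiffAt_const.congr_of_eventuallyEq this

lemma tsupport_pd_subset (a : Fin 4) (φ : Coord → ℝ) : tsupport (pd a φ) ⊆ tsupport φ := by
  refine closure_minimal (fun y hy => ?_) (isClosed_tsupport _)
  by_contra h
  refine hy ?_
  have := notMem_tsupport_iff_eventuallyEq.1 h
  rw [pd_congr a this]
  exact pd_const a 0 y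

lemma pd_eq_zero_of_notMem_tsupport (a : Fin 4) {φ : Coord → ℝ} {y : Coord}
    (hy : y ∉ tsupport φ) : pd a φ y = 0 :=
  image_eq_zero_of_notMem_tsupport fun h => hy (tsupport_pd_subset a φ h)

/-- A total derivative does not contribute to the integral over a set containing the support. -/
lemma setIntegral_pd_eq_zero {P : Coord → ℝ} {K : Set Coord} (hK : IsCompact K)
    (hP : ContDiff ℝ ∞ P) (hs : tsupport P ⊆ K) (a : Fin 4) : ∫ y in K, pd a P y = 0 := by
  have hc : HasCompactSupport P := hK.of_isClosed_subset (isClosed_tsupport _) hs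
  have hcd : HasCompactSupport (pd a P) :=
    hK.of_isClosed_subset (isClosed_tsupport _) ((tsupport_pd_subset a P).trans hs)
  have hpc : Continuous (pd a P) := continuous_iff_continuousAt.2 fun y =>
    (hP.contDiffAt.pd a).continuousAt
  rw [setIntegral_eq_integral_of_forall_compl_eq_zero fun y hy =>
    pd_eq_zero_of_notMem_tsupport a fun h => hy (hs h)]
  have := integral_mul_fderiv_eq_neg_fderiv_mul_of_integrable (μ := (volume : Measure Coord))
    (f := fun _ : Coord => (1 : ℝ)) (g := P) (v := EuclideanSpace.single a 1)
    (by simp) (by simpa using! hpc.integrable_of_hasCompactSupport hcd)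
    (by simpa using hP.continuous.integrable_of_hasCompactSupport hc)
    (fun _ _ => differentiableAt_const _)
    (fun _ _ => hP.contDiffAt.differentiableAt (by simp))
  simpa using! this

/-- The fundamental lemma of the calculus of variations. -/
lemma eq_zero_of_forall_setIntegral_mul_eq_zero {U : Set Coord} (hU : IsOpen U) {A : Coord → ℝ}
    (hA : ContinuousOn A U)
    (h : ∀ K : Set Coord, IsCompact K → K ⊆ U → ∀ φ : Coord → ℝ, ContDiff ℝ ∞ φ →
      tsupport φ ⊆ K → ∫ y in K, A y * φ y = 0) : ∀ y ∈ U, A y = 0 := by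
  have h1 : ∀ᵐ y ∂(volume : Measure Coord), y ∈ U → A y = 0 := by
    refine hU.ae_eq_zero_of_integral_contDiff_smul_eq_zero
      (hA.locallyIntegrableOn hU.measurableSet) fun φ hφ hc hs => ?_
    rw [← h _ hc hs φ hφ subset_rfl, setIntegral_eq_integral_of_forall_compl_eq_zero]
    · simp [mul_comm]
    · intro y hy; simp [image_eq_zero_of_notMem_tsupport hy]
  have h2 : A =ᵐ[volume.restrict U] fun _ => (0 : ℝ) :=
    (ae_restrict_iff' hU.measurableSet).2 h1
  exact Measure.eqOn_open_of_ae_eq h2 hU hA continuousOn_const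

end Calculus

section Covariance

open Filter Topology

/-! ### Covariance of the Ricci tensor under a change of coordinates -/

/-- The chain rule in coordinates. -/
lemma pd_comp {τ : Coord → Coord} {F : Coord → ℝ} {y : Coord} (a : Fin 4)
    (hF : DifferentiableAt ℝ F (τ y)) (hτ : DifferentiableAt ℝ τ y) :
    pd a (fun z => F (τ z)) y = ∑ i, pd a (fun z => τ z i) y * pd i F (τ y) := by
  have h1 := (hF.hasFDerivAt.comp y hτ.hasFDerivAt).fderiv
  have h2 : ∀ i, pd a (fun z => τ z i) y = fderiv ℝ τ y (EuclideanSpace.single a 1) i := by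
    intro i
    have := ((EuclideanSpace.proj (𝕜 := ℝ) i).hasFDerivAt.comp y hτ.hasFDerivAt).fderiv
    unfold pd
    change fderiv ℝ (⇑(EuclideanSpace.proj (𝕜 := ℝ) i) ∘ τ) y _ = _
    rw [this]; rfl
  have h3 : ∀ w : Coord, w = ∑ i, w i • EuclideanSpace.single i (1 : ℝ) := by
    intro w
    ext k
    simp [Finset.sum_apply, Pi.single_apply]
  change fderiv ℝ (F ∘ τ) y _ = _
  rw [h1, ContinuousLinearMap.comp_apply, h3 (fderiv ℝ τ y (EuclideanSpace.single a 1)), map_sum]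
  refine Finset.sum_congr rfl fun i _ => ?_
  rw [map_smul, h2, smul_eq_mul]; rfl

/-- The entrywise partial derivative of a matrix valued function. -/
noncomputable def mpd (c : Fin 4) (A : Coord → Matrix (Fin 4) (Fin 4) ℝ) (y : Coord) :
    Matrix (Fin 4) (Fin 4) ℝ :=
  Matrix.of fun i j => pd c (fun z => A z i j) y

lemma mpd_mul {A B : Coord → Matrix (Fin 4) (Fin 4) ℝ} {y : Coord} (c : Fin 4)
    (hA : ∀ i j, DifferentiableAt ℝ (fun z => A z i j) y)
    (hB : ∀ i j, DifferentiableAt ℝ (fun z => B z i j) y) :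
    mpd c (fun z => A z * B z) y = mpd c A y * B y + A y * mpd c B y := by
  ext i j
  simp only [mpd, Matrix.mul_apply, Matrix.add_apply, Matrix.of_apply]
  rw [pd_sum c fun k _ => (hA i k).fun_mul (hB k j), ← Finset.sum_add_distrib]
  exact Finset.sum_congr rfl fun k _ => pd_mul c (hA i k) (hB k j)

lemma mpd_add {A B : Coord → Matrix (Fin 4) (Fin 4) ℝ} {y : Coord} (c : Fin 4)
    (hA : ∀ i j, DifferentiableAt ℝ (fun z => A z i j) y)
    (hB : ∀ i j, DifferentiableAt ℝ (fun z => B z i j) y) :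
    mpd c (fun z => A z + B z) y = mpd c A y + mpd c B y := by
  ext i j
  exact pd_add c (hA i j) (hB i j)

lemma mpd_congr {A B : Coord → Matrix (Fin 4) (Fin 4) ℝ} {y : Coord} (c : Fin 4)
    (h : A =ᶠ[𝓝 y] B) : mpd c A y = mpd c B y := by
  ext i j
  exact pd_congr c (h.mono fun z hz => congrFun (congrFun hz i) j)

/-- The matrix `(Γ_b)^c_a = Γ^c_{ab}` of the connection form in the direction `b`. -/
noncomputable def connMatrix (Γ : Coord → Fin 4 → Fin 4 → Fin 4 → ℝ) (b : Fin 4) (z : Coord) :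
    Matrix (Fin 4) (Fin 4) ℝ :=
  Matrix.of fun c a => Γ z c a b

/-- The curvature matrix `∂_c A_b - ∂_b A_c + [A_c, A_b]` of a matrix valued one-form `A`. -/
noncomputable def curvMatrix (A : Fin 4 → Coord → Matrix (Fin 4) (Fin 4) ℝ) (c b : Fin 4)
    (y : Coord) :
    Matrix (Fin 4) (Fin 4) ℝ :=
  mpd c (A b) y - mpd b (A c) y + A c y * A b y - A b y * A c y

lemma ricci_eq_sum_curvMatrix {Γ : Coord → Fin 4 → Fin 4 → Fin 4 → ℝ} {y : Coord}
    (hΓ : ∀ c a b, Γ y c a b = Γ y c b a) (a b : Fin 4) :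
    ricci Γ y a b = ∑ c, curvMatrix (connMatrix Γ) c b y c a := by
  simp only [ricci, curvMatrix, connMatrix, mpd, Matrix.sub_apply, Matrix.add_apply,
    Matrix.mul_apply, Matrix.of_apply, Finset.sum_sub_distrib, Finset.sum_add_distrib]
  have h1 : ∀ c, (∑ d, Γ y c c d * Γ y d a b) = ∑ d, Γ y c d c * Γ y d a b := fun c =>
    Finset.sum_congr rfl fun d _ => by rw [hΓ c c d]
  have h2 : ∀ c d, Γ y c b d = Γ y c d b := fun c d => hΓ _ _ _
  simp only [h1, h2]
  ring

/-- Under a gauge transformation `J A_b = B_b J + ∂_b J` the curvature transforms by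
conjugation. -/
lemma mul_curvMatrix_of_gauge {A B : Fin 4 → Coord → Matrix (Fin 4) (Fin 4) ℝ}
    {J : Coord → Matrix (Fin 4) (Fin 4) ℝ} {y : Coord}
    (hA : ∀ b i j, DifferentiableAt ℝ (fun z => A b z i j) y)
    (hB : ∀ b i j, DifferentiableAt ℝ (fun z => B b z i j) y)
    (hJ : ∀ i j, ContDiffAt ℝ ∞ (fun z => J z i j) y)
    (h : ∀ b, ∀ᶠ z in 𝓝 y, J z * A b z = B b z * J z + mpd b J z) (c b : Fin 4) :
    J y * curvMatrix A c b y = curvMatrix B c b y * J y := by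
  have hJd : ∀ i j, DifferentiableAt ℝ (fun z => J z i j) y := fun i j =>
    (hJ i j).differentiableAt (by simp)
  have hmJ : ∀ b i j, DifferentiableAt ℝ (fun z => mpd b J z i j) y := fun b i j =>
    ((hJ i j).pd b).differentiableAt (by simp)
  have hBJ : ∀ b i j, DifferentiableAt ℝ (fun z => (B b z * J z) i j) y := fun b i j => by
    simp only [Matrix.mul_apply]
    exact DifferentiableAt.fun_sum fun k _ => (hB b i k).fun_mul (hJd k j)
  have key : ∀ c b, J y * mpd c (A b) y =
      mpd c (B b) y * J y + B b y * mpd c J y + mpd c (mpd b J) y - mpd c J y * A b y := by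
    intro c b
    have h1 := mpd_congr c (h b)
    rw [mpd_mul c hJd (hA b), mpd_add c (hBJ b) (hmJ b), mpd_mul c (hB b) hJd] at h1
    rw [← h1]; abel
  have hsymm : mpd c (mpd b J) y = mpd b (mpd c J) y := by
    ext i j
    exact pd_comm (hJ i j) c b
  have hc := (h c).self_of_nhds
  have hb := (h b).self_of_nhds
  have e1 : J y * (A c y * A b y) =
      B c y * (B b y * J y + mpd b J y) + mpd c J y * A b y := by
    rw [← mul_assoc, hc, add_mul, mul_assoc, hb]
  have e2 : J y * (A b y * A c y) =
      B b y * (B c y * J y + mpd c J y) + mpd b J y * A c y := by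
    rw [← mul_assoc, hb, add_mul, mul_assoc, hc]
  simp only [curvMatrix, mul_sub, mul_add, sub_mul, add_mul] at e1 e2 ⊢
  rw [key, key, e1, e2, hsymm]
  simp only [mul_assoc]
  abel

/-- The curvature of the pull-back `τ^* A` of a matrix valued one-form is the pull-back of the
curvature. -/
lemma curvMatrix_pullback {A : Fin 4 → Coord → Matrix (Fin 4) (Fin 4) ℝ} {τ : Coord → Coord}
    {y : Coord} (hτ : ContDiffAt ℝ ∞ τ y)
    (hA : ∀ b i j, DifferentiableAt ℝ (fun z => A b z i j) (τ y)) (c b : Fin 4) :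
    curvMatrix (fun b z => ∑ j, pd b (fun w => τ w j) z • A j (τ z)) c b y =
      ∑ i, ∑ j, (pd c (fun w => τ w i) y * pd b (fun w => τ w j) y) •
        curvMatrix A i j (τ y) := by
  have hτj : ∀ j, ContDiffAt ℝ ∞ (fun z => τ z j) y := contDiffAt_euclidean.1 hτ
  have hτd : DifferentiableAt ℝ τ y := hτ.differentiableAt (by simp)
  have hD : ∀ c b, mpd c (fun z => ∑ j, pd b (fun w => τ w j) z • A j (τ z)) y =
      ∑ j, pd c (pd b (fun w => τ w j)) y • A j (τ y) +
        ∑ i, ∑ j, (pd c (fun w => τ w i) y * pd b (fun w => τ w j) y) • mpd i (A j) (τ y) := by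
    intro c b
    ext k l
    simp only [mpd, Matrix.of_apply, Matrix.sum_apply, Matrix.smul_apply, Matrix.add_apply,
      smul_eq_mul]
    have hd1 : ∀ j, DifferentiableAt ℝ (pd b (fun w => τ w j)) y := fun j =>
      ((hτj j).pd b).differentiableAt (by simp)
    have hd2 : ∀ j, DifferentiableAt ℝ (fun z => A j (τ z) k l) y := fun j =>
      (hA j k l).comp y hτd
    rw [pd_sum c fun j _ => (hd1 j).fun_mul (hd2 j), Finset.sum_comm (γ := Fin 4),
      ← Finset.sum_add_distrib]
    refine Finset.sum_congr rfl fun j _ => ?_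
    rw [pd_mul c (hd1 j) (hd2 j), pd_comp (F := fun w => A j w k l) c (hA j k l) hτd,
      Finset.mul_sum]
    congr 1
    exact Finset.sum_congr rfl fun i _ => by ring
  have hM : ∀ c b, (∑ j, pd c (fun w => τ w j) y • A j (τ y)) *
      (∑ j, pd b (fun w => τ w j) y • A j (τ y)) =
      ∑ i, ∑ j, (pd c (fun w => τ w i) y * pd b (fun w => τ w j) y) •
        (A i (τ y) * A j (τ y)) := by
    intro c b
    rw [Finset.sum_mul_sum]
    refine Finset.sum_congr rfl fun i _ => Finset.sum_congr rfl fun j _ => ?_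
    rw [smul_mul_smul_comm]
  have hswap : ∀ X : Fin 4 → Fin 4 → Matrix (Fin 4) (Fin 4) ℝ,
      ∑ i, ∑ j, (pd b (fun w => τ w i) y * pd c (fun w => τ w j) y) • X i j =
      ∑ i, ∑ j, (pd c (fun w => τ w i) y * pd b (fun w => τ w j) y) • X j i := by
    intro X
    rw [Finset.sum_comm]
    exact Finset.sum_congr rfl fun i _ => Finset.sum_congr rfl fun j _ => by rw [mul_comm]
  have hcomm : ∀ j, pd b (pd c (fun w => τ w j)) y = pd c (pd b (fun w => τ w j)) y :=
    fun j => pd_comm (hτj j) b c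
  simp only [curvMatrix]
  rw [hD c b, hD b c, hM c b, hM b c, hswap, hswap]
  simp only [hcomm, smul_sub, smul_add, Finset.sum_add_distrib, Finset.sum_sub_distrib]
  abel

/-- The Ricci tensor of a torsion-free connection is a tensor. -/
lemma ricci_transform {Γ Γ' : Coord → Fin 4 → Fin 4 → Fin 4 → ℝ} {τ : Coord → Coord} {y : Coord}
    (hτ : ∀ᶠ z in 𝓝 y, ContDiffAt ℝ ∞ τ z)
    (hΓ : ∀ c a b, ContDiffAt ℝ ∞ (fun z => Γ z c a b) y)
    (hΓ' : ∀ c a b, ContDiffAt ℝ ∞ (fun z => Γ' z c a b) (τ y))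
    (hs : ∀ c a b, Γ y c a b = Γ y c b a) (hs' : ∀ c a b, Γ' (τ y) c a b = Γ' (τ y) c b a)
    (hdet : (Matrix.of fun k a => pd a (fun w => τ w k) y).det ≠ 0)
    (h : ∀ᶠ z in 𝓝 y, ∀ k a b, ∑ c, pd c (fun w => τ w k) z * Γ z c a b =
      ∑ i, ∑ j, pd a (fun w => τ w i) z * pd b (fun w => τ w j) z * Γ' (τ z) k i j +
        pd a (pd b (fun w => τ w k)) z) (a b : Fin 4) :
    ricci Γ y a b = ∑ i, ∑ j, pd a (fun w => τ w i) y * pd b (fun w => τ w j) y *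
      ricci Γ' (τ y) i j := by
  have hτj : ∀ j, ContDiffAt ℝ ∞ (fun z => τ z j) y := contDiffAt_euclidean.1 hτ.self_of_nhds
  have hτd : DifferentiableAt ℝ τ y := hτ.self_of_nhds.differentiableAt (by simp)
  set J : Coord → Matrix (Fin 4) (Fin 4) ℝ := fun z => Matrix.of fun k a =>
    pd a (fun w => τ w k) z with hJ
  set B : Fin 4 → Coord → Matrix (Fin 4) (Fin 4) ℝ := fun b z =>
    ∑ j, pd b (fun w => τ w j) z • connMatrix Γ' j (τ z) with hB
  have hBapp : ∀ b z k i, B b z k i = ∑ j, pd b (fun w => τ w j) z * Γ' (τ z) k i j := by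
    intro b z k i
    simp [hB, connMatrix, Matrix.sum_apply]
  have hJd : ∀ i j, ContDiffAt ℝ ∞ (fun z => J z i j) y := fun i j => (hτj i).pd j
  have hgauge : ∀ b, ∀ᶠ z in 𝓝 y, J z * connMatrix Γ b z = B b z * J z + mpd b J z := by
    intro b
    filter_upwards [h, hτ] with z hz hz2
    ext k a
    rw [Matrix.add_apply, Matrix.mul_apply, Matrix.mul_apply]
    simp only [hBapp]
    have := hz k a b
    simp only [hJ, connMatrix, mpd, Matrix.of_apply]
    rw [this, pd_comm (contDiffAt_euclidean.1 hz2 k) a b]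
    congr 1
    refine Finset.sum_congr rfl fun i _ => ?_
    rw [Finset.sum_mul]
    exact Finset.sum_congr rfl fun j _ => by ring
  have hmain := mul_curvMatrix_of_gauge (A := connMatrix Γ) (B := B) (J := J) (y := y)
    (fun b i j => (hΓ i j b).differentiableAt (by simp))
    (fun b i j => by
      simp only [hBapp]
      exact DifferentiableAt.fun_sum fun k _ => (((hτj k).pd b).differentiableAt (by simp)).fun_mul
        (((hΓ' i j k).differentiableAt (by simp)).comp y hτd)) hJd hgauge
  have hpull := curvMatrix_pullback (A := connMatrix Γ') hτ.self_of_nhds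
    (fun b i j => (hΓ' i j b).differentiableAt (by simp))
  have hJu : IsUnit (J y).det := isUnit_iff_ne_zero.2 hdet
  have hcurv : ∀ c, curvMatrix (connMatrix Γ) c b y = ∑ i, ∑ j, (J y i c * J y j b) •
      ((J y)⁻¹ * (curvMatrix (connMatrix Γ') i j (τ y) * J y)) := by
    intro c
    have h1 : curvMatrix (connMatrix Γ) c b y = (J y)⁻¹ * (curvMatrix B c b y * J y) := by
      rw [← hmain, ← mul_assoc, Matrix.nonsing_inv_mul _ hJu, one_mul]
    rw [h1, hB, hpull]
    simp only [Finset.sum_mul, Finset.mul_sum, smul_mul_assoc, mul_smul_comm]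
    rfl
  rw [ricci_eq_sum_curvMatrix hs]
  simp only [ricci_eq_sum_curvMatrix hs', hcurv, Matrix.sum_apply, Matrix.smul_apply, smul_eq_mul]
  have hinv : ∀ i k, ∑ c, J y i c * (J y)⁻¹ c k = if i = k then 1 else 0 := by
    intro i k
    rw [← Matrix.mul_apply, Matrix.mul_nonsing_inv _ hJu, Matrix.one_apply]
  calc ∑ c, ∑ i, ∑ j, J y i c * J y j b *
        ((J y)⁻¹ * (curvMatrix (connMatrix Γ') i j (τ y) * J y)) c a
      = ∑ i, ∑ j, ∑ k, (∑ c, J y i c * (J y)⁻¹ c k) *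
          (J y j b * (curvMatrix (connMatrix Γ') i j (τ y) * J y) k a) := by
        rw [Finset.sum_comm]
        refine Finset.sum_congr rfl fun i _ => ?_
        rw [Finset.sum_comm]
        refine Finset.sum_congr rfl fun j _ => ?_
        simp only [Matrix.mul_apply (M := (J y)⁻¹), Finset.mul_sum, Finset.sum_mul]
        rw [Finset.sum_comm]
        exact Finset.sum_congr rfl fun k _ => Finset.sum_congr rfl fun c _ => by ring
    _ = ∑ i, ∑ j, J y j b * (curvMatrix (connMatrix Γ') i j (τ y) * J y) i a := by
        simp only [hinv, ite_mul, one_mul, zero_mul, Finset.sum_ite_eq, Finset.mem_univ, if_true]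
    _ = ∑ l, ∑ j, J y l a * J y j b * ∑ i, curvMatrix (connMatrix Γ') i j (τ y) i l := by
        simp only [Matrix.mul_apply, Finset.mul_sum]
        rw [Finset.sum_comm]
        symm
        rw [Finset.sum_comm]
        symm
        refine Finset.sum_congr rfl fun j _ => ?_
        rw [Finset.sum_comm]
        exact Finset.sum_congr rfl fun l _ => Finset.sum_congr rfl fun i _ => by ring

end Covariance

section PointwiseAlgebra

open Filter Topology

/-! ### Non-metricity -/

/-- `g` is, near the point `y`, a smooth symmetric matrix function of negative determinant. -/
structure IsMetricAt (g : Coord → Matrix (Fin 4) (Fin 4) ℝ) (y : Coord) : Prop where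
  smooth : ∀ a b, ContDiffAt ℝ ∞ (fun z => g z a b) y
  symm : ∀ᶠ z in 𝓝 y, ∀ a b, g z a b = g z b a
  det_neg : (g y).det < 0

/-- `Γ` is, near the point `y`, a smooth field of torsion-free connection coefficients. -/
structure IsConnAt (Γ : Coord → Fin 4 → Fin 4 → Fin 4 → ℝ) (y : Coord) : Prop where
  smooth : ∀ c a b, ContDiffAt ℝ ∞ (fun z => Γ z c a b) y
  symm : ∀ᶠ z in 𝓝 y, ∀ c a b, Γ z c a b = Γ z c b a

/-- The covariant derivative `∇_c g_{ab}`. -/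
noncomputable def nonmetricity (g : Coord → Matrix (Fin 4) (Fin 4) ℝ)
    (Γ : Coord → Fin 4 → Fin 4 → Fin 4 → ℝ) (y : Coord) (c a b : Fin 4) : ℝ :=
  pd c (fun z => g z a b) y - ∑ d, (Γ y d c a * g y d b + Γ y d c b * g y a d)

/-- The bracket of the Weyl constraint: the deviation of `Γ` from the Weyl connection of `g` and
`Q`. -/
noncomputable def weylDefect (Q : Coord → Fin 4 → ℝ) (g : Coord → Matrix (Fin 4) (Fin 4) ℝ)
    (Γ : Coord → Fin 4 → Fin 4 → Fin 4 → ℝ) (y : Coord) (c a b : Fin 4) : ℝ :=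
  Γ y c a b - christoffel g y c a b -
    (1 / 2) * ∑ d, (g y)⁻¹ c d * (Q y b * g y a d + Q y a * g y d b - Q y d * g y a b)

section IsMetricAt

variable {g : Coord → Matrix (Fin 4) (Fin 4) ℝ} {y : Coord}

lemma IsMetricAt.isUnit_det (h : IsMetricAt g y) : IsUnit (g y).det :=
  isUnit_iff_ne_zero.2 h.det_neg.ne

lemma IsMetricAt.differentiableAt (h : IsMetricAt g y) (a b : Fin 4) :
    DifferentiableAt ℝ (fun z => g z a b) y :=
  (h.smooth a b).differentiableAt (by simp)

lemma IsMetricAt.contDiffAt_inv (h : IsMetricAt g y) (a b : Fin 4) :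
    ContDiffAt ℝ ∞ (fun z => (g z)⁻¹ a b) y :=
  contDiffAt_matrix_inv h.smooth h.det_neg.ne a b

lemma IsMetricAt.volDensity_pos (h : IsMetricAt g y) : 0 < volDensity g y :=
  Real.sqrt_pos.2 (neg_pos.2 h.det_neg)

lemma IsMetricAt.contDiffAt_volDensity (h : IsMetricAt g y) :
    ContDiffAt ℝ ∞ (volDensity g) y :=
  (contDiffAt_det h.smooth).neg.sqrt (neg_pos.2 h.det_neg).ne'

lemma IsMetricAt.eventually_det_neg (h : IsMetricAt g y) : ∀ᶠ z in 𝓝 y, (g z).det < 0 :=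
  (contDiffAt_det h.smooth).continuousAt.eventually_lt continuousAt_const h.det_neg

lemma IsMetricAt.transpose_eq (h : IsMetricAt g y) : (g y).transpose = g y := by
  ext a b
  exact h.symm.self_of_nhds b a

lemma IsMetricAt.inv_symm (h : IsMetricAt g y) (a b : Fin 4) : (g y)⁻¹ a b = (g y)⁻¹ b a := by
  have := congrFun (congrFun (Matrix.transpose_nonsing_inv (g y)) b) a
  rw [h.transpose_eq] at this
  exact this

/-- Jacobi's formula for a matrix function of the coordinates. -/
lemma pd_det (h : ∀ a b, DifferentiableAt ℝ (fun z => g z a b) y) (hd : (g y).det ≠ 0)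
    (c : Fin 4) : pd c (fun z => (g z).det) y = (g y).det * ((g y)⁻¹ * mpd c g y).trace := by
  have h1 := (hasFDerivAt_det fun i j => (h i j).hasFDerivAt).fderiv
  have h2 : (g y).adjugate = (g y).det • (g y)⁻¹ := by
    rw [Matrix.inv_def, smul_smul, Ring.inverse_eq_inv', mul_inv_cancel₀ hd, one_smul]
  unfold pd
  rw [h1, h2]
  simp only [sum_apply, smul_apply, Matrix.trace, Matrix.diag_apply, Matrix.mul_apply,
    Matrix.smul_apply, smul_eq_mul, Finset.mul_sum, mpd, Matrix.of_apply, pd, mul_assoc]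

lemma IsMetricAt.pd_volDensity (h : IsMetricAt g y) (c : Fin 4) :
    pd c (volDensity g) y = 1 / 2 * volDensity g y * ((g y)⁻¹ * mpd c g y).trace := by
  have hd : DifferentiableAt ℝ (fun z => (g z).det) y :=
    (contDiffAt_det h.smooth).differentiableAt (by simp)
  have hpos := h.volDensity_pos
  have hne : -(g y).det ≠ 0 := (neg_pos.2 h.det_neg).ne'
  have h1 := pd_real_comp (φ := fun x => √(-x)) (F := fun z => (g z).det) (y := y) c
    ((Real.hasDerivAt_sqrt hne).comp _ (hasDerivAt_neg _)).differentiableAt hd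
  have h2 : deriv (fun x => √(-x)) (g y).det = 1 / (2 * √(-(g y).det)) * -1 :=
    ((Real.hasDerivAt_sqrt hne).comp _ (hasDerivAt_neg _)).deriv
  have h3 : √(-(g y).det) * √(-(g y).det) = -(g y).det :=
    Real.mul_self_sqrt (neg_pos.2 h.det_neg).le
  change pd c (fun z => √(-(g z).det)) y = _
  rw [h1, h2, pd_det h.differentiableAt h.det_neg.ne]
  unfold volDensity at hpos ⊢
  field_simp
  linear_combination (-((g y)⁻¹ * mpd c g y).trace) * h3

end IsMetricAt

/-- The classical computation that recovers the connection coefficients from a prescribed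
derivative `D_{cab}` of the metric. -/
lemma eq_christoffel_combination_iff {G : Matrix (Fin 4) (Fin 4) ℝ} (hG : IsUnit G.det)
    (hGs : ∀ a b, G a b = G b a) {C D : Fin 4 → Fin 4 → Fin 4 → ℝ}
    (hC : ∀ c a b, C c a b = C c b a) (hD : ∀ c a b, D c a b = D c b a) :
    (∀ c a b, C c a b = 1 / 2 * ∑ d, G⁻¹ c d * (D b a d + D a d b - D d a b)) ↔
      ∀ c a b, D c a b = ∑ d, (C d c a * G d b + C d c b * G a d) := by
  have hlow : ∀ c a b, ∑ d, (C d c a * G d b + C d c b * G a d) =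
      ∑ d, G b d * C d c a + ∑ d, G a d * C d c b := by
    intro c a b
    rw [← Finset.sum_add_distrib]
    exact Finset.sum_congr rfl fun d _ => by rw [hGs d b]; ring
  simp only [hlow]
  constructor
  · intro h
    have h1 : ∀ e a b, ∑ d, G e d * C d a b = 1 / 2 * (D b a e + D a e b - D e a b) := by
      intro e a b
      have h2 : G.mulVec (G⁻¹.mulVec fun d => D b a d + D a d b - D d a b) e =
          D b a e + D a e b - D e a b := by
        rw [Matrix.mulVec_mulVec, Matrix.mul_nonsing_inv _ hG, Matrix.one_mulVec]
      rw [← h2]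
      simp only [Matrix.mulVec, dotProduct, Finset.mul_sum, h _ a b]
      exact Finset.sum_congr rfl fun d _ => Finset.sum_congr rfl fun i _ => by ring
    intro c a b
    rw [h1, h1, hD c b a]
    ring
  · intro h c a b
    have h1 : ∀ d, D b a d + D a d b - D d a b = 2 * ∑ e, G d e * C e a b := by
      intro d
      rw [h b a d, h a d b, h d a b]
      have e1 : ∀ p q r, ∑ e, G p e * C e q r = ∑ e, G p e * C e r q := fun p q r =>
        Finset.sum_congr rfl fun e _ => by rw [hC e q r]
      rw [e1 d b a, e1 a d b, e1 b d a]
      ring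
    have h2 : G⁻¹.mulVec (G.mulVec fun e => C e a b) c = C c a b := by
      rw [Matrix.mulVec_mulVec, Matrix.nonsing_inv_mul _ hG, Matrix.one_mulVec]
    rw [← h2]
    simp only [h1, Matrix.mulVec, dotProduct, Finset.mul_sum]
    exact Finset.sum_congr rfl fun d _ => Finset.sum_congr rfl fun i _ => by ring

section Equations

variable {g : Coord → Matrix (Fin 4) (Fin 4) ℝ} {Γ : Coord → Fin 4 → Fin 4 → Fin 4 → ℝ}
  {y : Coord}

/-- The Weyl constraint expresses that `∇_c g_{ab} = -Q_c g_{ab}`. -/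
lemma weylDefect_eq_zero_iff (hg : IsMetricAt g y) (hΓ : IsConnAt Γ y) (Q : Coord → Fin 4 → ℝ) :
    (∀ c a b, weylDefect Q g Γ y c a b = 0) ↔
    ∀ c a b, nonmetricity g Γ y c a b = - Q y c * g y a b := by
  have hgs := hg.symm.self_of_nhds
  have hpds : ∀ c a b, pd c (fun z => g z a b) y = pd c (fun z => g z b a) y := fun c a b =>
    pd_congr c (hg.symm.mono fun z hz => hz a b)
  have key := eq_christoffel_combination_iff hg.isUnit_det hgs (C := Γ y)
    (D := fun c a b => pd c (fun z => g z a b) y + Q y c * g y a b) hΓ.symm.self_of_nhds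
    (fun c a b => by rw [hpds, hgs a b])
  have e1 : ∀ c a b, weylDefect Q g Γ y c a b =
      Γ y c a b - 1 / 2 * ∑ d, (g y)⁻¹ c d * ((pd b (fun z => g z a d) y + Q y b * g y a d) +
        (pd a (fun z => g z d b) y + Q y a * g y d b) -
        (pd d (fun z => g z a b) y + Q y d * g y a b)) := by
    intro c a b
    rw [weylDefect, christoffel, sub_sub, ← mul_add, ← Finset.sum_add_distrib]
    congr 2
    exact Finset.sum_congr rfl fun d _ => by ring
  simp only [e1, sub_eq_zero]
  rw [key]
  refine forall_congr' fun c => forall_congr' fun a => forall_congr' fun b => ?_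
  unfold nonmetricity
  constructor <;> intro h <;> linarith

/-- `Γ` is the Levi-Civita connection of `u g` if and only if `∇_c g_{ab} = -u⁻¹ ∂_c u g_{ab}`. -/
lemma christoffel_smul_iff (hg : IsMetricAt g y) (hΓ : IsConnAt Γ y) {u : Coord → ℝ}
    (hu : DifferentiableAt ℝ u y) (hu0 : u y ≠ 0) :
    (∀ c a b, Γ y c a b = christoffel (fun z => u z • g z) y c a b) ↔
    ∀ c a b, nonmetricity g Γ y c a b = - (pd c u y / u y) * g y a b := by
  have hgs := hg.symm.self_of_nhds
  have hpd : ∀ c a b, pd c (fun z => (u z • g z) a b) y =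
      pd c u y * g y a b + u y * pd c (fun z => g z a b) y := fun c a b =>
    pd_mul c hu (hg.differentiableAt a b)
  have hpds : ∀ c a b, pd c (fun z => g z a b) y = pd c (fun z => g z b a) y := fun c a b =>
    pd_congr c (hg.symm.mono fun z hz => hz a b)
  have hdet : IsUnit (u y • g y).det := by
    rw [Matrix.det_smul]
    exact (IsUnit.pow _ (isUnit_iff_ne_zero.2 hu0)).mul hg.isUnit_det
  have key := eq_christoffel_combination_iff hdet
    (fun a b => by simp only [Matrix.smul_apply]; rw [hgs a b]) (C := Γ y)
    (D := fun c a b => pd c (fun z => (u z • g z) a b) y) hΓ.symm.self_of_nhds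
    (fun c a b => by simp only [hpd]; rw [hpds, hgs a b])
  unfold christoffel
  rw [key]
  refine forall_congr' fun c => forall_congr' fun a => forall_congr' fun b => ?_
  have e : ∑ d, (Γ y d c a * (u y • g y) d b + Γ y d c b * (u y • g y) a d) =
      u y * ∑ d, (Γ y d c a * g y d b + Γ y d c b * g y a d) := by
    rw [Finset.mul_sum]
    exact Finset.sum_congr rfl fun d _ => by simp only [Matrix.smul_apply, smul_eq_mul]; ring
  rw [hpd, e]
  unfold nonmetricity
  generalize ∑ d, (Γ y d c a * g y d b + Γ y d c b * g y a d) = S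
  constructor
  · intro h
    field_simp
    linarith
  · intro h
    field_simp at h
    linarith

/-- The matrix form of the non-metricity in a fixed direction. -/
lemma nonmetricity_eq_matrix (c a b : Fin 4) :
    nonmetricity g Γ y c a b = (mpd c g y - (Matrix.of fun p q => Γ y p c q).transpose * g y -
      g y * (Matrix.of fun p q => Γ y p c q)) a b := by
  simp only [nonmetricity, Matrix.sub_apply, Matrix.mul_apply, Matrix.transpose_apply,
    Matrix.of_apply, mpd, Finset.sum_add_distrib]
  rw [sub_sub]
  congr 2
  exact Finset.sum_congr rfl fun d _ => mul_comm _ _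

/-- The trace `g^{ab} ∇_c g_{ab}`. -/
lemma trace_inv_mul_nonmetricity (hg : IsMetricAt g y) (c : Fin 4) :
    ((g y)⁻¹ * (mpd c g y - (Matrix.of fun p q => Γ y p c q).transpose * g y -
      g y * (Matrix.of fun p q => Γ y p c q))).trace =
      ((g y)⁻¹ * mpd c g y).trace - 2 * ∑ d, Γ y d c d := by
  have h1 : (Matrix.of fun p q => Γ y p c q).trace = ∑ d, Γ y d c d := rfl
  rw [mul_sub, mul_sub, Matrix.trace_sub, Matrix.trace_sub, Matrix.trace_mul_comm (g y)⁻¹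
    ((Matrix.of fun p q => Γ y p c q).transpose * g y), mul_assoc,
    Matrix.mul_nonsing_inv _ hg.isUnit_det, mul_one, ← mul_assoc,
    Matrix.nonsing_inv_mul _ hg.isUnit_det, one_mul, Matrix.trace_transpose, h1]
  ring

/-- If `Γ` is the Levi-Civita connection of `u g`, then
`Γ^d_{cd} = ∂_c ln √|det (u g)|`. -/
lemma conn_trace_eq (hg : IsMetricAt g y) {u : Coord → ℝ}
    (hu : DifferentiableAt ℝ u y) (hu0 : u y ≠ 0) {c : Fin 4}
    (h : ∀ a b, nonmetricity g Γ y c a b = - (pd c u y / u y) * g y a b) :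
    ∑ d, Γ y d c d = pd c (fun z => Real.log (volDensity g z) + 2 * Real.log (u z)) y := by
  have hv := hg.volDensity_pos
  have hvd : DifferentiableAt ℝ (volDensity g) y :=
    hg.contDiffAt_volDensity.differentiableAt (by simp)
  have hN : mpd c g y - (Matrix.of fun p q => Γ y p c q).transpose * g y -
      g y * (Matrix.of fun p q => Γ y p c q) = (-(pd c u y / u y)) • g y := by
    ext a b
    rw [← nonmetricity_eq_matrix, h]; rfl
  have ht := trace_inv_mul_nonmetricity (Γ := Γ) hg c
  rw [hN, mul_smul_comm, Matrix.nonsing_inv_mul _ hg.isUnit_det, Matrix.trace_smul,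
    Matrix.trace_one, Fintype.card_fin] at ht
  rw [pd_add c (hvd.log hv.ne') ((hu.log hu0).const_mul 2), pd_const_mul c 2 (hu.log hu0),
    pd_real_comp c (Real.differentiableAt_log hv.ne') hvd,
    pd_real_comp c (Real.differentiableAt_log hu0) hu, Real.deriv_log, Real.deriv_log,
    hg.pd_volDensity]
  simp only [smul_eq_mul] at ht
  field_simp at ht ⊢
  push_cast at ht
  linarith

/-- `∇_c (u √(-g) g^{ab}) = 0` if and only if `∇_c g_{ab} = -u⁻¹ ∂_c u g_{ab}`. This is where the
dimension enters: in dimension four `u √(-g) g^{ab}` is `√(-h) h^{ab}` for `h = u g`. -/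
lemma gothic_equation_iff (hg : IsMetricAt g y) {u : Coord → ℝ}
    (hu : DifferentiableAt ℝ u y) (hu0 : u y ≠ 0) (c : Fin 4) :
    (∀ a b, pd c (fun z => u z * volDensity g z * (g z)⁻¹ a b) y +
      ∑ d, (Γ y a c d * (u y * volDensity g y * (g y)⁻¹ d b) +
        Γ y b c d * (u y * volDensity g y * (g y)⁻¹ a d) -
        Γ y d c d * (u y * volDensity g y * (g y)⁻¹ a b)) = 0) ↔
    ∀ a b, nonmetricity g Γ y c a b = - (pd c u y / u y) * g y a b := by
  have hv := hg.volDensity_pos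
  have hvd : DifferentiableAt ℝ (volDensity g) y :=
    hg.contDiffAt_volDensity.differentiableAt (by simp)
  have hId : ∀ a b, DifferentiableAt ℝ (fun z => (g z)⁻¹ a b) y := fun a b =>
    (hg.contDiffAt_inv a b).differentiableAt (by simp)
  have hU := hg.isUnit_det
  set G := g y with hG
  set G' := mpd c g y with hG'
  set I' := mpd c (fun z => (g z)⁻¹) y with hI'
  set C : Matrix (Fin 4) (Fin 4) ℝ := Matrix.of fun p q => Γ y p c q with hC
  set w := u y * volDensity g y with hw
  set w' := pd c u y * volDensity g y + u y * pd c (volDensity g) y with hw'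
  have hw0 : w ≠ 0 := mul_ne_zero hu0 hv.ne'
  have hGI : G' * G⁻¹ + G * I' = 0 := by
    have h1 := mpd_mul (A := g) (B := fun z => (g z)⁻¹) c hg.differentiableAt hId
    have h2 : (fun z => g z * (g z)⁻¹) =ᶠ[𝓝 y] fun _ => 1 := by
      filter_upwards [hg.eventually_det_neg] with z hz
      exact Matrix.mul_nonsing_inv _ (isUnit_iff_ne_zero.2 hz.ne)
    rw [← h1, mpd_congr c h2]
    ext a b
    exact pd_const c _ y
  have hE : ∀ a b, pd c (fun z => u z * volDensity g z * (g z)⁻¹ a b) y +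
      ∑ d, (Γ y a c d * (w * G⁻¹ d b) + Γ y b c d * (w * G⁻¹ a d) - Γ y d c d * (w * G⁻¹ a b)) =
      (w' • G⁻¹ + w • I' + w • (C * G⁻¹) + w • (G⁻¹ * C.transpose) -
        (C.trace * w) • G⁻¹) a b := by
    intro a b
    rw [pd_mul c (hu.fun_mul hvd) (hId a b), pd_mul c hu hvd]
    simp only [Matrix.add_apply, Matrix.sub_apply, Matrix.smul_apply, Matrix.mul_apply,
      smul_eq_mul, Matrix.transpose_apply, hC, Matrix.of_apply, Matrix.trace, Matrix.diag_apply,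
      Finset.sum_add_distrib, Finset.sum_sub_distrib, Finset.mul_sum, Finset.sum_mul, hI', mpd,
      ← hw, ← hw', ← hG]
    have e1 : ∀ x, Γ y a c x * (w * G⁻¹ x b) = w * (Γ y a c x * G⁻¹ x b) := fun x => by ring
    have e2 : ∀ x, Γ y b c x * (w * G⁻¹ a x) = w * (G⁻¹ a x * Γ y b c x) := fun x => by ring
    have e3 : ∀ x, Γ y x c x * (w * G⁻¹ a b) = Γ y x c x * w * G⁻¹ a b := fun x => by ring
    simp only [e1, e2, e3]
    ring
  set N := G' - C.transpose * G - G * C with hN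
  have hNapp : ∀ a b, nonmetricity g Γ y c a b = N a b := fun a b => nonmetricity_eq_matrix c a b
  have hT : (G⁻¹ * N).trace = (G⁻¹ * G').trace - 2 * C.trace :=
    trace_inv_mul_nonmetricity hg c
  have hww : w' - C.trace * w = w * (pd c u y / u y + 1 / 2 * (G⁻¹ * N).trace) := by
    rw [hT, hw', hg.pd_volDensity, hw]
    field_simp
    ring
  -- lowering both indices of the gothic equation
  have hlow : G * (w' • G⁻¹ + w • I' + w • (C * G⁻¹) + w • (G⁻¹ * C.transpose) -
      (C.trace * w) • G⁻¹) * G = (w' - C.trace * w) • G - w • N := by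
    have h1 : G * G⁻¹ = 1 := Matrix.mul_nonsing_inv _ hU
    have h2 : G⁻¹ * G = 1 := Matrix.nonsing_inv_mul _ hU
    have h3 : G * I' * G = -G' := by
      have : G * I' = -(G' * G⁻¹) := by rw [eq_neg_iff_add_eq_zero, add_comm]; exact hGI
      rw [this, neg_mul, mul_assoc, h2, mul_one]
    have h4 : G * (C * G⁻¹) * G = G * C := by rw [mul_assoc, mul_assoc, h2, mul_one]
    have h5 : G * (G⁻¹ * C.transpose) * G = C.transpose * G := by
      rw [← mul_assoc, h1, one_mul]
    simp only [mul_add, add_mul, mul_sub, sub_mul, mul_smul_comm, smul_mul_assoc, h1, h3, h4, h5,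
      one_mul, hN, smul_sub, sub_smul, smul_neg]
    abel
  set E := w' • G⁻¹ + w • I' + w • (C * G⁻¹) + w • (G⁻¹ * C.transpose) -
    (C.trace * w) • G⁻¹ with hEdef
  simp only [hE, hNapp]
  have hE0 : E = 0 ↔ N = (pd c u y / u y + 1 / 2 * (G⁻¹ * N).trace) • G := by
    have h1 : E = 0 ↔ G * E * G = 0 := by
      constructor
      · intro h; rw [h]; simp
      · intro h
        have : E = G⁻¹ * (G * E * G) * G⁻¹ := by
          rw [mul_assoc G E G, ← mul_assoc G⁻¹ G, Matrix.nonsing_inv_mul _ hU, one_mul, mul_assoc,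
            Matrix.mul_nonsing_inv _ hU, mul_one]
        rw [this, h]; simp
    rw [h1, hlow, hww, mul_smul, ← smul_sub, smul_eq_zero, or_iff_right hw0, sub_eq_zero, eq_comm]
  have hM : (∀ a b, E a b = 0) ↔ E = 0 :=
    ⟨fun h => by ext a b; exact h a b, fun h a b => by rw [h]; rfl⟩
  have hM' : (∀ a b, N a b = -(pd c u y / u y) * G a b) ↔ N = (-(pd c u y / u y)) • G :=
    ⟨fun h => by ext a b; exact h a b, fun h a b => by rw [h]; rfl⟩
  have htr : ∀ r : ℝ, N = r • G → (G⁻¹ * N).trace = 4 * r := by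
    intro r hr
    rw [hr, mul_smul_comm, Matrix.nonsing_inv_mul _ hU, Matrix.trace_smul, Matrix.trace_one,
      Fintype.card_fin, smul_eq_mul]
    push_cast
    ring
  rw [hM, hM', hE0]
  constructor
  · intro h
    have h1 := htr _ h
    rw [h]
    congr 1
    linarith
  · intro h
    have h1 := htr _ h
    rw [h1, h]
    congr 1
    ring

/-- The antisymmetric part of the Ricci tensor of a torsion-free connection is the curl of
`Γ^d_{ad}`, so that it vanishes if this trace is a gradient. -/
lemma ricci_symm_of_trace_eq_gradient (hΓ : IsConnAt Γ y) {ψ : Coord → ℝ}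
    (hψ : ContDiffAt ℝ ∞ ψ y)
    (h : ∀ᶠ z in 𝓝 y, ∀ a, ∑ d, Γ z d a d = pd a ψ z) (a b : Fin 4) :
    ricci Γ y a b = ricci Γ y b a := by
  have hs := hΓ.symm.self_of_nhds
  have h1 : ∀ a b, ∑ c, pd b (fun z => Γ z c a c) y = pd b (pd a ψ) y := by
    intro a b
    rw [← pd_sum b fun c _ => (hΓ.smooth c a c).differentiableAt (by simp)]
    exact pd_congr b (h.mono fun z hz => hz a)
  have h2 : ∀ c, pd c (fun z => Γ z c a b) y = pd c (fun z => Γ z c b a) y := fun c =>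
    pd_congr c (hΓ.symm.mono fun z hz => hz c a b)
  have h3 : ∑ c, ∑ d, Γ y c b d * Γ y d a c = ∑ c, ∑ d, Γ y c a d * Γ y d b c := by
    rw [Finset.sum_comm]
    exact Finset.sum_congr rfl fun c _ => Finset.sum_congr rfl fun d _ => mul_comm _ _
  simp only [ricci, Finset.sum_sub_distrib, h1, h2, h3, pd_comm hψ b a, hs _ a b]

end Equations

end PointwiseAlgebra

section Variations

open Filter Topology

/-! ### Smooth dependence of the Lagrangian densities on the variation parameter -/

section JointSmoothness

variable {gt : ℝ → Coord → Matrix (Fin 4) (Fin 4) ℝ}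
  {Γt Lt : ℝ → Coord → Fin 4 → Fin 4 → Fin 4 → ℝ} {p : ℝ × Coord}

lemma contDiffAt_volDensity_param
    (hg : ∀ a b, ContDiffAt ℝ ∞ (fun q : ℝ × Coord => gt q.1 q.2 a b) p)
    (hd : (gt p.1 p.2).det < 0) :
    ContDiffAt ℝ ∞ (fun q : ℝ × Coord => volDensity (gt q.1) q.2) p :=
  (contDiffAt_det hg).neg.sqrt (neg_pos.2 hd).ne'

lemma contDiffAt_ricci_param
    (hΓ : ∀ c a b, ContDiffAt ℝ ∞ (fun q : ℝ × Coord => Γt q.1 q.2 c a b) p) (a b : Fin 4) :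
    ContDiffAt ℝ ∞ (fun q : ℝ × Coord => ricci (Γt q.1) q.2 a b) p := by
  unfold ricci
  refine ContDiffAt.add (ContDiffAt.sum fun c _ => ?_)
    (ContDiffAt.sum fun c _ => ContDiffAt.sum fun d _ => ?_)
  · exact (contDiffAt_pd_param (hΓ c a b) c).sub (contDiffAt_pd_param (hΓ c a c) b)
  · exact ((hΓ c c d).mul (hΓ d a b)).sub ((hΓ c b d).mul (hΓ d a c))

lemma contDiffAt_palatiniDensity_param {f : ℝ → ℝ} (hf : ContDiff ℝ ∞ f)
    (hg : ∀ a b, ContDiffAt ℝ ∞ (fun q : ℝ × Coord => gt q.1 q.2 a b) p)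
    (hd : (gt p.1 p.2).det < 0)
    (hΓ : ∀ c a b, ContDiffAt ℝ ∞ (fun q : ℝ × Coord => Γt q.1 q.2 c a b) p) :
    ContDiffAt ℝ ∞ (fun q : ℝ × Coord => palatiniDensity f (gt q.1) (Γt q.1) q.2) p := by
  unfold palatiniDensity localScalar
  refine (contDiffAt_volDensity_param hg hd).mul (hf.contDiffAt.comp p ?_)
  exact ContDiffAt.sum fun a _ => ContDiffAt.sum fun b _ =>
    (contDiffAt_matrix_inv (A := fun q : ℝ × Coord => gt q.1 q.2) hg hd.ne a b).mul
      (contDiffAt_ricci_param hΓ a b)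

lemma contDiffAt_weylDefect_param {Q : Coord → Fin 4 → ℝ}
    (hQ : ∀ a, ContDiffAt ℝ ∞ (fun z => Q z a) p.2)
    (hg : ∀ a b, ContDiffAt ℝ ∞ (fun q : ℝ × Coord => gt q.1 q.2 a b) p)
    (hd : (gt p.1 p.2).det < 0)
    (hΓ : ∀ c a b, ContDiffAt ℝ ∞ (fun q : ℝ × Coord => Γt q.1 q.2 c a b) p) (c a b : Fin 4) :
    ContDiffAt ℝ ∞ (fun q : ℝ × Coord => weylDefect Q (gt q.1) (Γt q.1) q.2 c a b) p := by
  have hI := contDiffAt_matrix_inv (A := fun q : ℝ × Coord => gt q.1 q.2) hg hd.ne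
  have hQ' : ∀ a, ContDiffAt ℝ ∞ (fun q : ℝ × Coord => Q q.2 a) p := fun a =>
    (hQ a).comp p contDiffAt_snd
  have hpd : ∀ c a b, ContDiffAt ℝ ∞
      (fun q : ℝ × Coord => pd c (fun z => gt q.1 z a b) q.2) p := fun c a b =>
    contDiffAt_pd_param (hg a b) c
  unfold weylDefect christoffel
  refine ((hΓ c a b).sub (contDiffAt_const.mul (ContDiffAt.sum fun d _ => ?_))).sub
    (contDiffAt_const.mul (ContDiffAt.sum fun d _ => ?_))
  · exact (hI c d).mul (((hpd b a d).add (hpd a d b)).sub (hpd d a b))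
  · exact (hI c d).mul ((((hQ' b).mul (hg a d)).add ((hQ' a).mul (hg d b))).sub
      ((hQ' d).mul (hg a b)))

lemma contDiffAt_weylConstraintDensity_param {Q : Coord → Fin 4 → ℝ}
    (hQ : ∀ a, ContDiffAt ℝ ∞ (fun z => Q z a) p.2)
    (hg : ∀ a b, ContDiffAt ℝ ∞ (fun q : ℝ × Coord => gt q.1 q.2 a b) p)
    (hd : (gt p.1 p.2).det < 0)
    (hΓ : ∀ c a b, ContDiffAt ℝ ∞ (fun q : ℝ × Coord => Γt q.1 q.2 c a b) p)
    (hL : ∀ c a b, ContDiffAt ℝ ∞ (fun q : ℝ × Coord => Lt q.1 q.2 c a b) p) :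
    ContDiffAt ℝ ∞
      (fun q : ℝ × Coord => weylConstraintDensity Q (gt q.1) (Γt q.1) (Lt q.1) q.2) p :=
  (contDiffAt_volDensity_param hg hd).mul (ContDiffAt.sum fun c _ => ContDiffAt.sum fun a _ =>
    ContDiffAt.sum fun b _ => (hL c a b).mul (contDiffAt_weylDefect_param hQ hg hd hΓ c a b))

end JointSmoothness

section Fields

variable {g δg : Coord → Matrix (Fin 4) (Fin 4) ℝ}
  {Γ X : Coord → Fin 4 → Fin 4 → Fin 4 → ℝ} {y : Coord}

lemma varyMetric_zero_eventuallyEq (hg : IsMetricAt g y) :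
    varyMetric g δg 0 =ᶠ[𝓝 y] g := by
  filter_upwards [hg.eventually_det_neg] with z hz
  simp only [varyMetric, zero_smul, add_zero]
  exact Matrix.nonsing_inv_nonsing_inv _ (isUnit_iff_ne_zero.2 hz.ne)

lemma varyMetric_zero_variation_eventuallyEq (hg : IsMetricAt g y) (t : ℝ) :
    varyMetric g (fun _ => 0) t =ᶠ[𝓝 y] g := by
  filter_upwards [hg.eventually_det_neg] with z hz
  simp only [varyMetric, smul_zero, add_zero]
  exact Matrix.nonsing_inv_nonsing_inv _ (isUnit_iff_ne_zero.2 hz.ne)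

lemma IsMetricAt.contDiffAt_varyMetric (hg : IsMetricAt g y)
    (hδ : ∀ a b, ContDiffAt ℝ ∞ (fun z => δg z a b) y) (a b : Fin 4) :
    ContDiffAt ℝ ∞ (fun q : ℝ × Coord => varyMetric g δg q.1 q.2 a b) (0, y) := by
  refine contDiffAt_matrix_inv (A := fun q : ℝ × Coord => (g q.2)⁻¹ + q.1 • δg q.2)
    (fun i j => ?_) ?_ a b
  · have h1 : ContDiffAt ℝ ∞ (fun q : ℝ × Coord => (g q.2)⁻¹ i j) (0, y) :=
      ContDiffAt.comp (g := fun z => (g z)⁻¹ i j) (0, y) (hg.contDiffAt_inv i j) contDiffAt_snd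
    have h2 : ContDiffAt ℝ ∞ (fun q : ℝ × Coord => δg q.2 i j) (0, y) :=
      ContDiffAt.comp (g := fun z => δg z i j) (0, y) (hδ i j) contDiffAt_snd
    exact h1.add (contDiffAt_fst.mul h2)
  · simp only [zero_smul, add_zero, Matrix.det_nonsing_inv, Ring.inverse_eq_inv']
    exact inv_ne_zero hg.det_neg.ne

lemma IsMetricAt.det_varyMetric_zero (hg : IsMetricAt g y) : (varyMetric g δg 0 y).det < 0 := by
  rw [(varyMetric_zero_eventuallyEq hg).self_of_nhds]
  exact hg.det_neg

lemma contDiffAt_vary (hΓ : ∀ c a b, ContDiffAt ℝ ∞ (fun z => Γ z c a b) y)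
    (hX : ∀ c a b, ContDiffAt ℝ ∞ (fun z => X z c a b) y) (c a b : Fin 4) :
    ContDiffAt ℝ ∞ (fun q : ℝ × Coord => vary Γ X q.1 q.2 c a b) (0, y) := by
  have h1 : ContDiffAt ℝ ∞ (fun q : ℝ × Coord => Γ q.2 c a b) (0, y) :=
    ContDiffAt.comp (g := fun z => Γ z c a b) (0, y) (hΓ c a b) contDiffAt_snd
  have h2 : ContDiffAt ℝ ∞ (fun q : ℝ × Coord => X q.2 c a b) (0, y) :=
    ContDiffAt.comp (g := fun z => X z c a b) (0, y) (hX c a b) contDiffAt_snd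
  exact h1.add (contDiffAt_fst.mul h2)

lemma IsConnAt.contDiffAt_ricci (hΓ : IsConnAt Γ y) (a b : Fin 4) :
    ContDiffAt ℝ ∞ (fun z => ricci Γ z a b) y := by
  unfold ricci
  exact ContDiffAt.add
    (ContDiffAt.sum fun c _ => ((hΓ.smooth c a b).pd c).sub ((hΓ.smooth c a c).pd b))
    (ContDiffAt.sum fun c _ => ContDiffAt.sum fun d _ =>
      ((hΓ.smooth c c d).mul (hΓ.smooth d a b)).sub ((hΓ.smooth c b d).mul (hΓ.smooth d a c)))

lemma contDiffAt_localScalar (hg : IsMetricAt g y) (hΓ : IsConnAt Γ y) :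
    ContDiffAt ℝ ∞ (localScalar g Γ) y :=
  ContDiffAt.sum fun a _ => ContDiffAt.sum fun b _ =>
    (hg.contDiffAt_inv a b).mul (hΓ.contDiffAt_ricci a b)

lemma contDiffAt_gothicMetric {f : ℝ → ℝ} (hf : ContDiff ℝ ∞ f) (hg : IsMetricAt g y)
    (hΓ : IsConnAt Γ y) (a b : Fin 4) : ContDiffAt ℝ ∞ (gothicMetric f g Γ a b) y := by
  have hf' : ContDiff ℝ ∞ (deriv f) := (contDiff_infty_iff_deriv.1 hf).2
  exact ((hf'.contDiffAt.comp y (contDiffAt_localScalar hg hΓ)).mul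
    hg.contDiffAt_volDensity).mul (hg.contDiffAt_inv a b)

/-! ### The first variation of the Palatini action -/

/-- The first variation of the Ricci tensor under the variation `X` of the connection. -/
noncomputable def ricciVariation (Γ X : Coord → Fin 4 → Fin 4 → Fin 4 → ℝ) (y : Coord)
    (a b : Fin 4) : ℝ :=
  ∑ c, (pd c (fun z => X z c a b) y - pd b (fun z => X z c a c) y) +
    ∑ c, ∑ d, ((X y c c d * Γ y d a b + Γ y c c d * X y d a b) -
      (X y c b d * Γ y d a c + Γ y c b d * X y d a c))

lemma hasDerivAt_ricci_vary (hΓ : ∀ c a b, DifferentiableAt ℝ (fun z => Γ z c a b) y)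
    (hX : ∀ c a b, DifferentiableAt ℝ (fun z => X z c a b) y) (a b : Fin 4) :
    HasDerivAt (fun t => ricci (vary Γ X t) y a b) (ricciVariation Γ X y a b) 0 := by
  have hpd : ∀ (e c a b : Fin 4) (t : ℝ), pd e (fun z => vary Γ X t z c a b) y =
      pd e (fun z => Γ z c a b) y + t * pd e (fun z => X z c a b) y := by
    intro e c a b t
    simp only [vary]
    rw [pd_add e (hΓ c a b) ((hX c a b).const_mul t), pd_const_mul e t (hX c a b)]
  have hlin : ∀ r s : ℝ, HasDerivAt (fun t : ℝ => r + t * s) s 0 := fun r s => by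
    simpa using ((hasDerivAt_id (0 : ℝ)).mul_const s).const_add r
  unfold ricci ricciVariation
  simp only [hpd]
  simp only [vary]
  refine HasDerivAt.add (HasDerivAt.fun_sum fun c _ => (hlin _ _).sub (hlin _ _))
    (HasDerivAt.fun_sum fun c _ => HasDerivAt.fun_sum fun d _ => ?_)
  have h := ((hlin (Γ y c c d) (X y c c d)).fun_mul (hlin (Γ y d a b) (X y d a b))).fun_sub
    ((hlin (Γ y c b d) (X y c b d)).fun_mul (hlin (Γ y d a c) (X y d a c)))
  simpa only [zero_mul, add_zero] using h

lemma hasDerivAt_volDensity_varyMetric (hg : IsMetricAt g y) :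
    HasDerivAt (fun t => volDensity (varyMetric g δg t) y)
      (-(1 / 2) * volDensity g y * ∑ a, ∑ b, g y a b * δg y b a) 0 := by
  have hinv : (g y)⁻¹.det = (g y).det⁻¹ := by
    rw [Matrix.det_nonsing_inv, Ring.inverse_eq_inv']
  have hd0 : (g y).det ≠ 0 := hg.det_neg.ne
  have hadj : (g y)⁻¹.adjugate = (g y).det⁻¹ • g y := by
    have h1 : ((g y)⁻¹)⁻¹ = g y := Matrix.nonsing_inv_nonsing_inv _ hg.isUnit_det
    rw [Matrix.inv_def ((g y)⁻¹), hinv, Ring.inverse_eq_inv', inv_inv] at h1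
    have h2 : (g y)⁻¹.adjugate = (g y).det⁻¹ • ((g y).det • (g y)⁻¹.adjugate) := by
      rw [smul_smul, inv_mul_cancel₀ hd0, one_smul]
    exact h2.trans (by rw [h1])
  have hlin : ∀ a b, HasFDerivAt (fun t : ℝ => ((g y)⁻¹ + t • δg y) a b)
      (ContinuousLinearMap.toSpanSingleton ℝ (δg y a b)) 0 := fun a b => by
    have h1 := ((hasDerivAt_id (0 : ℝ)).mul_const (δg y a b)).const_add ((g y)⁻¹ a b)
    simp only [id_eq, one_mul] at h1
    exact h1.hasFDerivAt
  have hdet : HasDerivAt (fun t : ℝ => ((g y)⁻¹ + t • δg y).det)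
      ((g y).det⁻¹ * ∑ a, ∑ b, g y a b * δg y b a) 0 := by
    have h1 := (hasFDerivAt_det hlin).hasDerivAt
    convert! h1 using 1
    simp only [zero_smul, add_zero, hadj, sum_apply, smul_apply, Matrix.smul_apply, smul_eq_mul,
      ContinuousLinearMap.toSpanSingleton_apply, one_mul, Finset.mul_sum, mul_assoc]
  have h0 : ((g y)⁻¹ + (0 : ℝ) • δg y).det = (g y).det⁻¹ := by rw [zero_smul, add_zero, hinv]
  have hne : ((g y)⁻¹ + (0 : ℝ) • δg y).det ≠ 0 := by rw [h0]; exact inv_ne_zero hd0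
  have h2 := (hdet.fun_inv hne).fun_neg
  have h3 := h2.sqrt (by rw [h0, inv_inv]; exact (neg_pos.2 hg.det_neg).ne')
  have hfun : (fun t => volDensity (varyMetric g δg t) y) =
      fun t : ℝ => √(-((g y)⁻¹ + t • δg y).det⁻¹) := by
    funext t
    simp only [volDensity, varyMetric, Matrix.det_nonsing_inv, Ring.inverse_eq_inv']
  rw [hfun]
  convert! h3 using 1
  rw [h0, inv_inv]
  have hv := hg.volDensity_pos
  have hsq : √(-(g y).det) * √(-(g y).det) = -(g y).det :=
    Real.mul_self_sqrt (neg_pos.2 hg.det_neg).le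
  unfold volDensity at hv ⊢
  generalize ∑ a, ∑ b, g y a b * δg y b a = S
  field_simp
  linear_combination (-S) * hsq

/-- The first variation of the Lagrangian density, before integration by parts. -/
lemma hasDerivAt_palatiniDensity {f : ℝ → ℝ} (hf : ContDiff ℝ ∞ f) (hg : IsMetricAt g y)
    (hΓ : IsConnAt Γ y) (hδ : ∀ a b, δg y a b = δg y b a)
    (hX : ∀ c a b, DifferentiableAt ℝ (fun z => X z c a b) y) :
    HasDerivAt (fun t => palatiniDensity f (varyMetric g δg t) (vary Γ X t) y)
      (∑ a, ∑ b, volDensity g y * (deriv f (localScalar g Γ y) * ricci Γ y a b -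
          1 / 2 * f (localScalar g Γ y) * g y a b) * δg y a b +
        ∑ a, ∑ b, gothicMetric f g Γ a b y * ricciVariation Γ X y a b) 0 := by
  have hΓd : ∀ c a b, DifferentiableAt ℝ (fun z => Γ z c a b) y := fun c a b =>
    (hΓ.smooth c a b).differentiableAt (by simp)
  have hvary0 : vary Γ X 0 = Γ := by funext z c a b; simp [vary]
  have hev : (fun t => localScalar (varyMetric g δg t) (vary Γ X t) y) =ᶠ[𝓝 0]
      fun t => ∑ a, ∑ b, ((g y)⁻¹ a b + t * δg y a b) * ricci (vary Γ X t) y a b := by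
    have hc : ContinuousAt (fun t : ℝ => ((g y)⁻¹ + t • δg y).det) 0 := by
      have : Continuous (fun t : ℝ => ((g y)⁻¹ + t • δg y).det) :=
        Continuous.matrix_det (by fun_prop)
      exact this.continuousAt
    have hne : ((g y)⁻¹ + (0 : ℝ) • δg y).det ≠ 0 := by
      rw [zero_smul, add_zero, Matrix.det_nonsing_inv, Ring.inverse_eq_inv']
      exact inv_ne_zero hg.det_neg.ne
    filter_upwards [hc.eventually_ne hne] with t ht
    simp only [localScalar, varyMetric]
    rw [Matrix.nonsing_inv_nonsing_inv _ (isUnit_iff_ne_zero.2 ht)]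
    rfl
  have hS0 : localScalar (varyMetric g δg 0) (vary Γ X 0) y = localScalar g Γ y := by
    rw [hvary0]
    simp only [localScalar]
    rw [(varyMetric_zero_eventuallyEq hg).self_of_nhds]
  have hS : HasDerivAt (fun t => localScalar (varyMetric g δg t) (vary Γ X t) y)
      (∑ a, ∑ b, (δg y a b * ricci Γ y a b + (g y)⁻¹ a b * ricciVariation Γ X y a b)) 0 := by
    refine HasDerivAt.congr_of_eventuallyEq ?_ hev
    refine HasDerivAt.fun_sum fun a _ => HasDerivAt.fun_sum fun b _ => ?_
    have h1 : HasDerivAt (fun t : ℝ => (g y)⁻¹ a b + t * δg y a b) (δg y a b) 0 := by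
      simpa using ((hasDerivAt_id (0 : ℝ)).mul_const (δg y a b)).const_add ((g y)⁻¹ a b)
    have h2 := h1.fun_mul (hasDerivAt_ricci_vary hΓd hX a b)
    simpa only [zero_mul, add_zero, hvary0] using h2
  have hfS : HasDerivAt f (deriv f (localScalar g Γ y))
      (localScalar (varyMetric g δg 0) (vary Γ X 0) y) := by
    rw [hS0]
    exact (hf.differentiable (by simp)).differentiableAt.hasDerivAt
  have hmain := (hasDerivAt_volDensity_varyMetric (δg := δg) hg).fun_mul (hfS.comp 0 hS)
  unfold palatiniDensity
  convert! hmain using 1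
  have hv0 : volDensity (varyMetric g δg 0) y = volDensity g y := by
    simp only [volDensity]
    rw [(varyMetric_zero_eventuallyEq hg).self_of_nhds]
  simp only [Function.comp_apply, hS0, hv0, gothicMetric, Finset.mul_sum, Finset.sum_mul,
    ← Finset.sum_add_distrib]
  refine Finset.sum_congr rfl fun a _ => Finset.sum_congr rfl fun b _ => ?_
  rw [← hδ a b]
  ring

end Fields

end Variations

section EulerLagrange

open Filter Topology

/-! ### Integration by parts in the first variation -/

/-- The covariant derivative `∇_c H^{ab}` of a tensor density of weight one. -/
noncomputable def densityDeriv (H : Fin 4 → Fin 4 → Coord → ℝ)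
    (Γ : Coord → Fin 4 → Fin 4 → Fin 4 → ℝ) (y : Coord) (c a b : Fin 4) : ℝ :=
  pd c (H a b) y +
    ∑ d, (Γ y a c d * H d b y + Γ y b c d * H a d y - Γ y d c d * H a b y)

/-- The Euler--Lagrange expression `-∇_c H^{ab} + δ_c^b ∇_d H^{ad}` that belongs to the variation
of `Γ^c_{ab}`, before symmetrization in `a` and `b`. -/
noncomputable def connectionEL (H : Fin 4 → Fin 4 → Coord → ℝ)
    (Γ : Coord → Fin 4 → Fin 4 → Fin 4 → ℝ) (y : Coord) (c a b : Fin 4) : ℝ :=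
  -densityDeriv H Γ y c a b + if c = b then ∑ d, densityDeriv H Γ y d a d else 0

/-- The vector density whose divergence is split off from `H^{ab} δR_{ab}`. -/
noncomputable def boundaryCurrent (H : Fin 4 → Fin 4 → Coord → ℝ)
    (X : Coord → Fin 4 → Fin 4 → Fin 4 → ℝ) (c : Fin 4) (y : Coord) : ℝ :=
  ∑ a, ∑ b, (H a b y * X y c a b - H a c y * X y b a b)

section SumPermutations

variable {ι : Type*} [Fintype ι] (F : ι → ι → ι → ι → ℝ)

lemma sum_swap_first : ∑ a, ∑ b, ∑ c, ∑ d, F a b c d = ∑ a, ∑ b, ∑ c, ∑ d, F b a c d :=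
  Finset.sum_comm

lemma sum_swap_middle : ∑ a, ∑ b, ∑ c, ∑ d, F a b c d = ∑ a, ∑ b, ∑ c, ∑ d, F a c b d :=
  Finset.sum_congr rfl fun _ _ => Finset.sum_comm

lemma sum_swap_last : ∑ a, ∑ b, ∑ c, ∑ d, F a b c d = ∑ a, ∑ b, ∑ c, ∑ d, F a b d c :=
  Finset.sum_congr rfl fun _ _ => Finset.sum_congr rfl fun _ _ => Finset.sum_comm

lemma sum_perm_rotate : ∑ a, ∑ b, ∑ c, ∑ d, F a b c d = ∑ a, ∑ b, ∑ c, ∑ d, F b c d a :=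
  (sum_swap_last F).trans ((sum_swap_middle _).trans (sum_swap_first _))

lemma sum_perm_fourCycle : ∑ a, ∑ b, ∑ c, ∑ d, F a b c d = ∑ a, ∑ b, ∑ c, ∑ d, F d c a b :=
  (sum_swap_first F).trans ((sum_swap_middle _).trans ((sum_swap_last _).trans
    ((sum_swap_first _).trans (sum_swap_middle _))))

lemma sum_perm_threeCycle : ∑ a, ∑ b, ∑ c, ∑ d, F a b c d = ∑ a, ∑ b, ∑ c, ∑ d, F b d c a :=
  (sum_swap_middle F).trans ((sum_swap_last _).trans ((sum_swap_middle _).trans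
    (sum_swap_first _)))

end SumPermutations

/-- The terms without derivatives in the integration by parts. -/
lemma sum_connection_terms {H : Fin 4 → Fin 4 → ℝ} {C X : Fin 4 → Fin 4 → Fin 4 → ℝ}
    (hC : ∀ c a b, C c a b = C c b a) (hX : ∀ c a b, X c a b = X c b a) :
    ∑ a, ∑ b, H a b * ∑ c, ∑ d, ((X c c d * C d a b + C c c d * X d a b) -
      (X c b d * C d a c + C c b d * X d a c)) =
    ∑ c, ∑ a, ∑ b, -(∑ d, (C a c d * H d b + C b c d * H a d - C d c d * H a b)) * X c a b +
    ∑ c, ∑ a, (∑ e, ∑ d, (C a e d * H d e + C e e d * H a d - C d e d * H a e)) * X c a c := by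
  have h0 : ∀ a, ∑ e, ∑ d, (C a e d * H d e + C e e d * H a d - C d e d * H a e) =
      ∑ e, ∑ d, C a e d * H d e := by
    intro a
    have h1 : ∑ e, ∑ d, C e e d * H a d = ∑ e, ∑ d, C d e d * H a e := by
      rw [Finset.sum_comm]
      exact Finset.sum_congr rfl fun e _ => Finset.sum_congr rfl fun d _ => by rw [hC d e d]
    simp only [Finset.sum_add_distrib, Finset.sum_sub_distrib, h1]
    ring
  have e1 : ∑ a, ∑ b, ∑ c, ∑ d, H a b * (X c c d * C d a b) =
      ∑ c, ∑ a, ∑ e, ∑ d, C a e d * H d e * X c a c := by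
    rw [sum_perm_fourCycle]
    exact Finset.sum_congr rfl fun c _ => Finset.sum_congr rfl fun a _ =>
      Finset.sum_congr rfl fun e _ => Finset.sum_congr rfl fun d _ => by
        rw [hC a e d, hX c a c]; ring
  have e2 : ∑ a, ∑ b, ∑ c, ∑ d, H a b * (C c c d * X d a b) =
      ∑ c, ∑ a, ∑ b, ∑ d, C d c d * H a b * X c a b := by
    rw [sum_perm_rotate]
    exact Finset.sum_congr rfl fun c _ => Finset.sum_congr rfl fun a _ =>
      Finset.sum_congr rfl fun e _ => Finset.sum_congr rfl fun d _ => by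
        rw [hC d c d]; ring
  have e3 : ∑ a, ∑ b, ∑ c, ∑ d, H a b * (X c b d * C d a c) =
      ∑ c, ∑ a, ∑ b, ∑ d, C a c d * H d b * X c a b := by
    rw [sum_perm_fourCycle]
    exact Finset.sum_congr rfl fun c _ => Finset.sum_congr rfl fun a _ =>
      Finset.sum_congr rfl fun e _ => Finset.sum_congr rfl fun d _ => by
        rw [hC a c d, hX c a e]; ring
  have e4 : ∑ a, ∑ b, ∑ c, ∑ d, H a b * (C c b d * X d a c) =
      ∑ c, ∑ a, ∑ b, ∑ d, C b c d * H a d * X c a b := by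
    rw [sum_perm_threeCycle]
    exact Finset.sum_congr rfl fun c _ => Finset.sum_congr rfl fun a _ =>
      Finset.sum_congr rfl fun e _ => Finset.sum_congr rfl fun d _ => by
        rw [hC e c d]; ring
  simp only [h0]
  simp only [Finset.mul_sum, Finset.sum_mul, mul_sub, mul_add, sub_mul, add_mul, neg_mul,
    Finset.sum_add_distrib, Finset.sum_sub_distrib, Finset.sum_neg_distrib, e1, e2, e3, e4]
  ring

/-- `H^{ab} δR_{ab}` is the Euler--Lagrange expression contracted with `δΓ`, up to a
divergence. -/
lemma sum_mul_ricciVariation {H : Fin 4 → Fin 4 → Coord → ℝ}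
    {Γ X : Coord → Fin 4 → Fin 4 → Fin 4 → ℝ} {y : Coord}
    (hH : ∀ a b, DifferentiableAt ℝ (H a b) y)
    (hX : ∀ c a b, DifferentiableAt ℝ (fun z => X z c a b) y)
    (hΓs : ∀ c a b, Γ y c a b = Γ y c b a) (hXs : ∀ c a b, X y c a b = X y c b a) :
    ∑ a, ∑ b, H a b y * ricciVariation Γ X y a b =
      ∑ c, ∑ a, ∑ b, connectionEL H Γ y c a b * X y c a b +
        ∑ c, pd c (boundaryCurrent H X c) y := by
  have hcur : ∀ c, pd c (boundaryCurrent H X c) y = ∑ a, ∑ b,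
      ((pd c (H a b) y * X y c a b + H a b y * pd c (fun z => X z c a b) y) -
        (pd c (H a c) y * X y b a b + H a c y * pd c (fun z => X z b a b) y)) := by
    intro c
    unfold boundaryCurrent
    have hd : ∀ a b, DifferentiableAt ℝ
        (fun z => H a b z * X z c a b - H a c z * X z b a b) y := fun a b =>
      ((hH a b).fun_mul (hX c a b)).fun_sub ((hH a c).fun_mul (hX b a b))
    rw [pd_sum c fun a _ => DifferentiableAt.fun_sum fun b _ => hd a b]
    refine Finset.sum_congr rfl fun a _ => ?_
    rw [pd_sum c fun b _ => hd a b]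
    refine Finset.sum_congr rfl fun b _ => ?_
    have h1 := pd_mul c (hH a b) (hX c a b)
    have h2 := pd_mul c (hH a c) (hX b a b)
    rw [← h1, ← h2]
    unfold pd
    rw [fderiv_fun_sub ((hH a b).fun_mul (hX c a b)) ((hH a c).fun_mul (hX b a b))]
    rfl
  have hEL : ∑ c, ∑ a, ∑ b, connectionEL H Γ y c a b * X y c a b =
      ∑ c, ∑ a, ∑ b, -densityDeriv H Γ y c a b * X y c a b +
        ∑ c, ∑ a, (∑ d, densityDeriv H Γ y d a d) * X y c a c := by
    simp only [connectionEL, add_mul, ite_mul, zero_mul, Finset.sum_add_distrib,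
      Finset.sum_ite_eq, Finset.mem_univ, if_true]
  have hterms := sum_connection_terms (H := fun a b => H a b y) hΓs hXs
  have p1 : ∑ a, ∑ b, ∑ c, H a b y * pd c (fun z => X z c a b) y =
      ∑ c, ∑ a, ∑ b, H a b y * pd c (fun z => X z c a b) y :=
    (Finset.sum_congr rfl fun _ _ => Finset.sum_comm).trans Finset.sum_comm
  have p2 : ∑ a, ∑ b, ∑ c, H a b y * pd b (fun z => X z c a c) y =
      ∑ c, ∑ a, ∑ b, H a c y * pd c (fun z => X z b a b) y := Finset.sum_comm
  have p3 : ∑ c, ∑ a, ∑ d, pd d (H a d) y * X y c a c =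
      ∑ c, ∑ a, ∑ b, pd c (H a c) y * X y b a b :=
    (Finset.sum_congr rfl fun _ _ => Finset.sum_comm).trans (Finset.sum_comm.trans
      (Finset.sum_congr rfl fun _ _ => Finset.sum_comm))
  have hsplit : ∑ a, ∑ b, H a b y * ricciVariation Γ X y a b =
      ∑ a, ∑ b, ∑ c, H a b y * pd c (fun z => X z c a b) y -
        ∑ a, ∑ b, ∑ c, H a b y * pd b (fun z => X z c a c) y +
      ∑ a, ∑ b, H a b y * ∑ c, ∑ d, ((X y c c d * Γ y d a b + Γ y c c d * X y d a b) -
        (X y c b d * Γ y d a c + Γ y c b d * X y d a c)) := by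
    rw [← Finset.sum_sub_distrib, ← Finset.sum_add_distrib]
    refine Finset.sum_congr rfl fun a _ => ?_
    rw [← Finset.sum_sub_distrib, ← Finset.sum_add_distrib]
    refine Finset.sum_congr rfl fun b _ => ?_
    rw [ricciVariation, mul_add, Finset.sum_sub_distrib, mul_sub, Finset.mul_sum, Finset.mul_sum]
  have hdiv : ∑ c, ∑ a, ∑ b, -densityDeriv H Γ y c a b * X y c a b +
        ∑ c, ∑ a, (∑ d, densityDeriv H Γ y d a d) * X y c a c =
      ∑ c, ∑ a, ∑ d, pd d (H a d) y * X y c a c -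
        ∑ c, ∑ a, ∑ b, pd c (H a b) y * X y c a b +
      (∑ c, ∑ a, ∑ b, -(∑ d, (Γ y a c d * H d b y + Γ y b c d * H a d y -
          Γ y d c d * H a b y)) * X y c a b +
        ∑ c, ∑ a, (∑ e, ∑ d, (Γ y a e d * H d e y + Γ y e e d * H a d y -
          Γ y d e d * H a e y)) * X y c a c) := by
    have h1 : ∀ c a b, -densityDeriv H Γ y c a b * X y c a b = -(pd c (H a b) y * X y c a b) +
        -(∑ d, (Γ y a c d * H d b y + Γ y b c d * H a d y - Γ y d c d * H a b y)) *
          X y c a b := fun c a b => by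
      rw [densityDeriv]; ring
    have h2 : ∀ c a, (∑ d, densityDeriv H Γ y d a d) * X y c a c =
        ∑ d, pd d (H a d) y * X y c a c +
        (∑ e, ∑ d, (Γ y a e d * H d e y + Γ y e e d * H a d y - Γ y d e d * H a e y)) *
          X y c a c := fun c a => by
      rw [← Finset.sum_mul, ← add_mul, ← Finset.sum_add_distrib]
      rfl
    simp only [h1, h2, Finset.sum_add_distrib, Finset.sum_neg_distrib]
    ring
  rw [hsplit, hterms, hEL, hdiv, p1, p2, p3]
  simp only [hcur, Finset.sum_add_distrib, Finset.sum_sub_distrib]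
  ring

/-- The Euler--Lagrange expression `√(-g) (f'(R) R_{ab} - ½ f(R) g_{ab})` that belongs to the
variation of `g^{ab}`, before symmetrization. -/
noncomputable def metricEL (f : ℝ → ℝ) (g : Coord → Matrix (Fin 4) (Fin 4) ℝ)
    (Γ : Coord → Fin 4 → Fin 4 → Fin 4 → ℝ) (y : Coord) (a b : Fin 4) : ℝ :=
  volDensity g y * (deriv f (localScalar g Γ y) * ricci Γ y a b -
    1 / 2 * f (localScalar g Γ y) * g y a b)

section Smooth

variable {f : ℝ → ℝ} {g : Coord → Matrix (Fin 4) (Fin 4) ℝ}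
  {Γ : Coord → Fin 4 → Fin 4 → Fin 4 → ℝ} {y : Coord}

lemma contDiffAt_metricEL (hf : ContDiff ℝ ∞ f) (hg : IsMetricAt g y) (hΓ : IsConnAt Γ y)
    (a b : Fin 4) : ContDiffAt ℝ ∞ (fun z => metricEL f g Γ z a b) y := by
  have hf' : ContDiff ℝ ∞ (deriv f) := (contDiff_infty_iff_deriv.1 hf).2
  have hS := contDiffAt_localScalar hg hΓ
  exact hg.contDiffAt_volDensity.mul (((hf'.contDiffAt.comp y hS).mul
    (hΓ.contDiffAt_ricci a b)).sub ((contDiffAt_const.mul (hf.contDiffAt.comp y hS)).mul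
      (hg.smooth a b)))

lemma contDiffAt_connectionEL {H : Fin 4 → Fin 4 → Coord → ℝ}
    (hH : ∀ a b, ContDiffAt ℝ ∞ (H a b) y) (hΓ : IsConnAt Γ y) (c a b : Fin 4) :
    ContDiffAt ℝ ∞ (fun z => connectionEL H Γ z c a b) y := by
  have hD : ∀ c a b, ContDiffAt ℝ ∞ (fun z => densityDeriv H Γ z c a b) y := fun c a b =>
    ((hH a b).pd c).add (ContDiffAt.sum fun d _ =>
      (((hΓ.smooth a c d).mul (hH d b)).add ((hΓ.smooth b c d).mul (hH a d))).sub
        ((hΓ.smooth d c d).mul (hH a b)))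
  unfold connectionEL
  refine (hD c a b).neg.add ?_
  by_cases hcb : c = b
  · simp only [hcb, if_true]
    exact ContDiffAt.sum fun d _ => hD d a d
  · simp only [hcb, if_false]
    exact contDiffAt_const

end Smooth

/-- The first variation of the Palatini action, with a further term `W` of the Lagrangian
density, in Euler--Lagrange form. -/
lemma hasDerivAt_action {f : ℝ → ℝ} (hf : ContDiff ℝ ∞ f) {U : Set Coord}
    {g δg : Coord → Matrix (Fin 4) (Fin 4) ℝ} {Γ X : Coord → Fin 4 → Fin 4 → Fin 4 → ℝ}
    (hg : ∀ y ∈ U, IsMetricAt g y) (hΓ : ∀ y ∈ U, IsConnAt Γ y)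
    {K : Set Coord} (hK : IsCompact K) (hKU : K ⊆ U)
    (hδ : IsMetricVariation K δg) (hX : IsSymVariation K X)
    {W : ℝ × Coord → ℝ} (hW : ∀ y ∈ K, ContDiffAt ℝ ∞ W (0, y)) {W' : Coord → ℝ}
    (hW' : ∀ y ∈ K, HasDerivAt (fun t => W (t, y)) (W' y) 0) (hWc : ContinuousOn W' K) :
    HasDerivAt (fun t => ∫ y in K,
        (palatiniDensity f (varyMetric g δg t) (vary Γ X t) y + W (t, y)))
      (∫ y in K, (∑ a, ∑ b, metricEL f g Γ y a b * δg y a b +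
        ∑ c, ∑ a, ∑ b, connectionEL (gothicMetric f g Γ) Γ y c a b * X y c a b + W' y)) 0 := by
  have hXd : ∀ c a b y, DifferentiableAt ℝ (fun z => X z c a b) y := fun c a b y =>
    (hX c a b).1.contDiffAt.differentiableAt (by simp)
  have hH : ∀ a b, ∀ y ∈ U, ContDiffAt ℝ ∞ (gothicMetric f g Γ a b) y := fun a b y hy =>
    contDiffAt_gothicMetric hf (hg y hy) (hΓ y hy) a b
  have hder := hasDerivAt_setIntegral hK
    (F := fun q => palatiniDensity f (varyMetric g δg q.1) (vary Γ X q.1) q.2 + W q)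
    (fun y hy => (contDiffAt_palatiniDensity_param (gt := varyMetric g δg) (Γt := vary Γ X) hf
      ((hg y (hKU hy)).contDiffAt_varyMetric fun a b => (hδ a b).1.contDiffAt)
      (hg y (hKU hy)).det_varyMetric_zero
      (contDiffAt_vary (hΓ y (hKU hy)).smooth fun c a b => (hX c a b).1.contDiffAt)).add (hW y hy))
    (fun y hy => (hasDerivAt_palatiniDensity hf (hg y (hKU hy)) (hΓ y (hKU hy))
      (fun a b => (hδ a b).2.2 y) (fun c a b => hXd c a b y)).add (hW' y hy))
  convert! hder using 1
  -- the boundary current is a smooth function with support in `K`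
  have hterm : ∀ a b e k l, ContDiff ℝ ∞ (fun z => gothicMetric f g Γ a b z * X z e k l) ∧
      ∀ y ∉ K, gothicMetric f g Γ a b y * X y e k l = 0 := by
    intro a b e k l
    refine ⟨contDiff_mul_of_tsupport (hH a b) (hX e k l).1 ((hX e k l).2.1.trans hKU), ?_⟩
    intro y hy
    have h : X y e k l = 0 :=
      image_eq_zero_of_notMem_tsupport (f := fun z => X z e k l) fun h => hy ((hX e k l).2.1 h)
    rw [h, mul_zero]
  have hB : ∀ c, ContDiff ℝ ∞ (boundaryCurrent (gothicMetric f g Γ) X c) := fun c =>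
    ContDiff.sum fun a _ => ContDiff.sum fun b _ =>
      (hterm a b c a b).1.sub (hterm a c b a b).1
  have hBs : ∀ c, tsupport (boundaryCurrent (gothicMetric f g Γ) X c) ⊆ K := by
    intro c
    refine closure_minimal (fun y hy => ?_) hK.isClosed
    by_contra h
    refine hy ?_
    refine Finset.sum_eq_zero fun a _ => Finset.sum_eq_zero fun b _ => ?_
    rw [(hterm a b c a b).2 y h, (hterm a c b a b).2 y h, sub_zero]
  have hBi : ∀ c, IntegrableOn (pd c (boundaryCurrent (gothicMetric f g Γ) X c)) K := fun c =>
    (continuous_iff_continuousAt.2 fun y =>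
      ((hB c).contDiffAt.pd c).continuousAt).continuousOn.integrableOn_compact hK
  have hEi : IntegrableOn (fun y => ∑ a, ∑ b, metricEL f g Γ y a b * δg y a b +
      ∑ c, ∑ a, ∑ b, connectionEL (gothicMetric f g Γ) Γ y c a b * X y c a b + W' y) K := by
    refine ContinuousOn.integrableOn_compact hK (ContinuousOn.add (ContinuousOn.add ?_ ?_) hWc)
    · refine continuousOn_finsetSum _ fun a _ => continuousOn_finsetSum _ fun b _ => ?_
      exact fun y hy => ((contDiffAt_metricEL hf (hg y (hKU hy)) (hΓ y (hKU hy)) a b).mul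
        (hδ a b).1.contDiffAt).continuousAt.continuousWithinAt
    · refine continuousOn_finsetSum _ fun c _ => continuousOn_finsetSum _ fun a _ =>
        continuousOn_finsetSum _ fun b _ => ?_
      exact fun y hy => ((contDiffAt_connectionEL (fun a b => hH a b y (hKU hy))
        (hΓ y (hKU hy)) c a b).mul (hX c a b).1.contDiffAt).continuousAt.continuousWithinAt
  have hsum : ∫ y in K, ∑ c, pd c (boundaryCurrent (gothicMetric f g Γ) X c) y = 0 := by
    rw [integral_finsetSum _ fun c _ => hBi c]
    exact Finset.sum_eq_zero fun c _ => setIntegral_pd_eq_zero hK (hB c) (hBs c) c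
  rw [← add_zero (∫ y in K, _), ← hsum, ← integral_add hEi (integrable_finsetSum _ fun c _ =>
    hBi c)]
  refine setIntegral_congr_fun hK.measurableSet fun y hy => ?_
  have := sum_mul_ricciVariation (H := gothicMetric f g Γ) (Γ := Γ) (X := X) (y := y)
    (fun a b => (hH a b y (hKU hy)).differentiableAt (by simp)) (fun c a b => hXd c a b y)
    (hΓ y (hKU hy)).symm.self_of_nhds (fun c a b => (hX c a b).2.2 y)
  simp only [this, metricEL]
  ring

/-! ### From the vanishing of the first variation to the field equations -/

/-- The fundamental lemma for symmetric variations sees only the symmetric part of the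
coefficients. -/
lemma symm_eq_zero_of_metricVariation {U : Set Coord} (hU : IsOpen U)
    {A : Coord → Fin 4 → Fin 4 → ℝ} (hA : ∀ a b, ContinuousOn (fun y => A y a b) U)
    (h : ∀ K : Set Coord, IsCompact K → K ⊆ U → ∀ δg, IsMetricVariation K δg →
      ∫ y in K, ∑ a, ∑ b, A y a b * δg y a b = 0) :
    ∀ y ∈ U, ∀ a b, A y a b + A y b a = 0 := by
  intro y hy a b
  refine eq_zero_of_forall_setIntegral_mul_eq_zero hU (A := fun y => A y a b + A y b a)
    ((hA a b).add (hA b a)) (fun K hK hKU φ hφ hs => ?_) y hy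
  have h1 := h K hK hKU (fun z => Matrix.of fun p q =>
      φ z * ((if p = a ∧ q = b then 1 else 0) + if p = b ∧ q = a then 1 else 0)) (fun p q => ?_)
  · rw [← h1]
    refine setIntegral_congr_fun hK.measurableSet fun z _ => ?_
    simp [mul_add, Finset.sum_add_distrib, ite_and, Finset.sum_ite_eq', add_mul]
  · refine ⟨hφ.mul contDiff_const, (tsupport_mul_subset_left).trans hs, fun z => ?_⟩
    simp only [Matrix.of_apply]
    rw [add_comm]
    simp only [and_comm]

lemma symm_eq_zero_of_symVariation {U : Set Coord} (hU : IsOpen U)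
    {A : Coord → Fin 4 → Fin 4 → Fin 4 → ℝ}
    (hA : ∀ c a b, ContinuousOn (fun y => A y c a b) U)
    (h : ∀ K : Set Coord, IsCompact K → K ⊆ U → ∀ X, IsSymVariation K X →
      ∫ y in K, ∑ c, ∑ a, ∑ b, A y c a b * X y c a b = 0) :
    ∀ y ∈ U, ∀ c a b, A y c a b + A y c b a = 0 := by
  intro y hy c a b
  refine eq_zero_of_forall_setIntegral_mul_eq_zero hU (A := fun y => A y c a b + A y c b a)
    ((hA c a b).add (hA c b a)) (fun K hK hKU φ hφ hs => ?_) y hy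
  have h1 := h K hK hKU (fun z r p q => φ z * (if r = c then
      ((if p = a ∧ q = b then 1 else 0) + if p = b ∧ q = a then 1 else 0) else 0))
      (fun r p q => ?_)
  · rw [← h1]
    refine setIntegral_congr_fun hK.measurableSet fun z _ => ?_
    simp [mul_add, Finset.sum_add_distrib, ite_and, Finset.sum_ite_eq', add_mul]
  · refine ⟨hφ.mul contDiff_const, (tsupport_mul_subset_left).trans hs, fun z => ?_⟩
    dsimp only
    rw [add_comm]
    simp only [and_comm]

/-- The trace argument: the symmetrized Euler--Lagrange expression determines `∇_c H^{ab}`. -/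
lemma densityDeriv_eq_zero_iff {H : Fin 4 → Fin 4 → Coord → ℝ}
    {Γ : Coord → Fin 4 → Fin 4 → Fin 4 → ℝ} {y : Coord}
    (hs : ∀ c a b, densityDeriv H Γ y c a b = densityDeriv H Γ y c b a) :
    (∀ c a b, connectionEL H Γ y c a b + connectionEL H Γ y c b a = 0) ↔
      ∀ c a b, densityDeriv H Γ y c a b = 0 := by
  constructor
  · intro h
    have h1 : ∀ a, ∑ d, densityDeriv H Γ y d a d = 0 := by
      intro a
      have h2 : ∑ c, (connectionEL H Γ y c a c + connectionEL H Γ y c c a) = 0 :=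
        Finset.sum_eq_zero fun c _ => h c a c
      simp only [connectionEL, if_true, Finset.sum_add_distrib, Finset.sum_neg_distrib,
        Finset.sum_const, Finset.card_univ, Fintype.card_fin, Finset.sum_ite_eq', Finset.mem_univ]
        at h2
      simp only [fun d => hs d d a, nsmul_eq_mul] at h2
      push_cast at h2
      linarith
    intro c a b
    have h2 := h c a b
    simp only [connectionEL, h1, ite_self, add_zero, hs c b a] at h2
    linarith
  · intro h c a b
    simp [connectionEL, h]

end EulerLagrange

section OnManifold

open Filter Topology

variable {M : Type*} [TopologicalSpace M] [ChartedSpace Coord M]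

/-! ### Scalars and one-forms on the manifold -/

lemma LorentzMetric.isMetricAt (g : LorentzMetric M) {e : OpenPartialHomeomorph M Coord}
    (he : IsChart M e) {y : Coord} (hy : y ∈ e.target) : IsMetricAt (g.comp e) y where
  smooth a b := (g.smooth e he a b).contDiffAt (e.open_target.mem_nhds hy)
  symm := by
    filter_upwards [e.open_target.mem_nhds hy] with z hz a b
    exact g.symm e he z hz a b
  det_neg := by
    obtain ⟨P, hP, h⟩ := g.lorentzian e he y hy
    have h1 := congrArg Matrix.det h
    rw [Matrix.det_mul, Matrix.det_mul, Matrix.det_transpose, Matrix.det_diagonal] at h1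
    have h2 : 0 < P.det * P.det := mul_self_pos.2 hP.ne_zero
    have h3 : P.det * P.det * (g.comp e y).det = -1 := by
      simp [Fin.prod_univ_four] at h1
      linarith
    by_contra h4
    nlinarith [mul_nonneg h2.le (not_lt.1 h4)]

lemma SymConnection.isConnAt (Γ : SymConnection M) {e : OpenPartialHomeomorph M Coord}
    (he : IsChart M e) {y : Coord} (hy : y ∈ e.target) : IsConnAt (Γ.comp e) y where
  smooth c a b := (Γ.smooth e he c a b).contDiffAt (e.open_target.mem_nhds hy)
  symm := by
    filter_upwards [e.open_target.mem_nhds hy] with z hz c a b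
    exact Γ.symm e he z hz c a b

/-- Coordinate changes are smooth. -/
lemma contDiffAt_transition {e e' : OpenPartialHomeomorph M Coord} (he : IsChart M e)
    (he' : IsChart M e') {z : Coord} (hz : z ∈ e.target) (hz' : e.symm z ∈ e'.source) :
    ContDiffAt ℝ ∞ (fun w => e' (e.symm w)) z := by
  have h1 := IsManifold.compatible_of_mem_maximalAtlas he he'
  have h2 : ContDiffOn ℝ ∞ (e.symm.trans e') (e.symm.trans e').source :=
    contMDiffOn_iff_contDiffOn.1 (contMDiffOn_of_mem_contDiffGroupoid h1)
  exact h2.contDiffAt ((e.symm.trans e').open_source.mem_nhds ⟨hz, hz'⟩)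

lemma eventually_mem_overlap {N : Type*} [TopologicalSpace N]
    {e e' : OpenPartialHomeomorph N Coord} {x : N} (hx : x ∈ e.source)
    (hx' : x ∈ e'.source) : ∀ᶠ z in 𝓝 (e x), z ∈ e.target ∧ e.symm z ∈ e'.source := by
  have h : e x ∈ (e.symm.trans e').source := ⟨e.map_source hx, by
    change e.symm (e x) ∈ e'.source
    rwa [e.left_inv hx]⟩
  exact (e.symm.trans e').open_source.mem_nhds h

/-- The chain rule for a function on the manifold. -/
lemma pd_chart_change {e e' : OpenPartialHomeomorph M Coord} (he : IsChart M e)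
    (he' : IsChart M e') {x : M} (hx : x ∈ e.source) (hx' : x ∈ e'.source) {u : M → ℝ}
    (hu : DifferentiableAt ℝ (fun z => u (e'.symm z)) (e' x)) (a : Fin 4) :
    pd a (fun z => u (e.symm z)) (e x) =
      ∑ i, jac e e' x i a * pd i (fun z => u (e'.symm z)) (e' x) := by
  have hτ : DifferentiableAt ℝ (fun w => e' (e.symm w)) (e x) :=
    (contDiffAt_transition he he' (e.map_source hx)
      (by rwa [e.left_inv hx])).differentiableAt (by simp)
  have h1 : (fun z => u (e.symm z)) =ᶠ[𝓝 (e x)]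
      fun z => (fun w => u (e'.symm w)) (e' (e.symm z)) := by
    filter_upwards [eventually_mem_overlap hx hx'] with z hz
    simp only [e'.left_inv hz.2]
  rw [pd_congr a h1, pd_comp (F := fun w => u (e'.symm w)) a (by rwa [e.left_inv hx]) hτ,
    e.left_inv hx]
  rfl

lemma LorentzMetric.comp_eq_jac (g : LorentzMetric M) {e e' : OpenPartialHomeomorph M Coord}
    (he : IsChart M e) (he' : IsChart M e') {x : M} (hx : x ∈ e.source) (hx' : x ∈ e'.source) :
    g.comp e (e x) = (Matrix.of (jac e e' x)).transpose * g.comp e' (e' x) *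
      Matrix.of (jac e e' x) := by
  ext a b
  rw [g.transform e he e' he' x ⟨hx, hx'⟩]
  simp only [Matrix.mul_apply, Matrix.transpose_apply, Matrix.of_apply, Finset.sum_mul]
  rw [Finset.sum_comm]
  exact Finset.sum_congr rfl fun i _ => Finset.sum_congr rfl fun j _ => by ring

lemma LorentzMetric.det_jac_ne_zero (g : LorentzMetric M)
    {e e' : OpenPartialHomeomorph M Coord} (he : IsChart M e) (he' : IsChart M e') {x : M}
    (hx : x ∈ e.source) (hx' : x ∈ e'.source) : (Matrix.of (jac e e' x)).det ≠ 0 := by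
  intro h
  have h1 := (g.isMetricAt he (e.map_source hx)).det_neg
  rw [g.comp_eq_jac he he' hx hx', Matrix.det_mul, h, mul_zero] at h1
  exact lt_irrefl _ h1

lemma SymConnection.ricci_eq_jac (Γ : SymConnection M) {e e' : OpenPartialHomeomorph M Coord}
    (he : IsChart M e) (he' : IsChart M e') {x : M} (hx : x ∈ e.source) (hx' : x ∈ e'.source)
    (hdet : (Matrix.of (jac e e' x)).det ≠ 0) (a b : Fin 4) :
    ricci (Γ.comp e) (e x) a b =
      ∑ i, ∑ j, jac e e' x i a * jac e e' x j b * ricci (Γ.comp e') (e' x) i j := by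
  have hy := e.map_source hx
  have hx0 : e.symm (e x) = x := e.left_inv hx
  have hov := eventually_mem_overlap hx hx'
  have h1 := ricci_transform (Γ := Γ.comp e) (Γ' := Γ.comp e') (τ := fun w => e' (e.symm w))
    (y := e x)
    (by filter_upwards [hov] with z hz using contDiffAt_transition he he' hz.1 hz.2)
    (Γ.isConnAt he hy).smooth
    (by rw [hx0]; exact (Γ.isConnAt he' (e'.map_source hx')).smooth)
    (Γ.isConnAt he hy).symm.self_of_nhds
    (by rw [hx0]; exact (Γ.isConnAt he' (e'.map_source hx')).symm.self_of_nhds)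
    hdet ?_ a b
  · rw [h1, hx0]
    rfl
  · filter_upwards [hov] with z hz k a b
    have h2 := Γ.transform e he e' he' (e.symm z) ⟨e.map_target hz.1, hz.2⟩ k a b
    simp only [jac, e.right_inv hz.1] at h2
    exact h2

/-- The scalar curvature does not depend on the chart. -/
lemma localScalar_eq_of_charts (g : LorentzMetric M) (Γ : SymConnection M)
    {e e' : OpenPartialHomeomorph M Coord} (he : IsChart M e) (he' : IsChart M e') {x : M}
    (hx : x ∈ e.source) (hx' : x ∈ e'.source) :
    localScalar (g.comp e) (Γ.comp e) (e x) = localScalar (g.comp e') (Γ.comp e') (e' x) := by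
  have hdet := g.det_jac_ne_zero he he' hx hx'
  have htr : ∀ (A : Matrix (Fin 4) (Fin 4) ℝ) (B : Fin 4 → Fin 4 → ℝ),
      ∑ a, ∑ b, A a b * B a b = (A * (Matrix.of B).transpose).trace := by
    intro A B
    simp only [Matrix.trace, Matrix.diag_apply, Matrix.mul_apply, Matrix.transpose_apply,
      Matrix.of_apply]
  have hric : Matrix.of (fun a b => ricci (Γ.comp e) (e x) a b) =
      (Matrix.of (jac e e' x)).transpose * Matrix.of (fun a b => ricci (Γ.comp e') (e' x) a b) *
        Matrix.of (jac e e' x) := by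
    ext a b
    rw [Matrix.of_apply, Γ.ricci_eq_jac he he' hx hx' hdet]
    simp only [Matrix.mul_apply, Matrix.transpose_apply, Matrix.of_apply, Finset.sum_mul]
    rw [Finset.sum_comm]
    exact Finset.sum_congr rfl fun i _ => Finset.sum_congr rfl fun j _ => by ring
  unfold localScalar
  rw [htr, htr]
  set J := Matrix.of (jac e e' x)
  have hJ : IsUnit J.det := isUnit_iff_ne_zero.2 hdet
  change ((g.comp e (e x))⁻¹ * (Matrix.of (fun a b => ricci (Γ.comp e) (e x) a b)).transpose).trace
    = _
  rw [hric, g.comp_eq_jac he he' hx hx', Matrix.mul_inv_rev, Matrix.mul_inv_rev,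
    Matrix.transpose_mul, Matrix.transpose_mul, Matrix.transpose_transpose]
  have hJt : IsUnit J.transpose.det := by rwa [Matrix.det_transpose]
  rw [mul_assoc, Matrix.trace_mul_comm, mul_assoc, mul_assoc, mul_assoc, mul_assoc,
    Matrix.mul_nonsing_inv _ hJ, mul_one, ← mul_assoc J.transpose⁻¹,
    Matrix.nonsing_inv_mul _ hJt, one_mul]

variable [IsManifold (𝓡 4) ∞ M]

/-- The scalar curvature may be computed in any chart. -/
lemma scalarCurvature_symm_apply (g : LorentzMetric M) (Γ : SymConnection M)
    {e : OpenPartialHomeomorph M Coord} (he : IsChart M e) {y : Coord} (hy : y ∈ e.target) :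
    scalarCurvature g Γ (e.symm y) = localScalar (g.comp e) (Γ.comp e) y := by
  have h := localScalar_eq_of_charts g Γ he
    (IsManifold.chart_mem_maximalAtlas (I := 𝓡 4) (n := ∞) (e.symm y)) (e.map_target hy)
    (mem_chart_source Coord (e.symm y))
  rw [e.right_inv hy] at h
  exact h.symm

lemma comp_scalarCurvature_eventuallyEq (g : LorentzMetric M) (Γ : SymConnection M) (φ : ℝ → ℝ)
    {e : OpenPartialHomeomorph M Coord} (he : IsChart M e) {y : Coord} (hy : y ∈ e.target) :
    (fun z => φ (scalarCurvature g Γ (e.symm z))) =ᶠ[𝓝 y]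
      fun z => φ (localScalar (g.comp e) (Γ.comp e) z) := by
  filter_upwards [e.open_target.mem_nhds hy] with z hz
  rw [scalarCurvature_symm_apply g Γ he hz]

lemma contDiffAt_scalarCurvature_symm (g : LorentzMetric M) (Γ : SymConnection M)
    {e : OpenPartialHomeomorph M Coord} (he : IsChart M e) {y : Coord} (hy : y ∈ e.target) :
    ContDiffAt ℝ ∞ (fun z => scalarCurvature g Γ (e.symm z)) y :=
  (contDiffAt_localScalar (g.isMetricAt he hy) (Γ.isConnAt he hy)).congr_of_eventuallyEq
    (comp_scalarCurvature_eventuallyEq g Γ id he hy)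

lemma contMDiff_of_charts {u : M → ℝ} (h : ∀ e, IsChart M e → ∀ y ∈ e.target,
    ContDiffAt ℝ ∞ (fun z => u (e.symm z)) y) : ContMDiff (𝓡 4) 𝓘(ℝ, ℝ) ∞ u := by
  intro x
  have he := IsManifold.chart_mem_maximalAtlas (I := 𝓡 4) (n := ∞) x
  have hx := mem_chart_source Coord x
  have h1 : ContMDiffAt (𝓡 4) (𝓡 4) ∞ (chartAt Coord x) x :=
    contMDiffAt_of_mem_maximalAtlas he hx
  have h2 : ContMDiffAt (𝓡 4) 𝓘(ℝ, ℝ) ∞ (fun z => u ((chartAt Coord x).symm z))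
      (chartAt Coord x x) := (h _ he _ ((chartAt Coord x).map_source hx)).contMDiffAt
  refine (h2.comp x h1).congr_of_eventuallyEq ?_
  filter_upwards [(chartAt Coord x).open_source.mem_nhds hx] with z hz
  simp only [Function.comp_apply, (chartAt Coord x).left_inv hz]

/-- A function with vanishing gradient on a connected manifold is constant. -/
lemma eq_of_forall_pd_eq_zero [ConnectedSpace M] {u : M → ℝ}
    (hd : ∀ e, IsChart M e → ∀ y ∈ e.target, DifferentiableAt ℝ (fun z => u (e.symm z)) y)
    (h : ∀ e, IsChart M e → ∀ y ∈ e.target, ∀ a, pd a (fun z => u (e.symm z)) y = 0) (p q : M) :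
    u p = u q := by
  refine IsLocallyConstant.apply_eq_of_preconnectedSpace
    ((IsLocallyConstant.iff_eventually_eq _).2 fun x => ?_) p q
  have he := IsManifold.chart_mem_maximalAtlas (I := 𝓡 4) (n := ∞) x
  have hx := mem_chart_source Coord x
  set e := chartAt Coord x
  obtain ⟨ε, hε, hb⟩ := Metric.isOpen_iff.1 e.open_target (e x) (e.map_source hx)
  have hf0 : ∀ y ∈ Metric.ball (e x) ε, fderiv ℝ (fun z => u (e.symm z)) y = 0 := by
    intro y hy
    ext v
    have h3 : v = ∑ i, v i • EuclideanSpace.single i (1 : ℝ) := by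
      ext k
      simp [Finset.sum_apply, Pi.single_apply]
    rw [h3, map_sum]
    simp only [map_smul]
    exact Finset.sum_eq_zero fun i _ => by
      have := h e he y (hb hy) i
      unfold pd at this
      rw [this]; simp
  have hconst : ∀ y ∈ Metric.ball (e x) ε, u (e.symm y) = u (e.symm (e x)) := by
    intro y hy
    exact Metric.isOpen_ball.is_const_of_fderiv_eq_zero (convex_ball (e x) ε).isPreconnected
      (fun z hz => (hd e he z (hb hz)).differentiableWithinAt) hf0 hy (Metric.mem_ball_self hε)
  filter_upwards [e.open_source.mem_nhds hx, (e.continuousAt hx).preimage_mem_nhds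
    (Metric.ball_mem_nhds _ hε)] with z hz hz'
  rw [← e.left_inv hz, hconst _ hz', e.left_inv hx]

/-- The gradient of a smooth function, as a one-form. -/
noncomputable def OneForm.grad (Φ : M → ℝ) (hΦ : ∀ e, IsChart M e → ∀ y ∈ e.target,
    ContDiffAt ℝ ∞ (fun z => Φ (e.symm z)) y) : OneForm M where
  comp e y a := pd a (fun z => Φ (e.symm z)) y
  smooth e he a y hy := ((hΦ e he y hy).pd a).contDiffWithinAt
  transform e he e' he' x hx a := pd_chart_change he he' hx.1 hx.2
    ((hΦ e' he' _ (e'.map_source hx.2)).differentiableAt (by simp)) a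

/-- The zero one-form. -/
def OneForm.zeroForm (M : Type*) [TopologicalSpace M] [ChartedSpace Coord M] : OneForm M where
  comp _ _ _ := 0
  smooth _ _ _ := contDiffOn_const
  transform := by simp

/-- The zero field of Lagrange multipliers. -/
def Multiplier.zeroField (M : Type*) [TopologicalSpace M] [ChartedSpace Coord M] :
    Multiplier M where
  comp _ _ _ _ _ := 0
  smooth _ _ _ _ _ := contDiffOn_const
  symm := by simp
  transform := by simp

/-- The conformally related metric `exp(Φ) g`. -/
noncomputable def LorentzMetric.expScale (g : LorentzMetric M) (Φ : M → ℝ)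
    (hΦ : ∀ e, IsChart M e → ∀ y ∈ e.target,
      ContDiffAt ℝ ∞ (fun z => Φ (e.symm z)) y) : LorentzMetric M where
  comp e y := Real.exp (Φ (e.symm y)) • g.comp e y
  smooth e he a b y hy := ((Real.contDiff_exp.contDiffAt.comp y (hΦ e he y hy)).mul
    ((g.isMetricAt he hy).smooth a b)).contDiffWithinAt
  symm e he y hy a b := by
    simp only [Matrix.smul_apply]
    rw [g.symm e he y hy a b]
  lorentzian e he y hy := by
    obtain ⟨P, hP, h⟩ := g.lorentzian e he y hy
    -- the frame is rescaled by `exp(-Φ/2)`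
    set r := Real.exp (-(Φ (e.symm y)) / 2) with hr
    have hr2 : r * (Real.exp (Φ (e.symm y)) * r) = 1 := by
      rw [hr, ← Real.exp_add, ← Real.exp_add, ← Real.exp_zero]
      congr 1
      ring
    refine ⟨r • P, ?_, ?_⟩
    · rw [Matrix.det_smul]
      exact (IsUnit.pow _ (isUnit_iff_ne_zero.2 (Real.exp_pos _).ne')).mul hP
    · rw [Matrix.transpose_smul]
      simp only [smul_mul_assoc, mul_smul_comm, smul_smul, h]
      rw [hr2, one_smul]
  transform e he e' he' x hx a b := by
    simp only [Matrix.smul_apply, smul_eq_mul]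
    rw [g.transform e he e' he' x hx a b, e.left_inv hx.1, e'.left_inv hx.2, Finset.mul_sum]
    refine Finset.sum_congr rfl fun i _ => ?_
    rw [Finset.mul_sum]
    exact Finset.sum_congr rfl fun j _ => by ring

end OnManifold

section Criticality

open Filter Topology

/-! ### The Euler--Lagrange equations of the two variational principles -/

lemma sum_mul_eq_zero_of_symm {ι : Type*} [Fintype ι] {A B : ι → ι → ℝ}
    (hA : ∀ a b, A a b + A b a = 0) (hB : ∀ a b, B a b = B b a) :
    ∑ a, ∑ b, A a b * B a b = 0 := by
  have h1 : ∑ a, ∑ b, A a b * B a b = ∑ a, ∑ b, A b a * B a b := by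
    rw [Finset.sum_comm]
    exact Finset.sum_congr rfl fun a _ => Finset.sum_congr rfl fun b _ => by rw [hB b a]
  have h2 : ∑ a, ∑ b, A a b * B a b + ∑ a, ∑ b, A b a * B a b = 0 := by
    simp only [← Finset.sum_add_distrib, ← add_mul, hA, zero_mul, Finset.sum_const_zero]
  linarith

lemma isMetricVariation_zero (K : Set Coord) : IsMetricVariation K fun _ => 0 := fun a b =>
  ⟨contDiff_const, by simp, fun _ => rfl⟩

lemma isSymVariation_zero (K : Set Coord) : IsSymVariation K fun _ _ _ _ => 0 := fun c a b =>
  ⟨contDiff_const, by simp, fun _ => rfl⟩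

section Local

variable {f : ℝ → ℝ} {Q : Coord → Fin 4 → ℝ} {g g' : Coord → Matrix (Fin 4) (Fin 4) ℝ}
  {Γ : Coord → Fin 4 → Fin 4 → Fin 4 → ℝ} {y : Coord}

lemma christoffel_congr (h : g =ᶠ[𝓝 y] g') (c a b : Fin 4) :
    christoffel g y c a b = christoffel g' y c a b := by
  have hpd : ∀ e p q, pd e (fun z => g z p q) y = pd e (fun z => g' z p q) y := fun e p q =>
    pd_congr e (h.mono fun z hz => congrFun (congrFun hz p) q)
  simp only [christoffel, hpd, h.self_of_nhds]

lemma weylDefect_congr (h : g =ᶠ[𝓝 y] g') (c a b : Fin 4) :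
    weylDefect Q g Γ y c a b = weylDefect Q g' Γ y c a b := by
  simp only [weylDefect, christoffel_congr h, h.self_of_nhds]

lemma weylConstraintDensity_eq (L : Coord → Fin 4 → Fin 4 → Fin 4 → ℝ) :
    weylConstraintDensity Q g Γ L y =
      volDensity g y * ∑ c, ∑ a, ∑ b, L y c a b * weylDefect Q g Γ y c a b := rfl

lemma contDiffAt_weylDefect (hQ : ∀ a, ContDiffAt ℝ ∞ (fun z => Q z a) y) (hg : IsMetricAt g y)
    (hΓ : IsConnAt Γ y) (c a b : Fin 4) :
    ContDiffAt ℝ ∞ (fun z => weylDefect Q g Γ z c a b) y := by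
  have h := contDiffAt_weylDefect_param (gt := fun _ => g) (Γt := fun _ => Γ) (p := ((0 : ℝ), y))
    hQ (fun a b => ContDiffAt.comp (g := fun z => g z a b) _ (hg.smooth a b) contDiffAt_snd)
    hg.det_neg
    (fun c a b => ContDiffAt.comp (g := fun z => Γ z c a b) _ (hΓ.smooth c a b) contDiffAt_snd)
    c a b
  exact ContDiffAt.comp (f := fun z : Coord => ((0 : ℝ), z)) y h
    (contDiffAt_const.prodMk contDiffAt_id)

lemma weylDefect_symm (hg : IsMetricAt g y) (hΓ : IsConnAt Γ y) (c a b : Fin 4) :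
    weylDefect Q g Γ y c a b = weylDefect Q g Γ y c b a := by
  have hpds : ∀ c a b, pd c (fun z => g z a b) y = pd c (fun z => g z b a) y := fun c a b =>
    pd_congr c (hg.symm.mono fun z hz => hz a b)
  have hgs := hg.symm.self_of_nhds
  simp only [weylDefect, christoffel]
  rw [hΓ.symm.self_of_nhds c a b]
  congr 1
  · congr 2
    refine Finset.sum_congr rfl fun d _ => ?_
    rw [hpds b a d, hpds a d b, hpds d a b]
    ring
  · congr 1
    refine Finset.sum_congr rfl fun d _ => ?_
    rw [hgs a d, hgs d b, hgs a b]
    ring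

lemma gothicMetric_densityDeriv_symm (hg : IsMetricAt g y) (c a b : Fin 4) :
    densityDeriv (gothicMetric f g Γ) Γ y c a b = densityDeriv (gothicMetric f g Γ) Γ y c b a := by
  have hH : ∀ a b, gothicMetric f g Γ a b =ᶠ[𝓝 y] gothicMetric f g Γ b a := by
    intro a b
    filter_upwards [hg.symm] with z hz
    have h1 : (g z).transpose = g z := by ext i j; exact hz j i
    have h2 := congrFun (congrFun (Matrix.transpose_nonsing_inv (g z)) b) a
    rw [h1] at h2
    simp only [gothicMetric]
    rw [← h2, Matrix.transpose_apply]
  unfold densityDeriv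
  rw [pd_congr c (hH a b)]
  congr 1
  refine Finset.sum_congr rfl fun d _ => ?_
  rw [(hH d b).self_of_nhds, (hH a d).self_of_nhds, (hH a b).self_of_nhds]
  ring

end Local

section Global

variable {M : Type*} [TopologicalSpace M] [ChartedSpace Coord M] {f : ℝ → ℝ}
  {g : LorentzMetric M} {Γ : SymConnection M} {Q : OneForm M} {L : Multiplier M}

/-- `(g, Γ)` satisfies the symmetrized Euler--Lagrange equations of the Palatini action. -/
def EulerLagrangeEquations (f : ℝ → ℝ) (g : LorentzMetric M) (Γ : SymConnection M) : Prop :=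
  ∀ e, IsChart M e → ∀ y ∈ e.target,
    (∀ a b, metricEL f (g.comp e) (Γ.comp e) y a b +
      metricEL f (g.comp e) (Γ.comp e) y b a = 0) ∧
    (∀ c a b, connectionEL (gothicMetric f (g.comp e) (Γ.comp e)) (Γ.comp e) y c a b +
      connectionEL (gothicMetric f (g.comp e) (Γ.comp e)) (Γ.comp e) y c b a = 0)

lemma EulerLagrangeEquations.sum_eq_zero (h : EulerLagrangeEquations f g Γ)
    {e : OpenPartialHomeomorph M Coord} (he : IsChart M e) {K : Set Coord} {y : Coord}
    (hy : y ∈ e.target) {δg : Coord → Matrix (Fin 4) (Fin 4) ℝ}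
    {X : Coord → Fin 4 → Fin 4 → Fin 4 → ℝ}
    (hδ : IsMetricVariation K δg) (hX : IsSymVariation K X) :
    ∑ a, ∑ b, metricEL f (g.comp e) (Γ.comp e) y a b * δg y a b +
      ∑ c, ∑ a, ∑ b, connectionEL (gothicMetric f (g.comp e) (Γ.comp e)) (Γ.comp e) y c a b *
        X y c a b = 0 := by
  rw [sum_mul_eq_zero_of_symm (h e he y hy).1 fun a b => (hδ a b).2.2 y, zero_add]
  exact Finset.sum_eq_zero fun c _ => sum_mul_eq_zero_of_symm ((h e he y hy).2 c)
    fun a b => (hX c a b).2.2 y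

/-- The metric equation from stationarity under variations of the metric alone. -/
lemma metricEL_symm_eq_zero_of_critical (hf : ContDiff ℝ ∞ f)
    {e : OpenPartialHomeomorph M Coord} (he : IsChart M e)
    (h : ∀ K : Set Coord, IsCompact K → K ⊆ e.target → ∀ δg, IsMetricVariation K δg →
      HasDerivAt (fun t : ℝ => ∫ y in K, (palatiniDensity f (varyMetric (g.comp e) δg t)
        (vary (Γ.comp e) (fun _ _ _ _ => 0) t) y + 0)) 0 0) :
    ∀ y ∈ e.target, ∀ a b, metricEL f (g.comp e) (Γ.comp e) y a b +
      metricEL f (g.comp e) (Γ.comp e) y b a = 0 := by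
  refine symm_eq_zero_of_metricVariation e.open_target (fun a b y hy =>
    (contDiffAt_metricEL hf (g.isMetricAt he hy) (Γ.isConnAt he hy)
      a b).continuousAt.continuousWithinAt) fun K hK hKU δg hδ => ?_
  have h1 := hasDerivAt_action hf (fun y hy => g.isMetricAt he hy) (fun y hy => Γ.isConnAt he hy)
    hK hKU hδ (isSymVariation_zero K) (W := fun _ => 0) (fun _ _ => contDiffAt_const)
    (W' := fun _ => 0) (fun _ _ => hasDerivAt_const _ _) continuousOn_const
  have h2 := h1.unique (h K hK hKU δg hδ)
  simpa only [mul_zero, Finset.sum_const_zero, add_zero] using h2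

/-- Palatini-criticality is equivalent to the Euler--Lagrange equations. -/
lemma isPalatiniCritical_iff_eulerLagrange (hf : ContDiff ℝ ∞ f) :
    IsPalatiniCritical f g Γ ↔ EulerLagrangeEquations f g Γ := by
  constructor
  · intro h e he y hy
    refine ⟨metricEL_symm_eq_zero_of_critical hf he (fun K hK hKU δg hδ => ?_) y hy, ?_⟩
    · simpa only [add_zero] using h e he K hK hKU δg _ hδ (isSymVariation_zero K)
    refine symm_eq_zero_of_symVariation e.open_target (fun c a b z hz =>
      (contDiffAt_connectionEL (fun a b => contDiffAt_gothicMetric hf (g.isMetricAt he hz)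
        (Γ.isConnAt he hz) a b) (Γ.isConnAt he hz) c a b).continuousAt.continuousWithinAt)
      (fun K hK hKU X hX => ?_) y hy
    have h1 := hasDerivAt_action hf (fun y hy => g.isMetricAt he hy)
      (fun y hy => Γ.isConnAt he hy) hK hKU (isMetricVariation_zero K) hX (W := fun _ => 0)
      (fun _ _ => contDiffAt_const) (W' := fun _ => 0) (fun _ _ => hasDerivAt_const _ _)
      continuousOn_const
    simp only [add_zero] at h1
    have h2 := h1.unique (h e he K hK hKU _ _ (isMetricVariation_zero K) hX)
    simpa only [Matrix.zero_apply, mul_zero, Finset.sum_const_zero, zero_add] using h2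
  · intro h e he K hK hKU δg δΓ hδ hX
    have h1 := hasDerivAt_action hf (fun y hy => g.isMetricAt he hy)
      (fun y hy => Γ.isConnAt he hy) hK hKU hδ hX (W := fun _ => 0)
      (fun _ _ => contDiffAt_const) (W' := fun _ => 0) (fun _ _ => hasDerivAt_const _ _)
      continuousOn_const
    simp only [add_zero] at h1
    rwa [setIntegral_eq_zero_of_forall_eq_zero fun y hy =>
      h.sum_eq_zero he (hKU hy) hδ hX] at h1

lemma OneForm.contDiffAt (Q : OneForm M) {e : OpenPartialHomeomorph M Coord} (he : IsChart M e)
    {y : Coord} (hy : y ∈ e.target) (a : Fin 4) : ContDiffAt ℝ ∞ (fun z => Q.comp e z a) y :=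
  (Q.smooth e he a).contDiffAt (e.open_target.mem_nhds hy)

lemma Multiplier.contDiffAt (L : Multiplier M) {e : OpenPartialHomeomorph M Coord}
    (he : IsChart M e) {y : Coord} (hy : y ∈ e.target) (c a b : Fin 4) :
    ContDiffAt ℝ ∞ (fun z => L.comp e z c a b) y :=
  (L.smooth e he c a b).contDiffAt (e.open_target.mem_nhds hy)

/-- The consequences of stationarity under variations of the connection and of the
multiplier, at fixed metric. -/
lemma IsConstrainedCritical.setIntegral_eq_zero (hf : ContDiff ℝ ∞ f)
    (h : IsConstrainedCritical f Q g Γ L) {e : OpenPartialHomeomorph M Coord} (he : IsChart M e)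
    {K : Set Coord} (hK : IsCompact K) (hKU : K ⊆ e.target)
    {X Y : Coord → Fin 4 → Fin 4 → Fin 4 → ℝ} (hX : IsSymVariation K X)
    (hY : IsSymVariation K Y) :
    ∫ y in K, (∑ c, ∑ a, ∑ b,
        connectionEL (gothicMetric f (g.comp e) (Γ.comp e)) (Γ.comp e) y c a b * X y c a b +
      volDensity (g.comp e) y * ∑ c, ∑ a, ∑ b, (L.comp e y c a b * X y c a b +
        Y y c a b * weylDefect (Q.comp e) (g.comp e) (Γ.comp e) y c a b)) = 0 := by
  have hg := fun y (hy : y ∈ K) => g.isMetricAt he (hKU hy)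
  have hΓ := fun y (hy : y ∈ K) => Γ.isConnAt he (hKU hy)
  have h1 := hasDerivAt_action hf hg hΓ hK subset_rfl (isMetricVariation_zero K) hX
    (W := fun q => weylConstraintDensity (Q.comp e) (varyMetric (g.comp e) (fun _ => 0) q.1)
      (vary (Γ.comp e) X q.1) (vary (L.comp e) Y q.1) q.2)
    (fun y hy => contDiffAt_weylConstraintDensity_param
      (gt := varyMetric (g.comp e) fun _ => 0) (Γt := vary (Γ.comp e) X)
      (Lt := vary (L.comp e) Y) (p := ((0 : ℝ), y)) (Q.contDiffAt he (hKU hy))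
      ((hg y hy).contDiffAt_varyMetric fun _ _ => contDiffAt_const)
      (hg y hy).det_varyMetric_zero
      (contDiffAt_vary (hΓ y hy).smooth fun c a b => (hX c a b).1.contDiffAt)
      (contDiffAt_vary (L.contDiffAt he (hKU hy)) fun c a b => (hY c a b).1.contDiffAt))
    (W' := fun y => volDensity (g.comp e) y * ∑ c, ∑ a, ∑ b, (L.comp e y c a b * X y c a b +
        Y y c a b * weylDefect (Q.comp e) (g.comp e) (Γ.comp e) y c a b))
    (fun y hy => ?_) (fun y hy => ?_)
  · have h2 := h1.unique (h e he K hK hKU _ X Y (isMetricVariation_zero K) hX hY)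
    simpa only [Matrix.zero_apply, mul_zero, Finset.sum_const_zero, zero_add] using h2
  · have hfun : (fun t => weylConstraintDensity (Q.comp e)
        (varyMetric (g.comp e) (fun _ => 0) t) (vary (Γ.comp e) X t) (vary (L.comp e) Y t) y) =
        fun t => volDensity (g.comp e) y * ∑ c, ∑ a, ∑ b,
          (L.comp e y c a b + t * Y y c a b) *
            (weylDefect (Q.comp e) (g.comp e) (Γ.comp e) y c a b + t * X y c a b) := by
      funext t
      have hev := varyMetric_zero_variation_eventuallyEq (hg y hy) t
      have hv : volDensity (varyMetric (g.comp e) (fun _ => 0) t) y = volDensity (g.comp e) y := by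
        simp only [volDensity, hev.self_of_nhds]
      rw [weylConstraintDensity_eq, hv]
      simp only [weylDefect_congr hev]
      congr 1
      refine Finset.sum_congr rfl fun c _ => Finset.sum_congr rfl fun a _ =>
        Finset.sum_congr rfl fun b _ => ?_
      simp only [vary, weylDefect]
      ring
    simp only [hfun]
    refine HasDerivAt.const_mul _ (HasDerivAt.fun_sum fun c _ => HasDerivAt.fun_sum fun a _ =>
      HasDerivAt.fun_sum fun b _ => ?_)
    have hlin : ∀ r s : ℝ, HasDerivAt (fun t : ℝ => r + t * s) s 0 := fun r s => by
      simpa using ((hasDerivAt_id (0 : ℝ)).mul_const s).const_add r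
    have h3 := (hlin (L.comp e y c a b) (Y y c a b)).fun_mul
      (hlin (weylDefect (Q.comp e) (g.comp e) (Γ.comp e) y c a b) (X y c a b))
    convert! h3 using 1
    ring
  · refine ContinuousAt.continuousWithinAt (ContDiffAt.continuousAt (𝕜 := ℝ) (n := ∞) ?_)
    exact (hg y hy).contDiffAt_volDensity.mul (ContDiffAt.sum fun c _ => ContDiffAt.sum fun a _ =>
      ContDiffAt.sum fun b _ => ((L.contDiffAt he (hKU hy) c a b).mul
        (hX c a b).1.contDiffAt).add ((hY c a b).1.contDiffAt.mul
          (contDiffAt_weylDefect (Q.contDiffAt he (hKU hy)) (hg y hy) (hΓ y hy) c a b)))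

/-- The variation of the multiplier returns the Weyl constraint. -/
lemma IsConstrainedCritical.weylDefect_eq_zero (hf : ContDiff ℝ ∞ f)
    (h : IsConstrainedCritical f Q g Γ L) {e : OpenPartialHomeomorph M Coord} (he : IsChart M e)
    {y : Coord} (hy : y ∈ e.target) (c a b : Fin 4) :
    weylDefect (Q.comp e) (g.comp e) (Γ.comp e) y c a b = 0 := by
  have h1 := symm_eq_zero_of_symVariation e.open_target (A := fun y c a b =>
      volDensity (g.comp e) y * weylDefect (Q.comp e) (g.comp e) (Γ.comp e) y c a b)
    (fun c a b z hz => ((g.isMetricAt he hz).contDiffAt_volDensity.mul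
      (contDiffAt_weylDefect (Q.contDiffAt he hz) (g.isMetricAt he hz) (Γ.isConnAt he hz)
        c a b)).continuousAt.continuousWithinAt)
    (fun K hK hKU Y hY => by
      rw [← h.setIntegral_eq_zero hf he hK hKU (isSymVariation_zero K) hY]
      refine setIntegral_congr_fun hK.measurableSet fun z _ => ?_
      simp only [mul_zero, Finset.sum_const_zero, zero_add, Finset.mul_sum]
      exact Finset.sum_congr rfl fun c _ => Finset.sum_congr rfl fun a _ =>
        Finset.sum_congr rfl fun b _ => by ring) y hy c a b
  rw [weylDefect_symm (g.isMetricAt he hy) (Γ.isConnAt he hy) c b a] at h1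
  have hv := (g.isMetricAt he hy).volDensity_pos
  have h2 : volDensity (g.comp e) y *
      weylDefect (Q.comp e) (g.comp e) (Γ.comp e) y c a b = 0 := by linarith
  exact (mul_eq_zero.1 h2).resolve_left hv.ne'

/-- The variation of the connection determines the multiplier. -/
lemma IsConstrainedCritical.connectionEL_add (hf : ContDiff ℝ ∞ f)
    (h : IsConstrainedCritical f Q g Γ L) {e : OpenPartialHomeomorph M Coord} (he : IsChart M e)
    {y : Coord} (hy : y ∈ e.target) (c a b : Fin 4) :
    connectionEL (gothicMetric f (g.comp e) (Γ.comp e)) (Γ.comp e) y c a b +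
      connectionEL (gothicMetric f (g.comp e) (Γ.comp e)) (Γ.comp e) y c b a +
      2 * (volDensity (g.comp e) y * L.comp e y c a b) = 0 := by
  have h1 := symm_eq_zero_of_symVariation e.open_target (A := fun y c a b =>
      connectionEL (gothicMetric f (g.comp e) (Γ.comp e)) (Γ.comp e) y c a b +
      volDensity (g.comp e) y * L.comp e y c a b)
    (fun c a b z hz => ((contDiffAt_connectionEL (fun a b => contDiffAt_gothicMetric hf
        (g.isMetricAt he hz) (Γ.isConnAt he hz) a b) (Γ.isConnAt he hz) c a b).add
      ((g.isMetricAt he hz).contDiffAt_volDensity.mul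
        (L.contDiffAt he hz c a b))).continuousAt.continuousWithinAt)
    (fun K hK hKU X hX => by
      rw [← h.setIntegral_eq_zero hf he hK hKU hX (isSymVariation_zero K)]
      refine setIntegral_congr_fun hK.measurableSet fun z _ => ?_
      simp only [zero_mul, add_zero, Finset.mul_sum, ← Finset.sum_add_distrib]
      exact Finset.sum_congr rfl fun c _ => Finset.sum_congr rfl fun a _ =>
        Finset.sum_congr rfl fun b _ => by ring) y hy c a b
  rw [L.symm e he y hy c b a] at h1
  linarith

/-- With vanishing multiplier, the constrained equations contain the Palatini equations. -/
lemma IsConstrainedCritical.isPalatiniCritical (hf : ContDiff ℝ ∞ f)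
    (h : IsConstrainedCritical f Q g Γ L) (hL : L.IsZero) : IsPalatiniCritical f g Γ := by
  rw [isPalatiniCritical_iff_eulerLagrange hf]
  intro e he y hy
  refine ⟨metricEL_symm_eq_zero_of_critical hf he (fun K hK hKU δg hδ => ?_) y hy,
    fun c a b => ?_⟩
  · have h1 := h e he K hK hKU δg _ _ hδ (isSymVariation_zero K) (isSymVariation_zero K)
    refine h1.congr_of_eventuallyEq (Eventually.of_forall fun t => ?_)
    refine setIntegral_congr_fun hK.measurableSet fun z hz => ?_
    simp only [weylConstraintDensity, vary, hL e he z (hKU hz), mul_zero, add_zero, zero_mul,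
      Finset.sum_const_zero]
  · have h1 := h.connectionEL_add hf he hy c a b
    rw [hL e he y hy c a b] at h1
    linarith

/-- A Palatini-critical pair that satisfies the Weyl constraint is constrained critical, with
vanishing multiplier. -/
lemma IsPalatiniCritical.isConstrainedCritical (hf : ContDiff ℝ ∞ f)
    (h : IsPalatiniCritical f g Γ)
    (hQ : ∀ e, IsChart M e → ∀ y ∈ e.target, ∀ c a b,
      weylDefect (Q.comp e) (g.comp e) (Γ.comp e) y c a b = 0) :
    IsConstrainedCritical f Q g Γ (Multiplier.zeroField M) := by
  rw [isPalatiniCritical_iff_eulerLagrange hf] at h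
  intro e he K hK hKU δg X Y hδ hX hY
  have hg := fun y (hy : y ∈ K) => g.isMetricAt he (hKU hy)
  have hΓ := fun y (hy : y ∈ K) => Γ.isConnAt he (hKU hy)
  have hsm : ∀ Z : ℝ → Coord → Fin 4 → Fin 4 → Fin 4 → ℝ, ∀ y ∈ K,
      (∀ c a b, ContDiffAt ℝ ∞ (fun q : ℝ × Coord => Z q.1 q.2 c a b) (0, y)) →
      ContDiffAt ℝ ∞ (fun q : ℝ × Coord => weylConstraintDensity (Q.comp e)
        (varyMetric (g.comp e) δg q.1) (vary (Γ.comp e) X q.1) (Z q.1) q.2) (0, y) :=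
    fun Z y hy hZ => contDiffAt_weylConstraintDensity_param
      (gt := varyMetric (g.comp e) δg) (Γt := vary (Γ.comp e) X)
      (Lt := Z) (p := ((0 : ℝ), y)) (Q.contDiffAt he (hKU hy))
      ((hg y hy).contDiffAt_varyMetric fun a b => (hδ a b).1.contDiffAt)
      (hg y hy).det_varyMetric_zero
      (contDiffAt_vary (hΓ y hy).smooth fun c a b => (hX c a b).1.contDiffAt) hZ
  have h1 := hasDerivAt_action hf hg hΓ hK subset_rfl hδ hX
    (W := fun q => weylConstraintDensity (Q.comp e) (varyMetric (g.comp e) δg q.1)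
      (vary (Γ.comp e) X q.1) (vary ((Multiplier.zeroField M).comp e) Y q.1) q.2)
    (fun y hy => hsm _ y hy (contDiffAt_vary (fun _ _ _ => contDiffAt_const)
      fun c a b => (hY c a b).1.contDiffAt))
    (W' := fun _ => 0) (fun y hy => ?_) continuousOn_const
  · rwa [setIntegral_eq_zero_of_forall_eq_zero fun y hy => by
      rw [add_zero]; exact h.sum_eq_zero he (hKU hy) hδ hX] at h1
  · -- the constraint density is `t` times a function that vanishes at `t = 0`
    set P : ℝ → ℝ := fun t => weylConstraintDensity (Q.comp e) (varyMetric (g.comp e) δg t)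
      (vary (Γ.comp e) X t) Y y with hP
    have hfun : (fun t => weylConstraintDensity (Q.comp e) (varyMetric (g.comp e) δg t)
        (vary (Γ.comp e) X t) (vary ((Multiplier.zeroField M).comp e) Y t) y) =
        fun t => t * P t := by
      funext t
      simp only [hP, weylConstraintDensity, vary, Multiplier.zeroField, zero_add, mul_assoc,
        ← Finset.mul_sum]
      ring
    have hPd : DifferentiableAt ℝ P 0 := by
      have h2 := (hsm (fun _ => Y) y hy fun c a b => ContDiffAt.comp (g := fun z => Y z c a b) _
        (hY c a b).1.contDiffAt contDiffAt_snd).differentiableAt (by simp)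
      exact DifferentiableAt.comp (f := fun t : ℝ => (t, y)) 0 h2
        (differentiableAt_id.prodMk (differentiableAt_const y))
    have hP0 : P 0 = 0 := by
      have hvary0 : vary (Γ.comp e) X 0 = Γ.comp e := by funext z c a b; simp [vary]
      simp only [hP, weylConstraintDensity_eq, hvary0,
        weylDefect_congr (varyMetric_zero_eventuallyEq (hg y hy)), hQ e he y (hKU hy), mul_zero,
        Finset.sum_const_zero]
    simp only [hfun]
    have h3 := (hasDerivAt_id (0 : ℝ)).fun_mul hPd.hasDerivAt
    simpa [hP0] using h3

end Global

end Criticality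

section PalatiniGeometry

open Filter Topology

/-! ### The geometry of Palatini-critical pairs -/

variable {M : Type*} [TopologicalSpace M] [ChartedSpace Coord M] {f : ℝ → ℝ}
  {g : LorentzMetric M} {Γ : SymConnection M}

lemma IsMetricAt.sum_inv_mul {g : Coord → Matrix (Fin 4) (Fin 4) ℝ} {y : Coord}
    (hg : IsMetricAt g y) : ∑ a, ∑ b, (g y)⁻¹ a b * g y a b = 4 := by
  have h1 : ((g y)⁻¹ * g y).trace = 4 := by
    rw [Matrix.nonsing_inv_mul _ hg.isUnit_det, Matrix.trace_one, Fintype.card_fin]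
    norm_num
  rw [← h1]
  simp only [Matrix.trace, Matrix.diag_apply, Matrix.mul_apply]
  exact Finset.sum_congr rfl fun a _ => Finset.sum_congr rfl fun b _ => by
    rw [hg.symm.self_of_nhds a b]

lemma ricci_congr {Γ Γ' : Coord → Fin 4 → Fin 4 → Fin 4 → ℝ} {y : Coord}
    (h : Γ =ᶠ[𝓝 y] Γ') (a b : Fin 4) : ricci Γ y a b = ricci Γ' y a b := by
  have hpd : ∀ e c p q, pd e (fun z => Γ z c p q) y = pd e (fun z => Γ' z c p q) y :=
    fun e c p q =>
    pd_congr e (h.mono fun z hz => congrFun (congrFun (congrFun hz c) p) q)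
  simp only [ricci, hpd, h.self_of_nhds]

lemma metricEquation_iff : MetricEquation f g Γ ↔ ∀ e, IsChart M e → ∀ y ∈ e.target, ∀ a b,
    metricEL f (g.comp e) (Γ.comp e) y a b + metricEL f (g.comp e) (Γ.comp e) y b a = 0 := by
  refine forall_congr' fun e => forall_congr' fun he => forall_congr' fun y =>
    forall_congr' fun hy => forall_congr' fun a => forall_congr' fun b => ?_
  have hv := (g.isMetricAt he hy).volDensity_pos
  have h1 : metricEL f (g.comp e) (Γ.comp e) y a b + metricEL f (g.comp e) (Γ.comp e) y b a =
      2 * volDensity (g.comp e) y * (deriv f (localScalar (g.comp e) (Γ.comp e) y) *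
        ((ricci (Γ.comp e) y a b + ricci (Γ.comp e) y b a) / 2) -
      (1 / 2) * f (localScalar (g.comp e) (Γ.comp e) y) * g.comp e y a b) := by
    unfold metricEL
    rw [g.symm e he y hy b a]
    ring
  rw [h1, mul_eq_zero, or_iff_right (by positivity)]

lemma connectionEquation_iff : ConnectionEquation f g Γ ↔ ∀ e, IsChart M e → ∀ y ∈ e.target,
    ∀ c a b, connectionEL (gothicMetric f (g.comp e) (Γ.comp e)) (Γ.comp e) y c a b +
      connectionEL (gothicMetric f (g.comp e) (Γ.comp e)) (Γ.comp e) y c b a = 0 :=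
  forall_congr' fun _ => forall_congr' fun he => forall_congr' fun _ =>
    forall_congr' fun hy => (densityDeriv_eq_zero_iff fun c a b =>
      gothicMetric_densityDeriv_symm (g.isMetricAt he hy) c a b).symm

/-- The field equations of the Palatini variation. -/
lemma isPalatiniCritical_iff (hf : ContDiff ℝ ∞ f) :
    IsPalatiniCritical f g Γ ↔ MetricEquation f g Γ ∧ ConnectionEquation f g Γ := by
  rw [isPalatiniCritical_iff_eulerLagrange hf, metricEquation_iff, connectionEquation_iff]
  exact ⟨fun h => ⟨fun e he y hy => (h e he y hy).1, fun e he y hy => (h e he y hy).2⟩,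
    fun h e he y hy => ⟨h.1 e he y hy, h.2 e he y hy⟩⟩

/-- `∇_c g_{ab} = -∂_c Φ g_{ab}` with `Φ = ln |f'(R)|`. -/
def HasGradientNonmetricity (f : ℝ → ℝ) (g : LorentzMetric M) (Γ : SymConnection M) : Prop :=
  ∀ e, IsChart M e → ∀ y ∈ e.target, ∀ c a b, nonmetricity (g.comp e) (Γ.comp e) y c a b =
    - pd c (fun z => logConformalFactor f g Γ (e.symm z)) y * g.comp e y a b

/-- The trace equation `f'(R) R = 2 f(R)`. -/
lemma MetricEquation.trace (h : MetricEquation f g Γ) {e : OpenPartialHomeomorph M Coord}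
    (he : IsChart M e) {y : Coord} (hy : y ∈ e.target) :
    deriv f (localScalar (g.comp e) (Γ.comp e) y) * localScalar (g.comp e) (Γ.comp e) y =
      2 * f (localScalar (g.comp e) (Γ.comp e) y) := by
  have hg := g.isMetricAt he hy
  have h4 := hg.sum_inv_mul
  have hS : ∑ a, ∑ b, (g.comp e y)⁻¹ a b *
      ((ricci (Γ.comp e) y a b + ricci (Γ.comp e) y b a) / 2) =
      localScalar (g.comp e) (Γ.comp e) y := by
    have h1 : ∑ a, ∑ b, (g.comp e y)⁻¹ a b * ricci (Γ.comp e) y b a =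
        localScalar (g.comp e) (Γ.comp e) y := by
      rw [Finset.sum_comm]
      exact Finset.sum_congr rfl fun a _ => Finset.sum_congr rfl fun b _ => by rw [hg.inv_symm]
    have h2 : ∀ a b, (g.comp e y)⁻¹ a b *
        ((ricci (Γ.comp e) y a b + ricci (Γ.comp e) y b a) / 2) =
        1 / 2 * ((g.comp e y)⁻¹ a b * ricci (Γ.comp e) y a b) +
        1 / 2 * ((g.comp e y)⁻¹ a b * ricci (Γ.comp e) y b a) := fun a b => by ring
    simp only [h2, Finset.sum_add_distrib, ← Finset.mul_sum, h1]
    unfold localScalar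
    ring
  have h0 : ∑ a, ∑ b, (g.comp e y)⁻¹ a b * (deriv f (localScalar (g.comp e) (Γ.comp e) y) *
        ((ricci (Γ.comp e) y a b + ricci (Γ.comp e) y b a) / 2) -
      (1 / 2) * f (localScalar (g.comp e) (Γ.comp e) y) * g.comp e y a b) = 0 :=
    Finset.sum_eq_zero fun a _ => Finset.sum_eq_zero fun b _ => by rw [h e he y hy a b, mul_zero]
  set S := localScalar (g.comp e) (Γ.comp e) y with hSdef
  have h3 : ∀ a b, (g.comp e y)⁻¹ a b * (deriv f S *
        ((ricci (Γ.comp e) y a b + ricci (Γ.comp e) y b a) / 2) - (1 / 2) * f S * g.comp e y a b) =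
      deriv f S * ((g.comp e y)⁻¹ a b *
        ((ricci (Γ.comp e) y a b + ricci (Γ.comp e) y b a) / 2)) -
      1 / 2 * f S * ((g.comp e y)⁻¹ a b * g.comp e y a b) := fun a b => by ring
  simp only [h3, Finset.sum_sub_distrib, ← Finset.mul_sum, hS, h4] at h0
  linarith

/-- A Weyl one-form is determined by the non-metricity, because `g` does not vanish. -/
lemma isGradientOf_of_isWeylSpace {Q : OneForm M} (hQ : IsWeylSpace g Q Γ)
    (h : HasGradientNonmetricity f g Γ) : Q.IsGradientOf (logConformalFactor f g Γ) := by
  intro e he y hy c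
  have h4 := (g.isMetricAt he hy).sum_inv_mul
  have h1 : ∀ a b, Q.comp e y c * ((g.comp e y)⁻¹ a b * g.comp e y a b) =
      pd c (fun z => logConformalFactor f g Γ (e.symm z)) y *
        ((g.comp e y)⁻¹ a b * g.comp e y a b) := by
    intro a b
    have h2 := (hQ e he y hy c a b).symm.trans (h e he y hy c a b)
    linear_combination (-(g.comp e y)⁻¹ a b) * h2
  have h3 : ∑ a, ∑ b, Q.comp e y c * ((g.comp e y)⁻¹ a b * g.comp e y a b) =
      ∑ a, ∑ b, pd c (fun z => logConformalFactor f g Γ (e.symm z)) y *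
        ((g.comp e y)⁻¹ a b * g.comp e y a b) := by simp only [h1]
  simp only [← Finset.mul_sum, h4] at h3
  linarith

lemma isWeylSpace_iff_of_isGradientOf {Q : OneForm M}
    (hQ : Q.IsGradientOf (logConformalFactor f g Γ)) :
    IsWeylSpace g Q Γ ↔ HasGradientNonmetricity f g Γ := by
  refine forall_congr' fun e => forall_congr' fun he => forall_congr' fun y =>
    forall_congr' fun hy => ?_
  simp only [hQ e he y hy]
  exact Iff.rfl

lemma isWeylSpace_iff_weylDefect {Q : OneForm M} :
    IsWeylSpace g Q Γ ↔ ∀ e, IsChart M e → ∀ y ∈ e.target, ∀ c a b,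
      weylDefect (Q.comp e) (g.comp e) (Γ.comp e) y c a b = 0 :=
  forall_congr' fun _ => forall_congr' fun he => forall_congr' fun _ =>
    forall_congr' fun hy => (weylDefect_eq_zero_iff (g.isMetricAt he hy) (Γ.isConnAt he hy) _).symm

lemma IsConstrainedCritical.isWeylSpace {Q : OneForm M} {L : Multiplier M}
    (hf : ContDiff ℝ ∞ f) (h : IsConstrainedCritical f Q g Γ L) : IsWeylSpace g Q Γ :=
  isWeylSpace_iff_weylDefect.2 fun _ he _ hy => h.weylDefect_eq_zero hf he hy

variable [IsManifold (𝓡 4) ∞ M]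

lemma contDiffAt_logConformalFactor (hf : ContDiff ℝ ∞ f)
    (hf' : ∀ p : M, deriv f (scalarCurvature g Γ p) ≠ 0)
    {e : OpenPartialHomeomorph M Coord} (he : IsChart M e) {y : Coord} (hy : y ∈ e.target) :
    ContDiffAt ℝ ∞ (fun z => logConformalFactor f g Γ (e.symm z)) y := by
  have hfd : ContDiff ℝ ∞ (deriv f) := (contDiff_infty_iff_deriv.1 hf).2
  exact (hfd.contDiffAt.comp y (contDiffAt_scalarCurvature_symm g Γ he hy)).log (hf' _)

lemma pd_logConformalFactor (hf : ContDiff ℝ ∞ f)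
    (hf' : ∀ p : M, deriv f (scalarCurvature g Γ p) ≠ 0)
    {e : OpenPartialHomeomorph M Coord} (he : IsChart M e) {y : Coord} (hy : y ∈ e.target)
    (c : Fin 4) : pd c (fun z => logConformalFactor f g Γ (e.symm z)) y =
      pd c (fun z => deriv f (scalarCurvature g Γ (e.symm z))) y /
        deriv f (scalarCurvature g Γ (e.symm y)) := by
  have hfd : ContDiff ℝ ∞ (deriv f) := (contDiff_infty_iff_deriv.1 hf).2
  have hd : DifferentiableAt ℝ (fun z => deriv f (scalarCurvature g Γ (e.symm z))) y :=
    (hfd.contDiffAt.comp y (contDiffAt_scalarCurvature_symm g Γ he hy)).differentiableAt (by simp)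
  have h := pd_real_comp (φ := Real.log) c (Real.differentiableAt_log (hf' (e.symm y))) hd
  unfold logConformalFactor
  rw [h, Real.deriv_log, div_eq_inv_mul]

lemma connectionEquation_iff_hasGradientNonmetricity (hf : ContDiff ℝ ∞ f)
    (hf' : ∀ p : M, deriv f (scalarCurvature g Γ p) ≠ 0) :
    ConnectionEquation f g Γ ↔ HasGradientNonmetricity f g Γ := by
  refine forall_congr' fun e => forall_congr' fun he => forall_congr' fun y =>
    forall_congr' fun hy => forall_congr' fun c => ?_
  have hfd : ContDiff ℝ ∞ (deriv f) := (contDiff_infty_iff_deriv.1 hf).2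
  have hg := g.isMetricAt he hy
  have hu : DifferentiableAt ℝ (fun z => deriv f (localScalar (g.comp e) (Γ.comp e) z)) y :=
    (hfd.contDiffAt.comp y
      (contDiffAt_localScalar hg (Γ.isConnAt he hy))).differentiableAt (by simp)
  have hS := scalarCurvature_symm_apply g Γ he hy
  have hu0 : deriv f (localScalar (g.comp e) (Γ.comp e) y) ≠ 0 := by
    rw [← hS]; exact hf' _
  have h := gothic_equation_iff (Γ := Γ.comp e) hg hu hu0 c
  rw [pd_logConformalFactor hf hf' he hy,
    pd_congr c (comp_scalarCurvature_eventuallyEq g Γ (deriv f) he hy), hS]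
  exact h

lemma isLeviCivitaOfScaled_iff_hasGradientNonmetricity (hf : ContDiff ℝ ∞ f)
    (hf' : ∀ p : M, deriv f (scalarCurvature g Γ p) ≠ 0) :
    IsLeviCivitaOfScaled (fun p => deriv f (scalarCurvature g Γ p)) g Γ ↔
      HasGradientNonmetricity f g Γ := by
  refine forall_congr' fun e => forall_congr' fun he => forall_congr' fun y =>
    forall_congr' fun hy => ?_
  have hfd : ContDiff ℝ ∞ (deriv f) := (contDiff_infty_iff_deriv.1 hf).2
  have hd : DifferentiableAt ℝ (fun z => deriv f (scalarCurvature g Γ (e.symm z))) y :=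
    (hfd.contDiffAt.comp y (contDiffAt_scalarCurvature_symm g Γ he hy)).differentiableAt (by simp)
  simp only [pd_logConformalFactor hf hf' he hy]
  exact christoffel_smul_iff (g.isMetricAt he hy) (Γ.isConnAt he hy) hd (hf' _)

lemma HasGradientNonmetricity.ricci_symm (h : HasGradientNonmetricity f g Γ)
    (hf : ContDiff ℝ ∞ f) (hf' : ∀ p : M, deriv f (scalarCurvature g Γ p) ≠ 0)
    {e : OpenPartialHomeomorph M Coord} (he : IsChart M e) {y : Coord} (hy : y ∈ e.target)
    (a b : Fin 4) : ricci (Γ.comp e) y a b = ricci (Γ.comp e) y b a := by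
  have hfd : ContDiff ℝ ∞ (deriv f) := (contDiff_infty_iff_deriv.1 hf).2
  refine ricci_symm_of_trace_eq_gradient (Γ.isConnAt he hy)
    (ψ := fun z => Real.log (volDensity (g.comp e) z) +
      2 * Real.log (deriv f (scalarCurvature g Γ (e.symm z)))) ?_ ?_ a b
  · exact ((g.isMetricAt he hy).contDiffAt_volDensity.log
      (g.isMetricAt he hy).volDensity_pos.ne').add
      (contDiffAt_const.mul (contDiffAt_logConformalFactor hf hf' he hy))
  · filter_upwards [e.open_target.mem_nhds hy] with z hz c
    refine conn_trace_eq (g.isMetricAt he hz) ((hfd.contDiffAt.comp z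
      (contDiffAt_scalarCurvature_symm g Γ he hz)).differentiableAt (by simp)) (hf' _) fun a b => ?_
    rw [h e he z hz c a b, pd_logConformalFactor hf hf' he hz]
    rfl

/-- Where the trace equation `f'(R) R = 2 f(R)` holds on all of `M`, a function `φ(R)` is constant
as soon as `φ'(R)` is a multiple of the derivative `f''(R) R - f'(R)` of the trace equation: that
derivative annihilates the gradient of `R`. -/
lemma comp_scalarCurvature_const [ConnectedSpace M] (hf : ContDiff ℝ ∞ f)
    (htr : ∀ p, deriv f (scalarCurvature g Γ p) * scalarCurvature g Γ p =
      2 * f (scalarCurvature g Γ p)) {φ : ℝ → ℝ}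
    (hφ : ∀ p, ∃ r, HasDerivAt φ (r * (deriv (deriv f) (scalarCurvature g Γ p) *
      scalarCurvature g Γ p - deriv f (scalarCurvature g Γ p))) (scalarCurvature g Γ p)) (p q : M) :
    φ (scalarCurvature g Γ p) = φ (scalarCurvature g Γ q) := by
  have hSd : ∀ e, IsChart M e → ∀ y ∈ e.target,
      DifferentiableAt ℝ (fun z => scalarCurvature g Γ (e.symm z)) y := fun e he y hy =>
    (contDiffAt_scalarCurvature_symm g Γ he hy).differentiableAt (by simp)
  refine eq_of_forall_pd_eq_zero (u := fun p => φ (scalarCurvature g Γ p))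
    (fun e he y hy => ?_) (fun e he y hy a => ?_) p q
  · obtain ⟨r, hr⟩ := hφ (e.symm y)
    exact DifferentiableAt.comp (g := φ) y hr.differentiableAt (hSd e he y hy)
  · obtain ⟨r, hr⟩ := hφ (e.symm y)
    set R := scalarCurvature g Γ (e.symm y)
    have hfd : ContDiff ℝ ∞ (deriv f) := (contDiff_infty_iff_deriv.1 hf).2
    have h1 : HasDerivAt f (deriv f R) R :=
      (hf.differentiable (by simp)).differentiableAt.hasDerivAt
    have h2 : HasDerivAt (deriv f) (deriv (deriv f) R) R :=
      (hfd.differentiable (by simp)).differentiableAt.hasDerivAt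
    have hG : HasDerivAt (fun ρ => deriv f ρ * ρ - 2 * f ρ)
        (deriv (deriv f) R * R - deriv f R) R := by
      have h3 := (h2.fun_mul (hasDerivAt_id R)).fun_sub (h1.const_mul 2)
      convert! h3 using 1
      simp only [id_eq]
      ring
    have h4 := pd_real_comp (φ := fun ρ => deriv f ρ * ρ - 2 * f ρ) a hG.differentiableAt
      (hSd e he y hy)
    have h5 : (fun z => (fun ρ => deriv f ρ * ρ - 2 * f ρ) (scalarCurvature g Γ (e.symm z))) =
        fun _ => 0 := by
      funext z
      simp only [htr, sub_self]
    rw [h5, pd_const, hG.deriv] at h4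
    rw [pd_real_comp (φ := φ) a hr.differentiableAt (hSd e he y hy), hr.deriv, mul_assoc, ← h4,
      mul_zero]

section Critical

lemma IsPalatiniCritical.hasGradientNonmetricity
    (hf : ContDiff ℝ ∞ f)
    (hf' : ∀ p : M, deriv f (scalarCurvature g Γ p) ≠ 0) (h : IsPalatiniCritical f g Γ) :
    HasGradientNonmetricity f g Γ :=
  (connectionEquation_iff_hasGradientNonmetricity hf hf').1 ((isPalatiniCritical_iff hf).1 h).2

lemma IsPalatiniCritical.trace (hf : ContDiff ℝ ∞ f) (h : IsPalatiniCritical f g Γ) (p : M) :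
    deriv f (scalarCurvature g Γ p) * scalarCurvature g Γ p = 2 * f (scalarCurvature g Γ p) :=
  ((isPalatiniCritical_iff hf).1 h).1.trace (IsManifold.chart_mem_maximalAtlas (I := 𝓡 4)
    (n := ∞) p) ((chartAt Coord p).map_source (mem_chart_source Coord p))

/-- The metric equation solved for the Ricci tensor. -/
lemma IsPalatiniCritical.ricci_eq
    (hf : ContDiff ℝ ∞ f)
    (hf' : ∀ p : M, deriv f (scalarCurvature g Γ p) ≠ 0) (h : IsPalatiniCritical f g Γ)
    {e : OpenPartialHomeomorph M Coord} (he : IsChart M e) {y : Coord} (hy : y ∈ e.target)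
    (a b : Fin 4) : ricci (Γ.comp e) y a b =
      scalarCurvature g Γ (e.symm y) / 4 * g.comp e y a b := by
  have h1 := ((isPalatiniCritical_iff hf).1 h).1 e he y hy a b
  have h2 := h.trace hf (e.symm y)
  rw [(h.hasGradientNonmetricity hf hf').ricci_symm hf hf' he hy b a, ← scalarCurvature_symm_apply
    g Γ he hy] at h1
  refine mul_left_cancel₀ (hf' (e.symm y)) ?_
  linear_combination h1 + g.comp e y a b / 4 * (-h2)

/-- Palatini-critical pairs are Levi-Civita connections of Einstein metrics `f'(R) g`, subject to
the trace equation. -/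
lemma isPalatiniCritical_iff_einstein
    (hf : ContDiff ℝ ∞ f)
    (hf' : ∀ p : M, deriv f (scalarCurvature g Γ p) ≠ 0) [ConnectedSpace M] :
    IsPalatiniCritical f g Γ ↔
      IsLeviCivitaOfScaled (fun p => deriv f (scalarCurvature g Γ p)) g Γ ∧
      (∀ p, deriv f (scalarCurvature g Γ p) * scalarCurvature g Γ p =
        2 * f (scalarCurvature g Γ p)) ∧
      ∃ k : ℝ, ∀ e, IsChart M e → ∀ y ∈ e.target, ∀ a b,
        ricci (Γ.comp e) y a b =
          k * (deriv f (scalarCurvature g Γ (e.symm y)) * g.comp e y a b) := by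
  have hfd : ContDiff ℝ ∞ (deriv f) := (contDiff_infty_iff_deriv.1 hf).2
  rw [isLeviCivitaOfScaled_iff_hasGradientNonmetricity hf hf']
  constructor
  · intro h
    obtain ⟨p₀⟩ : Nonempty M := inferInstance
    refine ⟨h.hasGradientNonmetricity hf hf', h.trace hf, (1 / 4) * (scalarCurvature g Γ p₀ /
      deriv f (scalarCurvature g Γ p₀)), fun e he y hy a b => ?_⟩
    have hc := comp_scalarCurvature_const hf (h.trace hf) (φ := fun ρ => ρ / deriv f ρ)
      (fun p => ⟨-(1 / deriv f (scalarCurvature g Γ p) ^ 2), by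
        have h2 : HasDerivAt (deriv f) (deriv (deriv f) (scalarCurvature g Γ p))
            (scalarCurvature g Γ p) :=
          (hfd.differentiable (by simp)).differentiableAt.hasDerivAt
        convert! (hasDerivAt_id (scalarCurvature g Γ p)).fun_div h2 (hf' p) using 1
        simp only [id_eq]
        ring⟩) p₀ (e.symm y)
    rw [hc, h.ricci_eq hf hf' he hy]
    have := hf' (e.symm y)
    field_simp
  · rintro ⟨h1, h2, k, h3⟩
    refine (isPalatiniCritical_iff hf).2 ⟨fun e he y hy a b => ?_,
      (connectionEquation_iff_hasGradientNonmetricity hf hf').2 h1⟩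
    have hS := scalarCurvature_symm_apply g Γ he hy
    have h4 := (g.isMetricAt he hy).sum_inv_mul
    have h5 : localScalar (g.comp e) (Γ.comp e) y =
        4 * (k * deriv f (localScalar (g.comp e) (Γ.comp e) y)) := by
      have h6 : ∀ a b, (g.comp e y)⁻¹ a b * ricci (Γ.comp e) y a b =
          k * deriv f (localScalar (g.comp e) (Γ.comp e) y) *
            ((g.comp e y)⁻¹ a b * g.comp e y a b) := fun a b => by
        rw [h3 e he y hy, hS]; ring
      conv_lhs => unfold localScalar
      simp only [h6, ← Finset.mul_sum, h4]
      ring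
    have h7 := h2 (e.symm y)
    rw [hS] at h7
    rw [h3 e he y hy a b, h3 e he y hy b a, hS, g.symm e he y hy b a]
    linear_combination (g.comp e y a b / 4) * h7 -
      (g.comp e y a b / 4) * deriv f (localScalar (g.comp e) (Γ.comp e) y) * h5

/-- What is left of a Palatini-critical pair after the conformal transformation: an Einstein
space. -/
lemma IsPalatiniCritical.exists_gauge
    (hf : ContDiff ℝ ∞ f)
    (hf' : ∀ p : M, deriv f (scalarCurvature g Γ p) ≠ 0) [ConnectedSpace M]
    (h : IsPalatiniCritical f g Γ) :
    ∃ Q : OneForm M, IsWeylSpace g Q Γ ∧ Q.IsGradientOf (logConformalFactor f g Γ) ∧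
      ∃ (g' : LorentzMetric M) (Q' : OneForm M),
        IsWeylGaugeTransform (logConformalFactor f g Γ) g Q g' Q' ∧ Q'.IsZero ∧
        IsLeviCivita g' Γ ∧ ∃ k : ℝ, IsEinsteinSpace k g' := by
  have hfd : ContDiff ℝ ∞ (deriv f) := (contDiff_infty_iff_deriv.1 hf).2
  have hΦ : ∀ e, IsChart M e → ∀ y ∈ e.target,
      ContDiffAt ℝ ∞ (fun z => logConformalFactor f g Γ (e.symm z)) y :=
    fun e he y hy => contDiffAt_logConformalFactor hf hf' he hy
  have hN := h.hasGradientNonmetricity hf hf'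
  set Φ := logConformalFactor f g Γ with hΦdef
  have hgrad : (OneForm.grad Φ hΦ).IsGradientOf Φ := fun _ _ _ _ _ => rfl
  have hLC : IsLeviCivita (g.expScale Φ hΦ) Γ := by
    intro e he y hy
    have hd : DifferentiableAt ℝ (fun z => Φ (e.symm z)) y :=
      (hΦ e he y hy).differentiableAt (by simp)
    refine (christoffel_smul_iff (g.isMetricAt he hy) (Γ.isConnAt he hy)
      (u := fun z => Real.exp (Φ (e.symm z))) hd.exp (Real.exp_pos _).ne').2 fun c a b => ?_
    rw [hN e he y hy, pd_real_comp (φ := Real.exp) c Real.differentiableAt_exp hd, Real.deriv_exp,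
      mul_div_cancel_left₀ _ (Real.exp_pos _).ne']
  obtain ⟨p₀⟩ : Nonempty M := inferInstance
  refine ⟨OneForm.grad Φ hΦ, (isWeylSpace_iff_of_isGradientOf hgrad).2 hN, hgrad,
    g.expScale Φ hΦ, OneForm.zeroForm M,
    fun e he y hy => ⟨fun a b => rfl, fun a => (sub_self _).symm⟩, fun _ _ _ _ _ => rfl, hLC,
    (1 / 4) * (scalarCurvature g Γ p₀ * Real.exp (-Φ p₀)), fun e he y hy a b => ?_⟩
  have hev : christoffel ((g.expScale Φ hΦ).comp e) =ᶠ[𝓝 y] Γ.comp e := by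
    filter_upwards [e.open_target.mem_nhds hy] with z hz
    funext c a b
    exact (hLC e he z hz c a b).symm
  have hc := comp_scalarCurvature_const hf (h.trace hf)
    (φ := fun ρ => ρ * Real.exp (-Real.log (deriv f ρ)))
    (fun p => ⟨-(Real.exp (-Real.log (deriv f (scalarCurvature g Γ p))) /
        deriv f (scalarCurvature g Γ p)), by
      have h2 : HasDerivAt (deriv f) (deriv (deriv f) (scalarCurvature g Γ p))
          (scalarCurvature g Γ p) :=
        (hfd.differentiable (by simp)).differentiableAt.hasDerivAt
      convert! (hasDerivAt_id (scalarCurvature g Γ p)).fun_mul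
        (h2.log (hf' p)).fun_neg.exp using 1
      simp only [id_eq]
      have := hf' p
      field_simp
      ring⟩) p₀ (e.symm y)
  have hc' : scalarCurvature g Γ p₀ * Real.exp (-Φ p₀) =
      scalarCurvature g Γ (e.symm y) * Real.exp (-Φ (e.symm y)) := hc
  rw [ricci_congr hev, h.ricci_eq hf hf' he hy, hc']
  change _ = _ * (Real.exp (Φ (e.symm y)) * g.comp e y a b)
  have h6 : Real.exp (-Φ (e.symm y)) * Real.exp (Φ (e.symm y)) = 1 := by
    rw [← Real.exp_add, neg_add_cancel, Real.exp_zero]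
  linear_combination (-(scalarCurvature g Γ (e.symm y) / 4 * g.comp e y a b)) * h6

/-- If the trace equation has a totally disconnected set of roots, the scalar curvature is
constant and `g` itself is Einstein. -/
lemma IsPalatiniCritical.einstein_of_isTotallyDisconnected
    (hf : ContDiff ℝ ∞ f)
    (hf' : ∀ p : M, deriv f (scalarCurvature g Γ p) ≠ 0) [ConnectedSpace M]
    (h : IsPalatiniCritical f g Γ)
    (hroots : IsTotallyDisconnected {ρ : ℝ | deriv f ρ * ρ = 2 * f ρ}) :
    ∃ ρ : ℝ, deriv f ρ * ρ = 2 * f ρ ∧ (∀ p, scalarCurvature g Γ p = ρ) ∧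
      IsLeviCivita g Γ ∧ IsEinsteinSpace (ρ / 4) g := by
  obtain ⟨p₀⟩ : Nonempty M := inferInstance
  have hcont : Continuous (scalarCurvature g Γ) :=
    (contMDiff_of_charts fun e he y hy => contDiffAt_scalarCurvature_symm g Γ he hy).continuous
  have hsub : (Set.range (scalarCurvature g Γ)).Subsingleton :=
    hroots _ (by rintro _ ⟨p, rfl⟩; exact h.trace hf p) (isPreconnected_range hcont)
  have hR : ∀ p, scalarCurvature g Γ p = scalarCurvature g Γ p₀ := fun p =>
    hsub ⟨p, rfl⟩ ⟨p₀, rfl⟩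
  have hLC : IsLeviCivita g Γ := by
    intro e he y hy
    have h1 := (christoffel_smul_iff (g.isMetricAt he hy) (Γ.isConnAt he hy) (u := fun _ => 1)
      (differentiableAt_const _) one_ne_zero).2 fun c a b => by
        rw [h.hasGradientNonmetricity hf hf' e he y hy]
        simp only [logConformalFactor, hR, pd_const, zero_div]
    simpa only [one_smul] using h1
  refine ⟨scalarCurvature g Γ p₀, h.trace hf p₀, hR, hLC, fun e he y hy a b => ?_⟩
  have hev : christoffel (g.comp e) =ᶠ[𝓝 y] Γ.comp e := by
    filter_upwards [e.open_target.mem_nhds hy] with z hz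
    funext c a b
    exact (hLC e he z hz c a b).symm
  rw [ricci_congr hev, h.ricci_eq hf hf' he hy, hR]

end Critical

/-! ### Comparison with the constrained formalism -/

section Constrained

variable {Q : OneForm M} {L : Multiplier M}

/-- In a constrained critical point, the multiplier measures the failure of the connection
equation. -/
lemma IsConstrainedCritical.isZero_iff
    (hf : ContDiff ℝ ∞ f)
    (hf' : ∀ p : M, deriv f (scalarCurvature g Γ p) ≠ 0) (h : IsConstrainedCritical f Q g Γ L) :
    L.IsZero ↔ HasGradientNonmetricity f g Γ := by
  rw [← connectionEquation_iff_hasGradientNonmetricity hf hf', connectionEquation_iff]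
  refine forall_congr' fun e => forall_congr' fun he => forall_congr' fun y =>
    forall_congr' fun hy => forall_congr' fun c => forall_congr' fun a => forall_congr' fun b => ?_
  have h1 := h.connectionEL_add hf he hy c a b
  have hv := (g.isMetricAt he hy).volDensity_pos
  constructor
  · intro h2
    rw [h2] at h1
    linarith
  · intro h2
    rw [h2, zero_add] at h1
    have h3 : volDensity (g.comp e) y * L.comp e y c a b = 0 := by linarith
    exact (mul_eq_zero.1 h3).resolve_left hv.ne'

lemma IsConstrainedCritical.isGradientOf_iff_isZero
    (hf : ContDiff ℝ ∞ f)
    (hf' : ∀ p : M, deriv f (scalarCurvature g Γ p) ≠ 0) (h : IsConstrainedCritical f Q g Γ L) :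
    Q.IsGradientOf (logConformalFactor f g Γ) ↔ L.IsZero := by
  rw [h.isZero_iff hf hf']
  exact ⟨fun hQ => (isWeylSpace_iff_of_isGradientOf hQ).1 (h.isWeylSpace hf),
    fun hN => isGradientOf_of_isWeylSpace (h.isWeylSpace hf) hN⟩

lemma IsConstrainedCritical.isPalatiniCritical_iff_isGradientOf
    (hf : ContDiff ℝ ∞ f)
    (hf' : ∀ p : M, deriv f (scalarCurvature g Γ p) ≠ 0)
    (h : IsConstrainedCritical f Q g Γ L) :
    IsPalatiniCritical f g Γ ↔ Q.IsGradientOf (logConformalFactor f g Γ) :=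
  ⟨fun hP => isGradientOf_of_isWeylSpace (h.isWeylSpace hf) (hP.hasGradientNonmetricity hf hf'),
    fun hQ => h.isPalatiniCritical hf ((h.isGradientOf_iff_isZero hf hf').1 hQ)⟩

lemma isPalatiniCritical_iff_exists_constrained
    (hf : ContDiff ℝ ∞ f)
    (hf' : ∀ p : M, deriv f (scalarCurvature g Γ p) ≠ 0)
    (hQ : Q.IsGradientOf (logConformalFactor f g Γ)) :
    IsPalatiniCritical f g Γ ↔ ∃ L : Multiplier M, IsConstrainedCritical f Q g Γ L :=
  ⟨fun h => ⟨_, h.isConstrainedCritical hf (isWeylSpace_iff_weylDefect.1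
      ((isWeylSpace_iff_of_isGradientOf hQ).2 (h.hasGradientNonmetricity hf hf')))⟩,
    fun ⟨_, h⟩ => (h.isPalatiniCritical_iff_isGradientOf hf hf').2 hQ⟩

end Constrained

end PalatiniGeometry

theorem mainTheorem2 {M : Type*} [TopologicalSpace M] [ChartedSpace Coord M]
    [IsManifold (𝓡 4) ∞ M] [ConnectedSpace M]
    (f : ℝ → ℝ) (hf : ContDiff ℝ ∞ f)
    (g : LorentzMetric M) (Γ : SymConnection M)
    (hf' : ∀ p : M, deriv f (scalarCurvature g Γ p) ≠ 0) :
    -- the field equations of the unconstrained variation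
    (IsPalatiniCritical f g Γ ↔ MetricEquation f g Γ ∧ ConnectionEquation f g Γ) ∧
    -- they say: `Γ` is the Levi-Civita connection of the Einstein metric `f'(R) g`,
    -- together with the trace equation
    (IsPalatiniCritical f g Γ ↔
      IsLeviCivitaOfScaled (fun p => deriv f (scalarCurvature g Γ p)) g Γ ∧
      (∀ p, deriv f (scalarCurvature g Γ p) * scalarCurvature g Γ p =
        2 * f (scalarCurvature g Γ p)) ∧
      ∃ k : ℝ, ∀ e, IsChart M e → ∀ y ∈ e.target, ∀ a b,
        ricci (Γ.comp e) y a b =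
          k * (deriv f (scalarCurvature g Γ (e.symm y)) * g.comp e y a b)) ∧
    -- the apparent Weyl one-form is the gradient of `ln |f'(R)|`; it is gauged away, and what
    -- remains is an Einstein space
    ContMDiff (𝓡 4) 𝓘(ℝ, ℝ) ∞ (logConformalFactor f g Γ) ∧
    (IsPalatiniCritical f g Γ →
      (∃ Q : OneForm M, IsWeylSpace g Q Γ ∧ Q.IsGradientOf (logConformalFactor f g Γ) ∧
        ∃ (g' : LorentzMetric M) (Q' : OneForm M),
          IsWeylGaugeTransform (logConformalFactor f g Γ) g Q g' Q' ∧ Q'.IsZero ∧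
          IsLeviCivita g' Γ ∧ ∃ k : ℝ, IsEinsteinSpace k g') ∧
      -- if the trace equation has only isolated roots (or just a totally disconnected set of
      -- them), then `R` is one of the roots and `g` itself is Einstein
      (IsTotallyDisconnected {ρ : ℝ | deriv f ρ * ρ = 2 * f ρ} →
        ∃ ρ : ℝ, deriv f ρ * ρ = 2 * f ρ ∧ (∀ p, scalarCurvature g Γ p = ρ) ∧
          IsLeviCivita g Γ ∧ IsEinsteinSpace (ρ / 4) g)) ∧
    -- the Palatini method is the special choice `Q = d ln |f'(R)|` of the constrained formalism
    (∃ Q : OneForm M, Q.IsGradientOf (logConformalFactor f g Γ)) ∧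
    (∀ Q : OneForm M, Q.IsGradientOf (logConformalFactor f g Γ) →
      (IsPalatiniCritical f g Γ ↔ ∃ L : Multiplier M, IsConstrainedCritical f Q g Γ L)) ∧
    (∀ (Q : OneForm M) (L : Multiplier M), IsConstrainedCritical f Q g Γ L →
      (IsPalatiniCritical f g Γ ↔ Q.IsGradientOf (logConformalFactor f g Γ)) ∧
      (Q.IsGradientOf (logConformalFactor f g Γ) ↔ L.IsZero)) ∧
    -- it cannot describe genuine Weyl spaces
    (∀ Q : OneForm M, IsWeylSpace g Q Γ → IsPalatiniCritical f g Γ →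
      Q.IsGradientOf (logConformalFactor f g Γ)) ∧
    (∀ Q : OneForm M, IsWeylSpace g Q Γ →
      (¬ ∃ Φ : M → ℝ, ContMDiff (𝓡 4) 𝓘(ℝ, ℝ) ∞ Φ ∧ Q.IsGradientOf Φ) →
      ¬ IsPalatiniCritical f g Γ) := by

  have hΦ : ∀ e, IsChart M e → ∀ y ∈ e.target,
      ContDiffAt ℝ ∞ (fun z => logConformalFactor f g Γ (e.symm z)) y :=
    fun e he y hy => contDiffAt_logConformalFactor hf hf' he hy
  have hsmooth := contMDiff_of_charts hΦ
  have hweyl : ∀ Q : OneForm M, IsWeylSpace g Q Γ → IsPalatiniCritical f g Γ →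
      Q.IsGradientOf (logConformalFactor f g Γ) := fun Q hQ h =>
    isGradientOf_of_isWeylSpace hQ (h.hasGradientNonmetricity hf hf')
  exact ⟨isPalatiniCritical_iff hf, isPalatiniCritical_iff_einstein hf hf', hsmooth,
    fun h => ⟨h.exists_gauge hf hf', h.einstein_of_isTotallyDisconnected hf hf'⟩,
    ⟨OneForm.grad _ hΦ, fun _ _ _ _ _ => rfl⟩,
    fun Q hQ => isPalatiniCritical_iff_exists_constrained hf hf' hQ,
    fun Q L h => ⟨h.isPalatiniCritical_iff_isGradientOf hf hf', h.isGradientOf_iff_isZero hf hf'⟩,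
    hweyl, fun Q hQ hgen h => hgen ⟨_, hsmooth, hweyl Q hQ h⟩⟩
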